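/- **Conventions.** A *commutative Lipschitz Banach halo* is a commutative ring $R$ with a map $|\cdot|_R\colon R\to[0,\infty)$ and constants $C_R,D_R>0$ such that $|1|_R=1$ unless $R=0$; $|f|_R=0$ iff $f=0$; $|f-g|_R\le C_R\max(|f|_R,|g|_R)$; $|fg|_R\le D_R|f|_R|g|_R$; and $R$ is complete. A (Lipschitz) $R$-*module* is an $R$-module $M$ with a map $|\cdot|_M\colon M\to[0,\infty)$ and constants $0<C_M\le C_R$, $0<D_M\le D_R$ such that $|m|_M=0$ iff $m=0$; $|m-n|_M\le C_M\max(|m|_M,|n|_M)$; $|fm|_M\le D_M|f|_R|m|_M$; and $M$ is complete. Morphisms are $R$-linear maps $f\colon M\to N$ that are Lipschitz ($|f(m)|\le K|m|$ for some $K$) and satisfy $C_N\le C_M$, $D_N\le D_M$. A *commutative $R$-algebra* is a commutative Lipschitz Banach halo $S$ with a Lipschitz ring homomorphism $R\to S$, where $C_S\le C_R$, $D_S\le D_R$; the category $\mathrm{CAlg}_R$ of these has as morphisms $S\to T$ the Lipschitz $R$-algebra homomorphisms, where $C_T\le C_S$, $D_T\le D_S$. The tensor product $M\otimes_R N$ is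 the completion of the algebraic tensor product for the largest semi-norm $|\cdot|$ with $|x-y|\le C\max(|x|,|y|)$, $C=\min(C_M,C_N)$, and $|m\otimes n|\le|m|_M|n|_N$. The dual $M^\vee=\mathrm{Hom}_R(M,R)$ is the module of Lipschitz $R$-linear maps $M\to R$ with the operator norm. A *comonoid with involution* $(C,\sigma)$ over $R$ is an $R$-module $C$ with morphisms $\Delta\colon C\to C\otimes_RC$ (coassociative) and $\eta\colon C\to R$ (a two-sided counit for $\Delta$), and with a morphism $\sigma\colon C\to C$ such that $\sigma^2=1$, $\eta\sigma=\eta$ and $\Delta\sigma=\tau(\sigma\otimes\sigma)\Delta$, where $\tau$ is the flip. For a commutative $R$-algebra $S$, $C^\vee\otimes_RS$ carries the product $(f\otimes s)(g\otimes t)=((f\otimes g)\circ\Delta)\otimes st$, the unit $1=\eta\otimes1$ and the involution $\sigma_S(f\otimes s)=(f\circ\sigma)\otimes s$. For $a\in C^\vee\otimes_RS$ and $c\in C$, $a(c)\in S$ is defined by $(f\otimes s)(c)=f(c)s$, and $$\alpha_{C,S}\colon C^\vee\otimes_RS\to\mathrm{Hom}_S(C\otimes_RS,S),\qquad \alpha_{C,S}(a)(c\otimes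 s)=a(c)s,$$ where the right-hand side is the module of Lipschitz $S$-linear maps with the operator norm. (All these maps are extended by linearity and continuity.) Let $\mathrm{SIso}(C,\sigma)(S)$ be the set of the $a\in C^\vee\otimes_RS$ with $a\,\sigma_S(a)=\sigma_S(a)\,a=1$ for which there is $D>0$ such that, for all $n\ge0$ and $c_0,\dots,c_{n-1}\in C$, $$|a(c_0)\cdots a(c_{n-1})|_S\le D\,|c_0|_C\cdots|c_{n-1}|_C .$$ This is a functor $\mathrm{SIso}(C,\sigma)\colon\mathrm{CAlg}_R\to\mathrm{Sets}$. $\mathrm{Sym}_R(C)$ is the completion of the algebraic symmetric algebra of $C$ for the largest semi-norm with $|x-y|\le C_R\max(|x|,|y|)$, $|r|\le|r|_R$ for $r\in R$, and $|c_0\cdots c_n|\le|c_0|_C\cdots|c_n|_C$ for $c_i\in C$; $\nabla\colon C\otimes_RC\to\mathrm{Sym}_R(C)$ is the morphism $c\otimes d\mapsto cd$. **Proposition.** Let $R$ be a commutative Lipschitz Banach halo and $(C,\sigma)$ a comonoid with involution over $R$ such that, for every commutative $R$-algebra $S$, $\alpha_{C,S}$ is an isomorphism (bijective and Lipschitz in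 both directions). Then $\mathrm{SIso}(C,\sigma)$ is represented by $$\mathcal A=\mathrm{Sym}_R(C)\big/\,\overline{\big(\nabla((1\otimes\sigma)(\Delta(c)))-\eta(c)\;:\;c\in C\big)},$$ the quotient by the closure of the ideal generated by the displayed elements. Precisely: there is a norm on the $R$-algebra $\mathcal A$, equivalent to the quotient norm, for which $\mathcal A$ is a commutative $R$-algebra in the above sense with constants $C_{\mathcal A}=C_R$, $D_{\mathcal A}=D_R$; and there are bijections, natural in $S\in\mathrm{CAlg}_R$, $$\mathrm{Hom}_{\mathrm{CAlg}_R}(\mathcal A,S)\;\xrightarrow{\ \sim\ }\;\mathrm{SIso}(C,\sigma)(S),$$ which send $\varphi$ to an $a$ with $a(c)=\varphi([c])$ for all $c\in C$. -/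

import Mathlib

universe u

noncomputable section

namespace Halo

/-! ### Sequences for a (semi-)norm `q : X → ℝ` -/

def CauchyFor {X : Type*} [Sub X] (q : X → ℝ) (a : ℕ → X) : Prop :=
  ∀ ε > 0, ∃ N, ∀ m ≥ N, ∀ n ≥ N, q (a m - a n) < ε

def ConvergesFor {X : Type*} [Sub X] (q : X → ℝ) (a : ℕ → X) (x : X) : Prop :=
  ∀ ε > 0, ∃ N, ∀ n ≥ N, q (a n - x) < ε

end Halo

open Halo

/-- A commutative Lipschitz Banach halo `(R, |·|, (C, D))`. -/
structure LipHalo : Type (u + 1) where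
  carrier : Type u
  [commRing : CommRing carrier]
  nrm : carrier → ℝ
  C : ℝ
  D : ℝ
  C_pos : 0 < C
  D_pos : 0 < D
  nrm_nonneg : ∀ f, 0 ≤ nrm f
  nrm_one : Nontrivial carrier → nrm 1 = 1
  nrm_eq_zero : ∀ f, nrm f = 0 ↔ f = 0
  nrm_sub_le : ∀ f g, nrm (f - g) ≤ C * max (nrm f) (nrm g)
  nrm_mul_le : ∀ f g, nrm (f * g) ≤ D * nrm f * nrm g
  complete : ∀ a : ℕ → carrier, CauchyFor nrm a → ∃ x, ConvergesFor nrm a x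

instance : CoeSort LipHalo.{u} (Type u) := ⟨LipHalo.carrier⟩
attribute [instance] LipHalo.commRing

/-- A semi-normed module `(M, |·|, (C, D))` over a halo. -/
structure SNModule (R : LipHalo.{u}) : Type (u + 1) where
  carrier : Type u
  [addCommGroup : AddCommGroup carrier]
  [module : Module R.carrier carrier]
  nrm : carrier → ℝ
  C : ℝ
  D : ℝ
  C_pos : 0 < C
  D_pos : 0 < D
  nrm_nonneg : ∀ m, 0 ≤ nrm m
  nrm_zero : nrm 0 = 0
  nrm_sub_le : ∀ m n, nrm (m - n) ≤ C * max (nrm m) (nrm n)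
  nrm_smul_le : ∀ (r : R.carrier) m, nrm (r • m) ≤ D * R.nrm r * nrm m

instance (R : LipHalo.{u}) : CoeSort (SNModule R) (Type u) := ⟨SNModule.carrier⟩
attribute [instance] SNModule.addCommGroup SNModule.module

/-- A Lipschitz module `(M, |·|, (C, D))`: separated and complete.  The comparison of `(C, D)` with
the constants of `R` is not part of this structure; it is imposed where it is needed. -/
structure LipModule (R : LipHalo.{u}) : Type (u + 1) extends SNModule R where
  eq_zero_of_nrm : ∀ m, nrm m = 0 → m = 0
  complete : ∀ a : ℕ → carrier, CauchyFor nrm a → ∃ x, ConvergesFor nrm a x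

instance (R : LipHalo.{u}) : CoeSort (LipModule R) (Type u) := ⟨fun M => M.carrier⟩

namespace SNModule

variable {R : LipHalo.{u}} (X Y : SNModule R)

theorem nrm_neg_le (x : X) : X.nrm (-x) ≤ X.C * X.nrm x := by
  have := X.nrm_sub_le 0 x
  rwa [zero_sub, X.nrm_zero, max_eq_right (X.nrm_nonneg x)] at this

theorem nrm_add_le (x y : X) : X.nrm (x + y) ≤ X.C * max (X.nrm x) (X.C * X.nrm y) := by
  have := X.nrm_sub_le x (-y)
  rw [sub_neg_eq_add] at this
  exact this.trans (mul_le_mul_of_nonneg_left (max_le_max le_rfl (X.nrm_neg_le y)) X.C_pos.le)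

theorem nrm_sub_lt {x y : X} {ε : ℝ} (hx : X.nrm x < ε / X.C) (hy : X.nrm y < ε / X.C) :
    X.nrm (x - y) < ε := by
  have h := X.nrm_sub_le x y
  have := mul_lt_mul_of_pos_left (max_lt hx hy) X.C_pos
  rw [mul_div_cancel₀ _ X.C_pos.ne'] at this
  exact h.trans_lt this

/-- Lipschitz `R`-linear maps. -/
def lipMaps : Submodule R (X.carrier →ₗ[R.carrier] Y.carrier) where
  carrier := {f | ∃ K, 0 ≤ K ∧ ∀ x, Y.nrm (f x) ≤ K * X.nrm x}
  zero_mem' := ⟨0, le_rfl, fun x => by simp [Y.nrm_zero]⟩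
  add_mem' := by
    rintro f g ⟨K, hK, hf⟩ ⟨L, hL, hg⟩
    refine ⟨Y.C * max K (Y.C * L), mul_nonneg Y.C_pos.le (le_max_of_le_left hK), fun x => ?_⟩
    refine (Y.nrm_add_le (f x) (g x)).trans ?_
    rw [mul_assoc]
    refine mul_le_mul_of_nonneg_left (max_le ?_ ?_) Y.C_pos.le
    · exact (hf x).trans (mul_le_mul_of_nonneg_right (le_max_left _ _) (X.nrm_nonneg x))
    · refine (mul_le_mul_of_nonneg_left (hg x) Y.C_pos.le).trans ?_
      rw [← mul_assoc]
      exact mul_le_mul_of_nonneg_right (le_max_right _ _) (X.nrm_nonneg x)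
  smul_mem' := by
    rintro r f ⟨K, hK, hf⟩
    have h0 : 0 ≤ Y.D * R.nrm r := mul_nonneg Y.D_pos.le (R.nrm_nonneg r)
    refine ⟨Y.D * R.nrm r * K, mul_nonneg h0 hK, fun x => ?_⟩
    refine (Y.nrm_smul_le r (f x)).trans ?_
    rw [mul_assoc _ K]
    exact mul_le_mul_of_nonneg_left (hf x) h0

variable {X Y}

/-- The operator norm. -/
def opNrm (f : lipMaps X Y) : ℝ := sInf {K | 0 ≤ K ∧ ∀ x, Y.nrm (f.1 x) ≤ K * X.nrm x}

theorem opNrm_nonneg (f : lipMaps X Y) : 0 ≤ opNrm f := Real.sInf_nonneg fun _ h => h.1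

theorem opNrm_le {f : lipMaps X Y} {K : ℝ} (hK : 0 ≤ K) (h : ∀ x, Y.nrm (f.1 x) ≤ K * X.nrm x) :
    opNrm f ≤ K := csInf_le ⟨0, fun _ h => h.1⟩ ⟨hK, h⟩

theorem le_opNrm (f : lipMaps X Y) (x : X) : Y.nrm (f.1 x) ≤ opNrm f * X.nrm x := by
  obtain ⟨K, hK, hf⟩ := f.2
  rcases (X.nrm_nonneg x).eq_or_lt with h | h
  · simpa [← h] using hf x
  · rw [← div_le_iff₀ h]
    exact le_csInf ⟨K, hK, hf⟩ fun L hL => (div_le_iff₀ h).2 (hL.2 x)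

/-! ### Completion by Cauchy sequences -/

variable (X)

def cauchy : Submodule R (ℕ → X.carrier) where
  carrier := {a | CauchyFor X.nrm a}
  zero_mem' := fun ε hε => ⟨0, fun _ _ _ _ => by simpa [X.nrm_zero] using hε⟩
  add_mem' := by
    intro a b ha hb ε hε
    have hC := X.C_pos
    obtain ⟨N, hN⟩ := ha (ε / X.C) (by positivity)
    obtain ⟨M, hM⟩ := hb (ε / X.C) (by positivity)
    refine ⟨max N M, fun m hm n hn => ?_⟩
    have := X.nrm_sub_lt (hN m (le_of_max_le_left hm) n (le_of_max_le_left hn))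
      (hM n (le_of_max_le_right hn) m (le_of_max_le_right hm))
    convert this using 2
    simp only [Pi.add_apply]; abel
  smul_mem' := by
    intro r a ha ε hε
    have h0 : 0 ≤ X.D * R.nrm r := mul_nonneg X.D_pos.le (R.nrm_nonneg r)
    obtain ⟨N, hN⟩ := ha (ε / (X.D * R.nrm r + 1)) (by positivity)
    refine ⟨N, fun m hm n hn => ?_⟩
    have h1 := hN m hm n hn
    rw [lt_div_iff₀ (by positivity)] at h1
    have h2 := X.nrm_smul_le r (a m - a n)
    have h3 := X.nrm_nonneg (a m - a n)
    simp only [Pi.smul_apply, ← smul_sub]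
    nlinarith

def null : Submodule R X.cauchy where
  carrier := {a | ConvergesFor X.nrm a.1 0}
  zero_mem' := fun ε hε => ⟨0, fun _ _ => by simpa [X.nrm_zero] using hε⟩
  add_mem' := by
    intro a b ha hb ε hε
    have hC := X.C_pos
    obtain ⟨N, hN⟩ := ha (ε / X.C) (by positivity)
    obtain ⟨M, hM⟩ := hb (ε / X.C / X.C) (by positivity)
    refine ⟨max N M, fun n hn => ?_⟩
    have h1 := hN n (le_of_max_le_left hn)
    have h2 := hM n (le_of_max_le_right hn)
    have h3 := X.nrm_neg_le (b.1 n)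
    rw [sub_zero] at h1 h2
    have h4 : X.nrm (-(b.1 n)) < ε / X.C := by
      rw [lt_div_iff₀ hC] at h2
      linarith
    have := X.nrm_sub_lt h1 h4
    simpa using this
  smul_mem' := by
    intro r a ha ε hε
    have h0 : 0 ≤ X.D * R.nrm r := mul_nonneg X.D_pos.le (R.nrm_nonneg r)
    obtain ⟨N, hN⟩ := ha (ε / (X.D * R.nrm r + 1)) (by positivity)
    refine ⟨N, fun n hn => ?_⟩
    have h1 := hN n hn
    rw [sub_zero, lt_div_iff₀ (by positivity)] at h1
    have h2 := X.nrm_smul_le r (a.1 n)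
    have h3 := X.nrm_nonneg (a.1 n)
    simp only [Submodule.coe_smul, Pi.smul_apply, sub_zero]
    nlinarith

abbrev Compl : Type u := X.cauchy ⧸ X.null

/-- The norm on the completion: the infimum of `limsup |aₙ|` over the Cauchy sequences `(aₙ)` that
represent the class.  It is `lim |aₙ|` whenever the semi-norm is continuous. -/
def complNrm (ξ : X.Compl) : ℝ :=
  sInf {r | 0 ≤ r ∧ ∃ a : X.cauchy, X.null.mkQ a = ξ ∧ ∃ N, ∀ n ≥ N, X.nrm (a.1 n) ≤ r}

theorem cauchy_bdd (a : X.cauchy) : ∃ r, 0 ≤ r ∧ ∃ N, ∀ n ≥ N, X.nrm (a.1 n) ≤ r := by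
  obtain ⟨N, hN⟩ := a.2 1 one_pos
  have hC := X.C_pos
  have h0 := X.nrm_nonneg (a.1 N)
  have h0' : 0 ≤ max 1 (X.C * X.nrm (a.1 N)) := le_max_of_le_left zero_le_one
  refine ⟨X.C * max 1 (X.C * X.nrm (a.1 N)), by positivity, N, fun n hn => ?_⟩
  have := X.nrm_add_le (a.1 n - a.1 N) (a.1 N)
  rw [sub_add_cancel] at this
  exact this.trans (mul_le_mul_of_nonneg_left (max_le_max (hN n hn N le_rfl).le le_rfl) hC.le)

variable {X}

theorem complNrm_nonneg (ξ : X.Compl) : 0 ≤ X.complNrm ξ := Real.sInf_nonneg fun _ h => h.1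

theorem complNrm_le (a : X.cauchy) {r : ℝ} (hr : 0 ≤ r) {N : ℕ}
    (h : ∀ n ≥ N, X.nrm (a.1 n) ≤ r) : X.complNrm (X.null.mkQ a) ≤ r :=
  csInf_le ⟨0, fun _ h => h.1⟩ ⟨hr, a, rfl, N, h⟩

theorem exists_rep (ξ : X.Compl) {r : ℝ} (h : X.complNrm ξ < r) :
    ∃ a : X.cauchy, X.null.mkQ a = ξ ∧ ∃ N, ∀ n ≥ N, X.nrm (a.1 n) ≤ r := by
  obtain ⟨a, rfl⟩ := X.null.mkQ_surjective ξ
  obtain ⟨s, hs, N, hN⟩ := X.cauchy_bdd a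
  obtain ⟨s, ⟨-, b, hb, N, hN⟩, hsr⟩ := exists_lt_of_csInf_lt
    ⟨s, (⟨hs, a, rfl, N, hN⟩ : s ∈ {r | 0 ≤ r ∧ ∃ a' : X.cauchy, X.null.mkQ a' = X.null.mkQ a ∧
      ∃ N, ∀ n ≥ N, X.nrm (a'.1 n) ≤ r})⟩ h
  exact ⟨b, hb, N, fun n hn => (hN n hn).trans hsr.le⟩

theorem complNrm_sub_le (ξ ζ : X.Compl) :
    X.complNrm (ξ - ζ) ≤ X.C * max (X.complNrm ξ) (X.complNrm ζ) := by
  have hC := X.C_pos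
  refine le_of_forall_pos_le_add fun ε hε => ?_
  have hε' : 0 < ε / X.C := by positivity
  obtain ⟨a, rfl, N, hN⟩ := exists_rep ξ (lt_add_of_pos_right _ hε')
  obtain ⟨b, rfl, M, hM⟩ := exists_rep ζ (lt_add_of_pos_right _ hε')
  rw [← map_sub]
  have h0 := complNrm_nonneg (X.null.mkQ a)
  have h0' := le_max_of_le_left (c := X.complNrm (X.null.mkQ b)) h0
  refine complNrm_le (N := max N M) _ (by positivity) fun n hn => ?_
  refine (X.nrm_sub_le (a.1 n) (b.1 n)).trans ?_
  have h1 := max_le_max (hN n (le_of_max_le_left hn)) (hM n (le_of_max_le_right hn))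
  rw [max_add_add_right] at h1
  refine (mul_le_mul_of_nonneg_left h1 hC.le).trans ?_
  rw [mul_add, mul_div_cancel₀ _ hC.ne']

theorem complNrm_smul_le (r : R.carrier) (ξ : X.Compl) :
    X.complNrm (r • ξ) ≤ X.D * R.nrm r * X.complNrm ξ := by
  have h0 : 0 ≤ X.D * R.nrm r := mul_nonneg X.D_pos.le (R.nrm_nonneg r)
  refine le_of_forall_pos_le_add fun ε hε => ?_
  have hε' : 0 < ε / (X.D * R.nrm r + 1) := by positivity
  obtain ⟨a, rfl, N, hN⟩ := exists_rep ξ (lt_add_of_pos_right _ hε')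
  rw [← map_smul]
  have h1 := complNrm_nonneg (X.null.mkQ a)
  refine complNrm_le (N := N) _ (by positivity) fun n hn => ?_
  refine (X.nrm_smul_le r (a.1 n)).trans ((mul_le_mul_of_nonneg_left (hN n hn) h0).trans ?_)
  rw [mul_add]
  refine add_le_add le_rfl ?_
  rw [← mul_div_assoc, div_le_iff₀ (by positivity)]
  nlinarith

/-- The constant sequence. -/
def constSeq : X.carrier →ₗ[R.carrier] X.cauchy where
  toFun x := ⟨fun _ => x, fun ε hε => ⟨0, fun _ _ _ _ => by simpa [X.nrm_zero] using hε⟩⟩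
  map_add' _ _ := rfl
  map_smul' _ _ := rfl

/-- The canonical map to the completion. -/
def toCompl : X.carrier →ₗ[R.carrier] X.Compl := X.null.mkQ ∘ₗ constSeq

theorem complNrm_toCompl_le (x : X) : X.complNrm (toCompl x) ≤ X.nrm x :=
  complNrm_le (N := 0) _ (X.nrm_nonneg x) fun _ _ => le_rfl

theorem nrm_le_complNrm (x : X) : X.nrm x ≤ X.C * X.complNrm (toCompl x) := by
  have hC := X.C_pos
  refine le_of_forall_pos_le_add fun ε hε => ?_
  have hε' : 0 < ε / X.C := by positivity
  obtain ⟨a, ha, N, hN⟩ := exists_rep (toCompl x) (lt_add_of_pos_right _ hε')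
  have h1 : a - constSeq x ∈ X.null := by
    rw [← Submodule.ker_mkQ X.null, LinearMap.mem_ker, map_sub, ha]; exact sub_self _
  obtain ⟨M, hM⟩ := h1 _ hε'
  have h2 := hM (max N M) (le_max_right _ _)
  have h3 := hN (max N M) (le_max_left _ _)
  have h4 := X.nrm_sub_le (a.1 (max N M)) (a.1 (max N M) - x)
  rw [sub_sub_cancel] at h4
  have h5 : X.nrm (a.1 (max N M) - x) ≤ X.complNrm (toCompl x) + ε / X.C := by
    have := complNrm_nonneg (toCompl x)
    rw [sub_zero] at h2
    exact h2.le.trans (by linarith)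
  refine h4.trans ((mul_le_mul_of_nonneg_left (max_le h3 h5) hC.le).trans ?_)
  rw [mul_add, mul_div_cancel₀ _ hC.ne']

theorem toCompl_tendsto (a : X.cauchy) :
    ConvergesFor X.complNrm (fun n => toCompl (a.1 n)) (X.null.mkQ a) := by
  intro ε hε
  obtain ⟨N, hN⟩ := a.2 (ε / 2) (by positivity)
  refine ⟨N, fun n hn => ?_⟩
  have : toCompl (a.1 n) - X.null.mkQ a = X.null.mkQ (constSeq (a.1 n) - a) := by
    rw [map_sub]; rfl
  rw [this]
  have h := complNrm_le (constSeq (a.1 n) - a) (r := ε / 2) (by positivity) (N := N)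
    (fun m hm => (hN n hn m hm).le)
  linarith

variable (X)

/-- The completion of a semi-normed module. -/
def completion : LipModule R where
  carrier := X.Compl
  nrm := X.complNrm
  C := X.C
  D := X.D
  C_pos := X.C_pos
  D_pos := X.D_pos
  nrm_nonneg := complNrm_nonneg
  nrm_zero := le_antisymm ((complNrm_toCompl_le (0 : X)).trans_eq X.nrm_zero |>.trans' (by simp))
    (complNrm_nonneg _)
  nrm_sub_le := complNrm_sub_le
  nrm_smul_le := complNrm_smul_le
  eq_zero_of_nrm := by
    intro ξ h
    obtain ⟨a, rfl⟩ := X.null.mkQ_surjective ξ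
    rw [← LinearMap.mem_ker, Submodule.ker_mkQ]
    intro ε hε
    have hC := X.C_pos
    have hε' : 0 < ε / X.C / 2 := by positivity
    obtain ⟨b, hb, N, hN⟩ := exists_rep (X.null.mkQ a) (r := ε / X.C / 2) (by rw [h]; exact hε')
    have h1 : b - a ∈ X.null := by
      rw [← Submodule.ker_mkQ X.null, LinearMap.mem_ker, map_sub, hb, sub_self]
    obtain ⟨M, hM⟩ := h1 _ (by positivity : 0 < ε / X.C)
    refine ⟨max N M, fun n hn => ?_⟩
    have h2 := hM n (le_of_max_le_right hn)
    have h3 := hN n (le_of_max_le_left hn)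
    rw [sub_zero] at h2
    have h4 := X.nrm_sub_lt (lt_of_le_of_lt h3 (by linarith : ε / X.C / 2 < ε / X.C)) h2
    simpa using h4
  complete := by
    intro ξ hξ
    have hC := X.C_pos
    have h1 : ∀ k : ℕ, ∃ x : X, X.complNrm (toCompl x - ξ k) < 1 / ((k : ℝ) + 1) := by
      intro k
      obtain ⟨a, ha⟩ := X.null.mkQ_surjective (ξ k)
      obtain ⟨N, hN⟩ := toCompl_tendsto a (1 / ((k : ℝ) + 1)) (by positivity)
      exact ⟨a.1 N, ha ▸ hN N le_rfl⟩
    choose x hx using h1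
    have hlt : ∀ {ξ ζ : X.Compl} {δ : ℝ}, X.complNrm ξ < δ / X.C → X.complNrm ζ < δ / X.C →
        X.complNrm (ξ - ζ) < δ := by
      intro ξ ζ δ h h'
      have := mul_lt_mul_of_pos_left (max_lt h h') hC
      rw [mul_div_cancel₀ _ hC.ne'] at this
      exact (complNrm_sub_le ξ ζ).trans_lt this
    have hsmall : ∀ δ > 0, ∃ N : ℕ, ∀ n ≥ N, X.complNrm (toCompl (x n) - ξ n) < δ := by
      intro δ hδ
      obtain ⟨N, hN⟩ := exists_nat_one_div_lt hδ
      refine ⟨N, fun n hn => (hx n).trans_le (le_trans ?_ hN.le)⟩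
      have : (N : ℝ) ≤ n := by exact_mod_cast hn
      exact one_div_le_one_div_of_le (by positivity) (by linarith)
    have hneg : ∀ {ξ : X.Compl} {δ : ℝ}, X.complNrm ξ < δ / X.C → X.complNrm (-ξ) < δ := by
      intro ξ δ h
      have h0 : X.complNrm 0 = 0 := le_antisymm
        ((complNrm_toCompl_le (0 : X)).trans_eq X.nrm_zero |>.trans' (by simp)) (complNrm_nonneg _)
      have := hlt (ξ := 0) (δ := δ) (h0 ▸ (complNrm_nonneg ξ).trans_lt h) h
      rwa [zero_sub] at this
    have hcau : CauchyFor X.nrm x := by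
      intro ε hε
      obtain ⟨N, hN⟩ := hξ (ε / X.C / X.C / X.C) (by positivity)
      obtain ⟨M, hM⟩ := hsmall (ε / X.C / X.C / X.C) (by positivity)
      obtain ⟨M', hM'⟩ := hsmall (ε / X.C / X.C) (by positivity)
      refine ⟨max N (max M M'), fun m hm n hn => ?_⟩
      simp only [ge_iff_le, max_le_iff] at hm hn
      have e1 := hlt (hM n hn.2.1) (hN m hm.1 n hn.1)
      have e2 := hlt (hM' m hm.2.2) e1
      have e3 := nrm_le_complNrm (x m - x n)
      have e4 : toCompl (x m - x n) =
        (toCompl (x m) - ξ m) - ((toCompl (x n) - ξ n) - (ξ m - ξ n)) := by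
        rw [map_sub]; abel
      rw [e4] at e3
      refine e3.trans_lt ?_
      rw [lt_div_iff₀ hC] at e2
      linarith
    refine ⟨X.null.mkQ ⟨x, hcau⟩, fun ε hε => ?_⟩
    obtain ⟨N, hN⟩ := toCompl_tendsto ⟨x, hcau⟩ (ε / X.C / X.C) (by positivity)
    obtain ⟨M, hM⟩ := hsmall (ε / X.C / X.C) (by positivity)
    refine ⟨max N M, fun n hn => ?_⟩
    have e1 := hlt (hM n (le_of_max_le_right hn)) (hN n (le_of_max_le_left hn))
    have := hneg e1
    convert this using 2
    dsimp only; abel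

end SNModule

namespace LipModule

variable {R : LipHalo.{u}}

/-- Lipschitz `R`-linear maps between Lipschitz modules. -/
abbrev LipMap (M N : LipModule R) : Type u := SNModule.lipMaps M.toSNModule N.toSNModule

instance (M N : LipModule R) : CoeFun (LipMap M N) (fun _ => M.carrier → N.carrier) :=
  ⟨fun f => f.1⟩

theorem tendsto_unique (N : LipModule R) {a : ℕ → N.carrier} {x y : N}
    (hx : ConvergesFor N.nrm a x) (hy : ConvergesFor N.nrm a y) : x = y := by
  have hC := N.C_pos
  rw [← sub_eq_zero]
  refine N.eq_zero_of_nrm _ (le_antisymm (le_of_forall_pos_le_add fun ε hε => ?_) (N.nrm_nonneg _))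
  obtain ⟨n, hn⟩ := hx (ε / N.C) (by positivity)
  obtain ⟨m, hm⟩ := hy (ε / N.C) (by positivity)
  have := N.nrm_sub_lt (hm (max n m) (le_max_right _ _)) (hn (max n m) (le_max_left _ _))
  rw [sub_sub_sub_cancel_left] at this
  linarith

theorem tendsto_add (N : LipModule R) {a b : ℕ → N.carrier} {x y : N}
    (hx : ConvergesFor N.nrm a x) (hy : ConvergesFor N.nrm b y) :
    ConvergesFor N.nrm (a + b) (x + y) := by
  intro ε hε
  have hC := N.C_pos
  obtain ⟨n, hn⟩ := hx (ε / N.C) (by positivity)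
  obtain ⟨m, hm⟩ := hy (ε / N.C / N.C) (by positivity)
  refine ⟨max n m, fun k hk => ?_⟩
  have h2 := hm k (le_of_max_le_right hk)
  have h3 := N.nrm_neg_le (b k - y)
  have h4 : N.nrm (-(b k - y)) < ε / N.C := by
    rw [lt_div_iff₀ hC] at h2
    linarith
  have := N.nrm_sub_lt (hn k (le_of_max_le_left hk)) h4
  convert this using 2
  simp only [Pi.add_apply]; abel

theorem tendsto_smul (N : LipModule R) (r : R.carrier) {a : ℕ → N.carrier} {x : N}
    (hx : ConvergesFor N.nrm a x) : ConvergesFor N.nrm (r • a) (r • x) := by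
  intro ε hε
  have h0 : 0 ≤ N.D * R.nrm r := mul_nonneg N.D_pos.le (R.nrm_nonneg r)
  obtain ⟨n, hn⟩ := hx (ε / (N.D * R.nrm r + 1)) (by positivity)
  refine ⟨n, fun k hk => ?_⟩
  have h1 := hn k hk
  rw [lt_div_iff₀ (by positivity)] at h1
  have h2 := N.nrm_smul_le r (a k - x)
  have h3 := N.nrm_nonneg (a k - x)
  simp only [Pi.smul_apply, ← smul_sub]
  nlinarith

/-- A limit is bounded, up to the constant `C`, by an eventual bound of the sequence. -/
theorem nrm_limit_le (N : LipModule R) {a : ℕ → N.carrier} {x : N} (hx : ConvergesFor N.nrm a x)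
    {r : ℝ} (hr : 0 ≤ r) {n : ℕ} (h : ∀ k ≥ n, N.nrm (a k) ≤ r) : N.nrm x ≤ N.C * r := by
  have hC := N.C_pos
  refine le_of_forall_pos_le_add fun ε hε => ?_
  obtain ⟨m, hm⟩ := hx (ε / N.C) (by positivity)
  have h1 := h (max n m) (le_max_left _ _)
  have h2 := hm (max n m) (le_max_right _ _)
  have h3 := N.nrm_sub_le (a (max n m)) (a (max n m) - x)
  rw [sub_sub_cancel] at h3
  refine h3.trans ((mul_le_mul_of_nonneg_left (max_le (c := r + ε / N.C) ?_ ?_) hC.le).trans ?_)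
  · have : 0 < ε / N.C := by positivity
    linarith
  · linarith
  · rw [mul_add, mul_div_cancel₀ _ hC.ne']

/-- The module `Hom_R(M, N)` of Lipschitz linear maps with the operator norm. -/
def hom (M N : LipModule R) : LipModule R where
  carrier := LipMap M N
  nrm := SNModule.opNrm
  C := N.C
  D := N.D
  C_pos := N.C_pos
  D_pos := N.D_pos
  nrm_nonneg := SNModule.opNrm_nonneg
  nrm_zero := le_antisymm (SNModule.opNrm_le le_rfl fun x => by simp [N.nrm_zero])
    (SNModule.opNrm_nonneg _)
  nrm_sub_le := by
    intro f g
    have hf := SNModule.opNrm_nonneg f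
    have h0 := le_max_of_le_left (c := SNModule.opNrm g) hf
    have hC := N.C_pos
    refine SNModule.opNrm_le (by positivity) fun x => ?_
    refine (N.nrm_sub_le (f.1 x) (g.1 x)).trans ?_
    rw [mul_assoc, max_mul_of_nonneg _ _ (M.nrm_nonneg x)]
    exact mul_le_mul_of_nonneg_left
      (max_le_max (SNModule.le_opNrm f x) (SNModule.le_opNrm g x)) hC.le
  nrm_smul_le := by
    intro r f
    have h0 : 0 ≤ N.D * R.nrm r := mul_nonneg N.D_pos.le (R.nrm_nonneg r)
    refine SNModule.opNrm_le (mul_nonneg h0 (SNModule.opNrm_nonneg f)) fun x => ?_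
    refine (N.nrm_smul_le r (f.1 x)).trans ?_
    rw [mul_assoc _ (SNModule.opNrm f)]
    exact mul_le_mul_of_nonneg_left (SNModule.le_opNrm f x) h0
  eq_zero_of_nrm := by
    intro f hf
    refine Subtype.ext (LinearMap.ext fun x => N.eq_zero_of_nrm _ (le_antisymm ?_ (N.nrm_nonneg _)))
    have := SNModule.le_opNrm f x
    rwa [hf, zero_mul] at this
  complete := by
    intro f hf
    have hC := N.C_pos
    have hcau : ∀ x : M, CauchyFor N.nrm (fun n => (f n).1 x) := by
      intro x ε hε
      have hx := M.nrm_nonneg x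
      obtain ⟨n, hn⟩ := hf (ε / (M.nrm x + 1)) (by positivity)
      refine ⟨n, fun k hk l hl => ?_⟩
      have h1 := hn k hk l hl
      rw [lt_div_iff₀ (by positivity)] at h1
      have h2 := SNModule.le_opNrm (f k - f l) x
      have h3 := SNModule.opNrm_nonneg (f k - f l)
      refine lt_of_le_of_lt h2 ?_
      nlinarith
    choose g hg using fun x => N.complete _ (hcau x)
    let G : M.carrier →ₗ[R.carrier] N.carrier :=
      { toFun := g
        map_add' := fun x y => N.tendsto_unique (hg (x + y))
          (by simpa [Pi.add_def] using N.tendsto_add (hg x) (hg y))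
        map_smul' := fun r x => N.tendsto_unique (hg (r • x))
          (by simpa [Pi.smul_def] using N.tendsto_smul r (hg x)) }
    have key : ∀ δ > 0, ∃ n, ∀ k ≥ n, ∀ x, N.nrm (((f k).1 - G) x) ≤ δ * M.nrm x := by
      intro δ hδ
      obtain ⟨n, hn⟩ := hf (δ / N.C / N.C) (by positivity)
      refine ⟨n, fun k hk x => ?_⟩
      have hx := M.nrm_nonneg x
      have h1 : ConvergesFor N.nrm (fun l => (f l).1 x - (f k).1 x) (G x - (f k).1 x) := by
        intro ε hε
        obtain ⟨m, hm⟩ := hg x ε hε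
        refine ⟨m, fun l hl => ?_⟩
        rw [sub_sub_sub_cancel_right]
        exact hm l hl
      have h2 := N.nrm_limit_le h1 (r := δ / N.C / N.C * M.nrm x) (by positivity) (n := n)
        fun l hl => (SNModule.le_opNrm (f l - f k) x).trans
          (mul_le_mul_of_nonneg_right (hn l hl k hk).le hx)
      have h3 := N.nrm_neg_le (G x - (f k).1 x)
      rw [neg_sub] at h3
      refine h3.trans ((mul_le_mul_of_nonneg_left h2 hC.le).trans_eq ?_)
      field_simp
    have hG : G ∈ SNModule.lipMaps M.toSNModule N.toSNModule := by
      obtain ⟨n, hn⟩ := key 1 one_pos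
      have h1 : (f n).1 - G ∈ SNModule.lipMaps M.toSNModule N.toSNModule :=
        ⟨1, zero_le_one, hn n le_rfl⟩
      have := Submodule.sub_mem _ (f n).2 h1
      rwa [sub_sub_cancel] at this
    refine ⟨⟨G, hG⟩, fun ε hε => ?_⟩
    obtain ⟨n, hn⟩ := key (ε / 2) (by positivity)
    refine ⟨n, fun k hk => ?_⟩
    have : SNModule.opNrm (f k - ⟨G, hG⟩) ≤ ε / 2 :=
      SNModule.opNrm_le (by positivity) (hn k hk)
    linarith

end LipModule

namespace SNModule

variable {R : LipHalo.{u}} {X Y : SNModule R} {N P : LipModule R}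

theorem map_cauchy {f : X.carrier →ₗ[R.carrier] Y.carrier} {K : ℝ} (hK : 0 ≤ K)
    (hf : ∀ x, Y.nrm (f x) ≤ K * X.nrm x) (a : X.cauchy) : CauchyFor Y.nrm (fun n => f (a.1 n)) := by
  intro ε hε
  obtain ⟨n, hn⟩ := a.2 (ε / (K + 1)) (by positivity)
  refine ⟨n, fun k hk l hl => ?_⟩
  have h1 := hn k hk l hl
  rw [lt_div_iff₀ (by positivity)] at h1
  have h2 := hf (a.1 k - a.1 l)
  have h3 := X.nrm_nonneg (a.1 k - a.1 l)
  rw [← map_sub]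
  nlinarith

theorem extend_exists (f : lipMaps X N.toSNModule) (a : X.cauchy) :
    ∃ y, ConvergesFor N.nrm (fun n => f.1 (a.1 n)) y :=
  N.complete _ (map_cauchy (opNrm_nonneg f) (le_opNrm f) a)

/-- The limit of `f (aₙ)` for a Cauchy sequence `(aₙ)`. -/
def extendSeq (f : lipMaps X N.toSNModule) : X.cauchy →ₗ[R.carrier] N.carrier where
  toFun a := (extend_exists f a).choose
  map_add' a b := N.tendsto_unique (extend_exists f (a + b)).choose_spec (by
    simpa [Pi.add_def] using
      N.tendsto_add (extend_exists f a).choose_spec (extend_exists f b).choose_spec)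
  map_smul' r a := N.tendsto_unique (extend_exists f (r • a)).choose_spec (by
    simpa [Pi.smul_def] using N.tendsto_smul r (extend_exists f a).choose_spec)

theorem extendSeq_spec (f : lipMaps X N.toSNModule) (a : X.cauchy) :
    ConvergesFor N.nrm (fun n => f.1 (a.1 n)) (extendSeq f a) := (extend_exists f a).choose_spec

theorem null_le_ker (f : lipMaps X N.toSNModule) : X.null ≤ LinearMap.ker (extendSeq f) := by
  intro a ha
  refine N.tendsto_unique (extendSeq_spec f a) fun ε hε => ?_
  have hK := opNrm_nonneg f
  obtain ⟨n, hn⟩ := ha (ε / (opNrm f + 1)) (by positivity)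
  refine ⟨n, fun k hk => ?_⟩
  have h1 := hn k hk
  rw [sub_zero, lt_div_iff₀ (by positivity)] at h1
  have h2 := le_opNrm f (a.1 k)
  have h3 := X.nrm_nonneg (a.1 k)
  rw [sub_zero]
  nlinarith

theorem nrm_extend_le (f : lipMaps X N.toSNModule) {K : ℝ} (hK : 0 ≤ K)
    (hf : ∀ x, N.nrm (f.1 x) ≤ K * X.nrm x) (ξ : X.completion) :
    N.nrm (X.null.liftQ (extendSeq f) (null_le_ker f) ξ) ≤ N.C * K * X.completion.nrm ξ := by
  have hC := N.C_pos
  refine le_of_forall_pos_le_add fun ε hε => ?_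
  obtain ⟨a, rfl, n, hn⟩ := exists_rep ξ
    (lt_add_of_pos_right _ (by positivity : 0 < ε / (N.C * K + 1)))
  have h1 := complNrm_nonneg (X.null.mkQ a)
  refine (N.nrm_limit_le (extendSeq_spec f a) (r := K * (X.complNrm (X.null.mkQ a) +
    ε / (N.C * K + 1))) (by positivity) (n := n) fun k hk =>
      (hf _).trans (mul_le_mul_of_nonneg_left (hn k hk) hK)).trans ?_
  rw [← mul_assoc, mul_add]
  refine add_le_add le_rfl ?_
  rw [← mul_div_assoc, div_le_iff₀ (by positivity)]
  nlinarith

/-- The extension of a Lipschitz linear map to the completion. -/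
def extend (f : lipMaps X N.toSNModule) : LipModule.LipMap X.completion N :=
  ⟨X.null.liftQ (extendSeq f) (null_le_ker f), N.C * opNrm f,
    mul_nonneg N.C_pos.le (opNrm_nonneg f), nrm_extend_le f (opNrm_nonneg f) (le_opNrm f)⟩

theorem extend_toCompl (f : lipMaps X N.toSNModule) (x : X) :
    (extend f).1 (toCompl x) = f.1 x :=
  N.tendsto_unique (extendSeq_spec f (constSeq x)) fun ε hε =>
    ⟨0, fun _ _ => by simpa [constSeq, N.nrm_zero] using hε⟩

theorem completion_ext {f g : LipModule.LipMap X.completion N}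
    (h : ∀ x : X, f.1 (toCompl x) = g.1 (toCompl x)) : f = g := by
  refine Subtype.ext (LinearMap.ext fun ξ => ?_)
  obtain ⟨a, rfl⟩ := X.null.mkQ_surjective ξ
  have key : ∀ f : LipModule.LipMap X.completion N,
      ConvergesFor N.nrm (fun n => f.1 (toCompl (a.1 n))) (f.1 (X.null.mkQ a)) := by
    intro f ε hε
    have hK := opNrm_nonneg f
    obtain ⟨n, hn⟩ := toCompl_tendsto a (ε / (opNrm f + 1)) (by positivity)
    refine ⟨n, fun k hk => ?_⟩
    have h1 := hn k hk
    rw [lt_div_iff₀ (by positivity)] at h1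
    have h2 := le_opNrm f (toCompl (a.1 k) - X.null.mkQ a)
    have h3 := complNrm_nonneg (toCompl (a.1 k) - X.null.mkQ a)
    have h4 : X.completion.nrm (toCompl (a.1 k) - X.null.mkQ a) =
      X.complNrm (toCompl (a.1 k) - X.null.mkQ a) := rfl
    rw [h4] at h2
    have h5 : f.1 (toCompl (a.1 k)) - f.1 (X.null.mkQ a) =
      f.1 (toCompl (a.1 k) - X.null.mkQ a) := (map_sub f.1 _ _).symm
    dsimp only
    rw [h5]
    nlinarith
  refine N.tendsto_unique (key f) ?_
  have := key g
  simpa only [h] using this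

/-- The extension of a Lipschitz bilinear map to the completions. -/
def extend₂ (B : X.carrier →ₗ[R.carrier] Y.carrier →ₗ[R.carrier] N.carrier)
    (hB : ∃ K, 0 ≤ K ∧ ∀ x y, N.nrm (B x y) ≤ K * X.nrm x * Y.nrm y) :
    LipModule.LipMap X.completion (LipModule.hom Y.completion N) :=
  extend (N := LipModule.hom Y.completion N) ⟨
    { toFun := fun x => extend ⟨B x, hB.choose * X.nrm x,
        mul_nonneg hB.choose_spec.1 (X.nrm_nonneg x), hB.choose_spec.2 x⟩
      map_add' := fun x x' => completion_ext fun y => by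
        refine (extend_toCompl (N := N) _ y).trans ?_
        change B (x + x') y = (extend (N := N) _).1 (toCompl y) + (extend (N := N) _).1 (toCompl y)
        rw [extend_toCompl, extend_toCompl, map_add]
        rfl
      map_smul' := fun r x => completion_ext fun y => by
        refine (extend_toCompl (N := N) _ y).trans ?_
        change B (r • x) y = r • (extend (N := N) _).1 (toCompl y)
        rw [extend_toCompl, map_smul]
        rfl },
    N.C * hB.choose, mul_nonneg N.C_pos.le hB.choose_spec.1, fun x => by
      have h0 := mul_nonneg hB.choose_spec.1 (X.nrm_nonneg x)
      have hC := N.C_pos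
      refine opNrm_le (by rw [mul_assoc]; positivity) fun ξ => ?_
      have := nrm_extend_le (N := N) (⟨B x, hB.choose * X.nrm x, h0, hB.choose_spec.2 x⟩ :
        lipMaps Y N.toSNModule) h0 (hB.choose_spec.2 x) ξ
      rwa [← mul_assoc] at this⟩

theorem extend₂_toCompl (B : X.carrier →ₗ[R.carrier] Y.carrier →ₗ[R.carrier] N.carrier)
    (hB : ∃ K, 0 ≤ K ∧ ∀ x y, N.nrm (B x y) ≤ K * X.nrm x * Y.nrm y) (x : X) (y : Y) :
    ((extend₂ B hB).1 (toCompl x)).1 (toCompl y) = B x y := by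
  simp only [extend₂, extend_toCompl]
  exact extend_toCompl (N := N) _ y

end SNModule

/-! ### The largest semi-norm with constant `K` below a weight

Finite binary trees with coloured leaves.  A node stands for the difference of its two subtrees, in
accordance with the axiom `|x - y| ≤ K max(|x|, |y|)`; when the weights are invariant under `x ↦ -x`
this is the same infimum as with sums. -/

inductive BinTree (L : Type u) : Type u
  | leaf (l : L) : BinTree L
  | node (s t : BinTree L) : BinTree L

namespace BinTree

variable {L : Type u} {X : Type u} [AddCommGroup X]

def eval (v : L → X) : BinTree L → X
  | leaf l => v l
  | node s t => s.eval v - t.eval v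

def size (K : ℝ) (w : L → ℝ) : BinTree L → ℝ
  | leaf l => w l
  | node s t => K * max (s.size K w) (t.size K w)

/-- The infimum of the sizes of the trees with value `x`. -/
def treeNrm (K : ℝ) (v : L → X) (w : L → ℝ) (x : X) : ℝ :=
  sInf {r | ∃ t : BinTree L, t.eval v = x ∧ t.size K w = r}

variable {K : ℝ} {v : L → X} {w : L → ℝ}

theorem size_nonneg (hK : 0 ≤ K) (hw : ∀ l, 0 ≤ w l) (t : BinTree L) : 0 ≤ t.size K w := by
  induction t with
  | leaf l => exact hw l
  | node s t hs _ => exact mul_nonneg hK (le_max_of_le_left hs)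

theorem treeNrm_nonneg (hK : 0 ≤ K) (hw : ∀ l, 0 ≤ w l) (x : X) : 0 ≤ treeNrm K v w x :=
  Real.sInf_nonneg (by rintro _ ⟨t, -, rfl⟩; exact size_nonneg hK hw t)

theorem treeNrm_le (hK : 0 ≤ K) (hw : ∀ l, 0 ≤ w l) (t : BinTree L) :
    treeNrm K v w (t.eval v) ≤ t.size K w :=
  csInf_le ⟨0, by rintro _ ⟨t, -, rfl⟩; exact size_nonneg hK hw t⟩ ⟨t, rfl, rfl⟩

theorem exists_tree (hv : ∀ x, ∃ t : BinTree L, t.eval v = x) {x : X} {r : ℝ}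
    (h : treeNrm K v w x < r) : ∃ t : BinTree L, t.eval v = x ∧ t.size K w < r := by
  obtain ⟨t, ht⟩ := hv x
  obtain ⟨_, ⟨s, hs, rfl⟩, hr⟩ := exists_lt_of_csInf_lt
    ⟨t.size K w, (⟨t, ht, rfl⟩ : _ ∈ {r | ∃ t : BinTree L, t.eval v = x ∧ t.size K w = r})⟩ h
  exact ⟨s, hs, hr⟩

theorem treeNrm_sub_le (hK : 0 < K) (hw : ∀ l, 0 ≤ w l) (hv : ∀ x, ∃ t : BinTree L, t.eval v = x)
    (x y : X) : treeNrm K v w (x - y) ≤ K * max (treeNrm K v w x) (treeNrm K v w y) := by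
  refine le_of_forall_pos_le_add fun ε hε => ?_
  have hε' : 0 < ε / K := by positivity
  obtain ⟨s, rfl, hs⟩ := exists_tree hv (lt_add_of_pos_right (treeNrm K v w x) hε')
  obtain ⟨t, rfl, ht⟩ := exists_tree hv (lt_add_of_pos_right (treeNrm K v w y) hε')
  refine (treeNrm_le hK.le hw (node s t)).trans ?_
  have h1 := max_le_max hs.le ht.le
  rw [max_add_add_right] at h1
  refine (mul_le_mul_of_nonneg_left h1 hK.le).trans ?_
  rw [mul_add, mul_div_cancel₀ _ hK.ne']

/-- Universal property of `treeNrm`. -/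
theorem le_treeNrm {Y : Type*} [AddCommGroup Y] (hK : 0 ≤ K)
    (hv : ∀ x, ∃ t : BinTree L, t.eval v = x) (φ : X →+ Y) (q : Y → ℝ) (hq0 : ∀ y, 0 ≤ q y)
    {K' : ℝ} (hK' : K' ≤ K) (hq : ∀ y z, q (y - z) ≤ K' * max (q y) (q z)) {B : ℝ} (hB : 0 ≤ B)
    (h : ∀ l, q (φ (v l)) ≤ B * w l) (x : X) : q (φ x) ≤ B * treeNrm K v w x := by
  have key : ∀ t : BinTree L, q (φ (t.eval v)) ≤ B * t.size K w := by
    intro t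
    induction t with
    | leaf l => exact h l
    | node s t hs ht =>
      simp only [eval, size, map_sub]
      have h0 := le_max_of_le_left (c := q (φ (t.eval v))) (hq0 (φ (s.eval v)))
      refine (hq _ _).trans ((mul_le_mul hK' (max_le_max hs ht) h0 hK).trans_eq ?_)
      rw [← mul_max_of_nonneg _ _ hB]
      ring
  refine le_of_forall_pos_le_add fun ε hε => ?_
  obtain ⟨t, rfl, ht⟩ := exists_tree hv
    (lt_add_of_pos_right (treeNrm K v w x) (by positivity : 0 < ε / (B + 1)))
  refine (key t).trans ((mul_le_mul_of_nonneg_left ht.le hB).trans ?_)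
  rw [mul_add]
  refine add_le_add le_rfl ?_
  rw [← mul_div_assoc, div_le_iff₀ (by positivity)]
  nlinarith

theorem exists_eval_add (hv0 : ∃ l, v l = 0) {x y : X} (hx : ∃ t : BinTree L, t.eval v = x)
    (hy : ∃ t : BinTree L, t.eval v = y) : ∃ t : BinTree L, t.eval v = x + y := by
  obtain ⟨l, hl⟩ := hv0
  obtain ⟨s, rfl⟩ := hx
  obtain ⟨t, rfl⟩ := hy
  exact ⟨node s (node (leaf l) t), by simp [eval, hl]⟩

end BinTree

namespace LipModule

variable {R : LipHalo.{u}} (M N : LipModule R)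

open scoped TensorProduct

/-- Pure tensors. -/
def pureTensor (l : M.carrier × N.carrier) : M.carrier ⊗[R.carrier] N.carrier :=
  l.1 ⊗ₜ[R.carrier] l.2

/-- The weight `|m| |n|` of the pure tensor `m ⊗ n`. -/
def pureWeight (l : M.carrier × N.carrier) : ℝ := M.nrm l.1 * N.nrm l.2

theorem pureWeight_nonneg (l : M.carrier × N.carrier) : 0 ≤ M.pureWeight N l :=
  mul_nonneg (M.nrm_nonneg _) (N.nrm_nonneg _)

theorem exists_pure (x : M.carrier ⊗[R.carrier] N.carrier) :
    ∃ t : BinTree (M.carrier × N.carrier), t.eval (M.pureTensor N) = x := by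
  induction x with
  | zero => exact ⟨.leaf (0, 0), by simp [BinTree.eval, pureTensor]⟩
  | tmul m n => exact ⟨.leaf (m, n), rfl⟩
  | add x y hx hy => exact BinTree.exists_eval_add ⟨(0, 0), by simp [pureTensor]⟩ hx hy

/-- The algebraic tensor product with the largest semi-norm of constant `min (C_M, C_N)` for which
`|m ⊗ n| ≤ |m| |n|`. -/
def preTensor : SNModule R where
  carrier := M.carrier ⊗[R.carrier] N.carrier
  nrm := BinTree.treeNrm (min M.C N.C) (M.pureTensor N) (M.pureWeight N)
  C := min M.C N.C
  D := min M.D N.D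
  C_pos := lt_min M.C_pos N.C_pos
  D_pos := lt_min M.D_pos N.D_pos
  nrm_nonneg := BinTree.treeNrm_nonneg (lt_min M.C_pos N.C_pos).le (M.pureWeight_nonneg N)
  nrm_zero := by
    refine le_antisymm ?_ (BinTree.treeNrm_nonneg (lt_min M.C_pos N.C_pos).le
      (M.pureWeight_nonneg N) _)
    have := BinTree.treeNrm_le (v := M.pureTensor N) (lt_min M.C_pos N.C_pos).le
      (M.pureWeight_nonneg N) (.leaf (0, 0))
    simpa [BinTree.eval, BinTree.size, pureTensor, pureWeight, M.nrm_zero] using this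
  nrm_sub_le := BinTree.treeNrm_sub_le (lt_min M.C_pos N.C_pos) (M.pureWeight_nonneg N)
    (M.exists_pure N)
  nrm_smul_le := by
    intro r x
    have hK := lt_min M.C_pos N.C_pos
    have hr := R.nrm_nonneg r
    have hM := M.D_pos
    have hN := N.D_pos
    have key : ∀ d, 0 ≤ d → (∀ m n, ∃ l, M.pureTensor N l = r • M.pureTensor N (m, n) ∧
        M.pureWeight N l ≤ d * R.nrm r * M.pureWeight N (m, n)) →
        BinTree.treeNrm (min M.C N.C) (M.pureTensor N) (M.pureWeight N) (r • x) ≤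
          d * R.nrm r * BinTree.treeNrm (min M.C N.C) (M.pureTensor N) (M.pureWeight N) x := by
      intro d hd h
      refine BinTree.le_treeNrm hK.le (M.exists_pure N)
        (DistribSMul.toAddMonoidHom _ r) _ (BinTree.treeNrm_nonneg hK.le (M.pureWeight_nonneg N))
        le_rfl (BinTree.treeNrm_sub_le hK (M.pureWeight_nonneg N) (M.exists_pure N))
        (by positivity) ?_ x
      rintro ⟨m, n⟩
      obtain ⟨l, hl, hl'⟩ := h m n
      have := BinTree.treeNrm_le (v := M.pureTensor N) hK.le (M.pureWeight_nonneg N) (.leaf l)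
      simp only [BinTree.eval, BinTree.size, hl] at this
      exact this.trans hl'
    rcases min_choice M.D N.D with h | h <;> rw [h]
    · refine key _ hM.le fun m n => ⟨(r • m, n), by simp [pureTensor, TensorProduct.smul_tmul'], ?_⟩
      have := mul_le_mul_of_nonneg_right (M.nrm_smul_le r m) (N.nrm_nonneg n)
      simpa [pureWeight, mul_assoc] using this
    · refine key _ hN.le fun m n => ⟨(m, r • n), by simp [pureTensor], ?_⟩
      have := mul_le_mul_of_nonneg_left (N.nrm_smul_le r n) (M.nrm_nonneg m)
      refine this.trans_eq ?_
      simp only [pureWeight]; ring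

/-- The completed tensor product `M ⊗_R N`. -/
def tensor : LipModule R := (M.preTensor N).completion

variable {M N}

/-- The pure tensor `m ⊗ n` in the completed tensor product. -/
def tmul (m : M) (n : N) : M.tensor N := SNModule.toCompl (X := M.preTensor N) (m ⊗ₜ[R.carrier] n)

theorem preTensor_bound {P : SNModule R} (f : (M.preTensor N).carrier →ₗ[R.carrier] P.carrier)
    (hC : P.C ≤ min M.C N.C) {K : ℝ} (hK : 0 ≤ K)
    (hf : ∀ m n, P.nrm (f (m ⊗ₜ[R.carrier] n)) ≤ K * M.nrm m * N.nrm n) (x : M.preTensor N) :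
    P.nrm (f x) ≤ K * (M.preTensor N).nrm x :=
  BinTree.le_treeNrm (lt_min M.C_pos N.C_pos).le (M.exists_pure N)
    f.toAddMonoidHom P.nrm P.nrm_nonneg hC P.nrm_sub_le hK
    (fun l => (hf l.1 l.2).trans_eq (by simp only [pureWeight]; ring)) x

theorem nrm_pure_le (m : M) (n : N) :
    (M.preTensor N).nrm (m ⊗ₜ[R.carrier] n) ≤ M.nrm m * N.nrm n :=
  BinTree.treeNrm_le (v := M.pureTensor N) (lt_min M.C_pos N.C_pos).le
    (M.pureWeight_nonneg N) (.leaf (m, n))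

/-- A bilinear map is Lipschitz. -/
def BilinLip {M N P : LipModule R} (f : M.carrier →ₗ[R.carrier] N.carrier →ₗ[R.carrier] P.carrier) :
    Prop :=
  ∃ K, 0 ≤ K ∧ ∀ m n, P.nrm (f m n) ≤ K * M.nrm m * N.nrm n

variable {P : LipModule R}

/-- The map `M ⊗_R N → P` induced by a Lipschitz bilinear map. -/
def lift (f : M.carrier →ₗ[R.carrier] N.carrier →ₗ[R.carrier] P.carrier) (hf : BilinLip f)
    (hC : P.C ≤ min M.C N.C) : LipMap (M.tensor N) P :=
  SNModule.extend (X := M.preTensor N) ⟨TensorProduct.lift f, hf.choose, hf.choose_spec.1,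
    preTensor_bound _ hC hf.choose_spec.1 hf.choose_spec.2⟩

theorem lift_tmul (f : M.carrier →ₗ[R.carrier] N.carrier →ₗ[R.carrier] P.carrier)
    (hf : BilinLip f) (hC : P.C ≤ min M.C N.C) (m : M) (n : N) :
    lift f hf hC (tmul m n) = f m n :=
  SNModule.extend_toCompl (X := M.preTensor N) _ _

theorem nrm_lift_le (f : M.carrier →ₗ[R.carrier] N.carrier →ₗ[R.carrier] P.carrier)
    (hf : BilinLip f) (hC : P.C ≤ min M.C N.C) {K : ℝ} (hK : 0 ≤ K)
    (h : ∀ m n, P.nrm (f m n) ≤ K * M.nrm m * N.nrm n) (x : M.tensor N) :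
    P.nrm (lift f hf hC x) ≤ P.C * K * (M.tensor N).nrm x :=
  SNModule.nrm_extend_le (X := M.preTensor N) _ hK
    (preTensor_bound _ hC hK h) x

theorem tensor_ext {f g : LipMap (M.tensor N) P} (h : ∀ m n, f (tmul m n) = g (tmul m n)) :
    f = g := by
  refine SNModule.completion_ext (X := M.preTensor N) fun x => ?_
  have : f.1 ∘ₗ SNModule.toCompl (X := M.preTensor N) = g.1 ∘ₗ SNModule.toCompl :=
    TensorProduct.ext' h
  exact LinearMap.congr_fun this x

theorem nrm_tmul_le (m : M) (n : N) : (M.tensor N).nrm (tmul m n) ≤ M.nrm m * N.nrm n :=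
  (SNModule.complNrm_toCompl_le _).trans (nrm_pure_le m n)

/-- The bilinear map `(m, n) ↦ m ⊗ n`. -/
def mkBilin (M N : LipModule R) :
    M.carrier →ₗ[R.carrier] N.carrier →ₗ[R.carrier] (M.tensor N).carrier :=
  LinearMap.compr₂ (TensorProduct.mk R.carrier M.carrier N.carrier)
    (SNModule.toCompl (X := M.preTensor N))

theorem nrm_apply_le (f : LipMap M N) (m : M) : N.nrm (f m) ≤ SNModule.opNrm f * M.nrm m :=
  SNModule.le_opNrm f m

/-- The map `f ⊗ g`. -/
def map {M' N' : LipModule R} (f : LipMap M M') (g : LipMap N N')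
    (hC : min M'.C N'.C ≤ min M.C N.C) : LipMap (M.tensor N) (M'.tensor N') :=
  lift ((mkBilin M' N').compl₁₂ f.1 g.1)
    ⟨SNModule.opNrm f * SNModule.opNrm g,
      mul_nonneg (SNModule.opNrm_nonneg f) (SNModule.opNrm_nonneg g), fun m n =>
      (nrm_tmul_le (f m) (g n)).trans ((mul_le_mul (nrm_apply_le f m) (nrm_apply_le g n)
        (N'.nrm_nonneg _) (mul_nonneg (SNModule.opNrm_nonneg f) (M.nrm_nonneg m))).trans_eq
          (by ring))⟩ hC

theorem map_tmul {M' N' : LipModule R} (f : LipMap M M') (g : LipMap N N')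
    (hC : min M'.C N'.C ≤ min M.C N.C) (m : M) (n : N) :
    map f g hC (tmul m n) = tmul (f m) (g n) := lift_tmul _ _ _ _ _

theorem nrm_map_le {M' N' : LipModule R} (f : LipMap M M') (g : LipMap N N')
    (hC : min M'.C N'.C ≤ min M.C N.C) {K : ℝ} (hK : 0 ≤ K)
    (h : ∀ m n, M'.nrm (f m) * N'.nrm (g n) ≤ K * M.nrm m * N.nrm n) (x : M.tensor N) :
    (M'.tensor N').nrm (map f g hC x) ≤ (M'.tensor N').C * K * (M.tensor N).nrm x := by
  unfold map
  exact nrm_lift_le _ _ _ hK (fun m n => (nrm_tmul_le (f m) (g n)).trans (h m n)) x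

/-- The flip `m ⊗ n ↦ n ⊗ m`. -/
def swap (M N : LipModule R) : LipMap (M.tensor N) (N.tensor M) :=
  lift (mkBilin N M).flip ⟨1, zero_le_one, fun m n =>
    (nrm_tmul_le n m).trans_eq (by ring)⟩ (min_comm N.C M.C).le

/-- The identity of `M`. -/
def idMap (M : LipModule R) : LipMap M M := ⟨LinearMap.id, 1, zero_le_one, fun m => by simp⟩

/-- The map `M ⊗ N → M ⊗ (N ⊗ P)`, `m ⊗ n ↦ m ⊗ (n ⊗ p)`, for a fixed `p`. -/
def tmulRight (M N P : LipModule R) (p : P) : LipMap (M.tensor N) (M.tensor (N.tensor P)) :=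
  map (idMap M) ⟨(mkBilin N P).flip p, P.nrm p, P.nrm_nonneg p, fun n =>
    (nrm_tmul_le n p).trans_eq (by ring)⟩ (min_le_min le_rfl (min_le_left _ _))

theorem tmulRight_tmul (p : P) (m : M) (n : N) :
    tmulRight M N P p (tmul m n) = tmul m (tmul n p) := map_tmul _ _ _ _ _

theorem nrm_tmulRight_le (p : P) (x : M.tensor N) :
    (M.tensor (N.tensor P)).nrm (tmulRight M N P p x) ≤
      (M.tensor (N.tensor P)).C * (M.tensor N).nrm x * P.nrm p := by
  have := nrm_map_le (idMap M) (⟨(mkBilin N P).flip p, P.nrm p, P.nrm_nonneg p, fun n =>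
    (nrm_tmul_le n p).trans_eq (by ring)⟩ : LipMap N (N.tensor P))
    (min_le_min le_rfl (min_le_left _ _)) (P.nrm_nonneg p)
    (fun m n => (mul_le_mul_of_nonneg_left (nrm_tmul_le n p) (M.nrm_nonneg m)).trans_eq (by ring)) x
  exact this.trans_eq (by ring)

/-- The associativity map `(M ⊗ N) ⊗ P → M ⊗ (N ⊗ P)`. -/
def assoc (M N P : LipModule R) : LipMap ((M.tensor N).tensor P) (M.tensor (N.tensor P)) :=
  lift
    (LinearMap.mk₂ R.carrier (fun x p => tmulRight M N P p x)
      (fun x y p => map_add (tmulRight M N P p).1 x y)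
      (fun r x p => map_smul (tmulRight M N P p).1 r x)
      (fun x p p' => by
        have : tmulRight M N P (p + p') = tmulRight M N P p + tmulRight M N P p' :=
          tensor_ext fun m n => by
            change _ = tmulRight M N P p (tmul m n) + tmulRight M N P p' (tmul m n)
            simp only [tmulRight_tmul]
            exact (congrArg (mkBilin M (N.tensor P) m) (map_add (mkBilin N P n) p p')).trans
              (map_add (mkBilin M (N.tensor P) m) _ _)
        rw [this]; rfl)
      (fun r x p => by
        have : tmulRight M N P (r • p) = r • tmulRight M N P p :=
          tensor_ext fun m n => by
            change _ = r • tmulRight M N P p (tmul m n)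
            simp only [tmulRight_tmul]
            exact (congrArg (mkBilin M (N.tensor P) m) (map_smul (mkBilin N P n) r p)).trans
              (map_smul (mkBilin M (N.tensor P) m) _ _)
        rw [this]; rfl))
    ⟨_, (M.tensor (N.tensor P)).C_pos.le, fun x p => nrm_tmulRight_le p x⟩
    (min_assoc M.C N.C P.C).ge

theorem nrm_preTensor_bilin {M' N' : LipModule R}
    (b : M.carrier →ₗ[R.carrier] M.carrier →ₗ[R.carrier] M'.carrier) (hb : BilinLip b)
    (c : N.carrier →ₗ[R.carrier] N.carrier →ₗ[R.carrier] N'.carrier) (hc : BilinLip c)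
    (hC : min M'.C N'.C ≤ min M.C N.C) :
    ∃ K, 0 ≤ K ∧ ∀ x y : M.preTensor N, (M'.preTensor N').nrm (TensorProduct.map₂ b c x y) ≤
      K * (M.preTensor N).nrm x * (M.preTensor N).nrm y := by
  obtain ⟨K, hK, hb⟩ := hb
  obtain ⟨L, hL, hc⟩ := hc
  refine ⟨K * L, by positivity, fun x y => ?_⟩
  have h1 : ∀ m n, (M'.preTensor N').nrm (TensorProduct.map₂ b c (m ⊗ₜ[R.carrier] n) y) ≤
      K * L * (M.preTensor N).nrm y * M.nrm m * N.nrm n := by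
    intro m n
    have hm := M.nrm_nonneg m
    have hn := N.nrm_nonneg n
    refine (preTensor_bound (P := M'.preTensor N') (K := K * L * M.nrm m * N.nrm n)
      (TensorProduct.map₂ b c (m ⊗ₜ[R.carrier] n)) hC (by positivity) (fun m' n' => ?_) y).trans_eq
        (by ring)
    have h2 : (M'.preTensor N').nrm (TensorProduct.map₂ b c (m ⊗ₜ[R.carrier] n)
        (m' ⊗ₜ[R.carrier] n')) ≤ M'.nrm (b m m') * N'.nrm (c n n') := nrm_pure_le _ _
    have hm' := M.nrm_nonneg m'
    refine h2.trans ((mul_le_mul (hb m m') (hc n n') (N'.nrm_nonneg _)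
      (by positivity)).trans_eq (by ring))
  refine (preTensor_bound (P := M'.preTensor N') ((TensorProduct.map₂ b c).flip y) hC
    (mul_nonneg (mul_nonneg hK hL) ((M.preTensor N).nrm_nonneg y)) h1 x).trans_eq (by ring)

/-- The Lipschitz bilinear map `(m ⊗ n, m' ⊗ n') ↦ b(m, m') ⊗ c(n, n')` on `M ⊗ N`. -/
def tensorBilin {M' N' : LipModule R}
    (b : M.carrier →ₗ[R.carrier] M.carrier →ₗ[R.carrier] M'.carrier) (hb : BilinLip b)
    (c : N.carrier →ₗ[R.carrier] N.carrier →ₗ[R.carrier] N'.carrier) (hc : BilinLip c)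
    (hC : min M'.C N'.C ≤ min M.C N.C) :
    LipMap (M.tensor N) (hom (M.tensor N) (M'.tensor N')) :=
  SNModule.extend₂ (X := M.preTensor N) (Y := M.preTensor N) (N := M'.tensor N')
    ((TensorProduct.map₂ b c).compr₂ (SNModule.toCompl (X := M'.preTensor N')))
    (by
      obtain ⟨K, hK, h⟩ := nrm_preTensor_bilin b hb c hc hC
      exact ⟨K, hK, fun x y => (SNModule.complNrm_toCompl_le (X := M'.preTensor N') _).trans
        (h x y)⟩)

theorem tensorBilin_tmul {M' N' : LipModule R}
    (b : M.carrier →ₗ[R.carrier] M.carrier →ₗ[R.carrier] M'.carrier) (hb : BilinLip b)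
    (c : N.carrier →ₗ[R.carrier] N.carrier →ₗ[R.carrier] N'.carrier) (hc : BilinLip c)
    (hC : min M'.C N'.C ≤ min M.C N.C) (m m' : M) (n n' : N) :
    (tensorBilin b hb c hc hC (tmul m n)).1 (tmul m' n') = tmul (b m m') (c n n') :=
  SNModule.extend₂_toCompl (X := M.preTensor N) (Y := M.preTensor N) (N := M'.tensor N') _ _ _ _

end LipModule

open LipModule

/-- A halo as a module over itself. -/
def LipHalo.asModule (R : LipHalo.{u}) : LipModule R where
  carrier := R.carrier
  nrm := R.nrm
  C := R.C
  D := R.D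
  C_pos := R.C_pos
  D_pos := R.D_pos
  nrm_nonneg := R.nrm_nonneg
  nrm_zero := (R.nrm_eq_zero 0).2 rfl
  nrm_sub_le := R.nrm_sub_le
  nrm_smul_le := R.nrm_mul_le
  eq_zero_of_nrm := fun f => (R.nrm_eq_zero f).1
  complete := R.complete

instance (R : LipHalo.{u}) : Mul R.asModule.carrier := ⟨fun x y : R.carrier => (x * y : R.carrier)⟩

/-! ### Commutative algebras over a halo -/

/-- A commutative `R`-algebra: a Lipschitz morphism `R → S` of commutative Lipschitz Banach halos
(the constants of `S` are at most those of `R`). -/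
structure CAlg (R : LipHalo.{u}) : Type (u + 1) extends LipHalo.{u} where
  ρ : R.carrier →+* carrier
  lip : ∃ K, ∀ r, nrm (ρ r) ≤ K * R.nrm r
  C_le : C ≤ R.C
  D_le : D ≤ R.D

instance (R : LipHalo.{u}) : CoeSort (CAlg R) (Type u) := ⟨fun S => S.carrier⟩

namespace CAlg

variable {R : LipHalo.{u}}

/-- Lipschitz `R`-algebra morphisms. -/
@[ext]
structure Hom (S T : CAlg R) : Type u where
  toRingHom : S.carrier →+* T.carrier
  comp_ρ : ∀ r, toRingHom (S.ρ r) = T.ρ r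
  lip : ∃ K, 0 ≤ K ∧ ∀ s, T.nrm (toRingHom s) ≤ K * S.nrm s
  C_le : T.C ≤ S.C
  D_le : T.D ≤ S.D

instance : CategoryTheory.Category (CAlg R) where
  Hom := Hom
  id S := ⟨RingHom.id _, fun _ => rfl, ⟨1, zero_le_one, fun s => by simp⟩, le_rfl, le_rfl⟩
  comp {S T U} f g := ⟨g.toRingHom.comp f.toRingHom,
    fun r => by rw [RingHom.comp_apply, f.comp_ρ, g.comp_ρ], by
      obtain ⟨K, hK, hf⟩ := f.lip
      obtain ⟨L, hL, hg⟩ := g.lip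
      exact ⟨L * K, mul_nonneg hL hK, fun s => (hg _).trans
        ((mul_le_mul_of_nonneg_left (hf s) hL).trans_eq (by ring))⟩,
    g.C_le.trans f.C_le, g.D_le.trans f.D_le⟩

/-- An `R`-algebra as an `R`-module, by restriction of scalars. -/
def asModule (S : CAlg R) : LipModule R where
  carrier := S.carrier
  module := Module.compHom S.carrier S.ρ
  nrm := S.nrm
  C := S.C
  D := S.D * max S.lip.choose 1
  C_pos := S.C_pos
  D_pos := mul_pos S.D_pos (lt_max_of_lt_right one_pos)
  nrm_nonneg := S.nrm_nonneg
  nrm_zero := (S.nrm_eq_zero 0).2 rfl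
  nrm_sub_le := S.nrm_sub_le
  nrm_smul_le := fun r s => by
    have hD := S.D_pos
    have h1 := S.lip.choose_spec r
    have h2 := R.nrm_nonneg r
    have h3 : S.nrm (S.ρ r) ≤ max S.lip.choose 1 * R.nrm r :=
      h1.trans (mul_le_mul_of_nonneg_right (le_max_left _ _) h2)
    refine (S.nrm_mul_le (S.ρ r) s).trans (mul_le_mul_of_nonneg_right ?_ (S.nrm_nonneg s))
    rw [mul_assoc]
    exact mul_le_mul_of_nonneg_left h3 hD.le
  eq_zero_of_nrm := fun f => (S.nrm_eq_zero f).1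
  complete := S.complete

/-- The multiplication of `S`, as an `R`-bilinear map. -/
def mulBilin (S : CAlg R) :
    S.asModule.carrier →ₗ[R.carrier] S.asModule.carrier →ₗ[R.carrier] S.asModule.carrier :=
  LinearMap.mk₂ R.carrier (fun s t : S.carrier => (s * t : S.carrier))
    (fun s s' t => add_mul (R := S.carrier) s s' t)
    (fun r s t => mul_assoc (G := S.carrier) (S.ρ r) s t)
    (fun s t t' => mul_add (R := S.carrier) s t t')
    (fun r s t => mul_left_comm (G := S.carrier) s (S.ρ r) t)

theorem mulBilin_lip (S : CAlg R) : BilinLip S.mulBilin :=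
  ⟨S.D, S.D_pos.le, S.nrm_mul_le⟩

/-- A morphism of `R`-algebras as a Lipschitz linear map. -/
def Hom.asLip {S T : CAlg R} (φ : Hom S T) : LipMap S.asModule T.asModule :=
  ⟨{ toFun := φ.toRingHom
     map_add' := map_add φ.toRingHom
     map_smul' := fun r s => (map_mul φ.toRingHom (S.ρ r) s).trans (by rw [φ.comp_ρ]; rfl) },
    φ.lip⟩

end CAlg

/-! ### Comonoids with involution -/

/-- `m ⊗ n ↦ η(m) n`. -/
def counitLeft {R : LipHalo.{u}} {M : LipModule R} (η : LipMap M R.asModule) :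
    LipMap (M.tensor M) M :=
  lift ((LinearMap.lsmul R.carrier M.carrier).comp η.1)
    ⟨M.D * SNModule.opNrm η, mul_nonneg M.D_pos.le (SNModule.opNrm_nonneg η), fun m n =>
      (M.nrm_smul_le (η m) n).trans (mul_le_mul_of_nonneg_right
        ((mul_le_mul_of_nonneg_left (nrm_apply_le η m) M.D_pos.le).trans_eq (by ring))
          (M.nrm_nonneg n))⟩ (min_self M.C).ge

/-- `m ⊗ n ↦ η(n) m`. -/
def counitRight {R : LipHalo.{u}} {M : LipModule R} (η : LipMap M R.asModule) :
    LipMap (M.tensor M) M :=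
  ⟨(counitLeft η).1 ∘ₗ (swap M M).1, by
    refine ⟨SNModule.opNrm (counitLeft η) * SNModule.opNrm (swap M M),
      mul_nonneg (SNModule.opNrm_nonneg _) (SNModule.opNrm_nonneg _), fun x => ?_⟩
    exact (nrm_apply_le (counitLeft η) _).trans ((mul_le_mul_of_nonneg_left
      (nrm_apply_le (swap M M) x) (SNModule.opNrm_nonneg _)).trans_eq (by ring))⟩

/-- A comonoid with involution `(C, Δ, η, σ)` in the monoidal category of Lipschitz `R`-modules.
A module over `R` has constants at most those of `R`, and a morphism does not increase
the constants; as `η : C → R` is a morphism, the constants of `C` are those of `R`. -/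
structure InvComonoid (R : LipHalo.{u}) : Type (u + 1) where
  M : LipModule R
  C_eq : M.C = R.C
  D_eq : M.D = R.D
  Δ : LipMap M (M.tensor M)
  η : LipMap M R.asModule
  coassoc : ∀ c, assoc M M M (map Δ (idMap M) (min_le_min (min_self M.C).le le_rfl) (Δ c)) =
    map (idMap M) Δ (min_le_min le_rfl (min_self M.C).le) (Δ c)
  counit_left : ∀ c, counitLeft η (Δ c) = c
  counit_right : ∀ c, counitRight η (Δ c) = c
  σ : LipMap M M
  σ_σ : ∀ c, σ (σ c) = c
  Δ_σ : ∀ c, Δ (σ c) = swap M M (map σ σ le_rfl (Δ c))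
  η_σ : ∀ c, η (σ c) = η c

namespace InvComonoid

variable {R : LipHalo.{u}} (C : InvComonoid R)

/-- The dual `C^∨ = Hom_R(C, R)`. -/
abbrev dual : LipModule R := LipModule.hom C.M R.asModule

theorem nrm_dual_apply_le (f : C.dual) (c : C.M) : R.nrm (f.1 c) ≤ C.dual.nrm f * C.M.nrm c :=
  nrm_apply_le f c

theorem nrm_mul_apply_le (f g : C.dual) (c d : C.M) : R.asModule.nrm (f.1 c * g.1 d) ≤
    R.D * C.dual.nrm f * C.dual.nrm g * C.M.nrm c * C.M.nrm d := by
  have h4 := R.D_pos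
  exact (R.nrm_mul_le (f.1 c) (g.1 d)).trans ((mul_le_mul (mul_le_mul_of_nonneg_left
    (C.nrm_dual_apply_le f c) h4.le) (C.nrm_dual_apply_le g d) (R.nrm_nonneg _) (mul_nonneg h4.le
      (mul_nonneg (C.dual.nrm_nonneg f) (C.M.nrm_nonneg c)))).trans_eq (by ring))

variable {C} in
/-- The pairing `c ⊗ d ↦ f(c) g(d)`. -/
def pair (f g : C.dual) : LipMap (C.M.tensor C.M) R.asModule :=
  lift ((LinearMap.mul R.carrier R.carrier).compl₁₂ f.1 g.1)
    ⟨R.D * C.dual.nrm f * C.dual.nrm g, mul_nonneg (mul_nonneg R.D_pos.le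
      (C.dual.nrm_nonneg f)) (C.dual.nrm_nonneg g), C.nrm_mul_apply_le f g⟩
    ((min_self C.M.C).trans C.C_eq).ge

end InvComonoid

namespace InvComonoid

variable {R : LipHalo.{u}} (C : InvComonoid R)

variable {C} in
theorem pair_tmul (f g : C.dual) (c d : C.M) :
    pair f g (tmul c d) = f.1 c * g.1 d := lift_tmul _ _ _ _ _

variable {C} in
theorem nrm_pair_le (f g : C.dual) (x : C.M.tensor C.M) :
    R.nrm (pair f g x) ≤ R.C * (R.D * C.dual.nrm f * C.dual.nrm g) * (C.M.tensor C.M).nrm x := by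
  unfold pair
  exact nrm_lift_le (P := R.asModule) _ _ _ (mul_nonneg (mul_nonneg R.D_pos.le
    (C.dual.nrm_nonneg f)) (C.dual.nrm_nonneg g)) (C.nrm_mul_apply_le f g) x

theorem nrm_convFun_le (f g : C.dual) (c : C.M) :
    R.nrm (pair f g (C.Δ c)) ≤
      R.C * R.D * SNModule.opNrm C.Δ * C.dual.nrm f * C.dual.nrm g * C.M.nrm c := by
  have hC := R.C_pos
  have hD := R.D_pos
  have hf := C.dual.nrm_nonneg f
  have hg := C.dual.nrm_nonneg g
  exact (nrm_pair_le f g (C.Δ c)).trans ((mul_le_mul_of_nonneg_left (nrm_apply_le C.Δ c)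
    (by positivity)).trans_eq (by ring))

variable {C} in
/-- The convolution product `(f * g)(c) = (f ⊗ g)(Δ c)` on `C^∨`. -/
def convFun (f g : C.dual) : C.dual :=
  ⟨(pair f g).1 ∘ₗ C.Δ.1,
    R.C * R.D * SNModule.opNrm C.Δ * C.dual.nrm f * C.dual.nrm g, by
      have hC := R.C_pos
      have hD := R.D_pos
      have hf := C.dual.nrm_nonneg f
      have hg := C.dual.nrm_nonneg g
      have := SNModule.opNrm_nonneg C.Δ
      positivity,
    C.nrm_convFun_le f g⟩

theorem convFun_congr {f g : C.dual} {φ : LipMap (C.M.tensor C.M) R.asModule}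
    (h : ∀ c d, f.1 c * g.1 d = φ (tmul c d)) (c : C.M) :
    (convFun f g).1 c = φ (C.Δ c) := by
  have : pair f g = φ := tensor_ext fun c d => (pair_tmul f g c d).trans (h c d)
  rw [← this]; rfl

/-- The product of `C^∨` as a bilinear map. -/
def conv : C.dual.carrier →ₗ[R.carrier] C.dual.carrier →ₗ[R.carrier] C.dual.carrier :=
  LinearMap.mk₂ R.carrier convFun
    (fun f f' g => Subtype.ext <| LinearMap.ext fun c =>
      C.convFun_congr (φ := pair f g + pair f' g) (fun c d => by
        change _ = pair f g (tmul c d) + pair f' g (tmul c d)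
        rw [pair_tmul, pair_tmul]; exact add_mul (R := R.carrier) _ _ _) c)
    (fun r f g => Subtype.ext <| LinearMap.ext fun c =>
      C.convFun_congr (φ := r • pair f g) (fun c d => by
        change _ = r • pair f g (tmul c d)
        rw [pair_tmul]; exact mul_assoc (G := R.carrier) _ _ _) c)
    (fun f g g' => Subtype.ext <| LinearMap.ext fun c =>
      C.convFun_congr (φ := pair f g + pair f g') (fun c d => by
        change _ = pair f g (tmul c d) + pair f g' (tmul c d)
        rw [pair_tmul, pair_tmul]; exact mul_add (R := R.carrier) _ _ _) c)
    (fun r f g => Subtype.ext <| LinearMap.ext fun c =>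
      C.convFun_congr (φ := r • pair f g) (fun c d => by
        change _ = r • pair f g (tmul c d)
        rw [pair_tmul]; exact mul_left_comm (G := R.carrier) _ _ _) c)

theorem conv_lip : BilinLip C.conv := by
  have hC := R.C_pos
  have hD := R.D_pos
  have h0 := SNModule.opNrm_nonneg C.Δ
  refine ⟨R.C * R.D * SNModule.opNrm C.Δ, by positivity, fun f g => ?_⟩
  have hf := C.dual.nrm_nonneg f
  have hg := C.dual.nrm_nonneg g
  exact SNModule.opNrm_le (by positivity) (C.nrm_convFun_le f g)

/-- The dual involution `f ↦ f ∘ σ`. -/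
def dualσ : LipMap C.dual C.dual :=
  ⟨{ toFun := fun f => ⟨f.1 ∘ₗ C.σ.1, C.dual.nrm f * SNModule.opNrm C.σ,
        mul_nonneg (C.dual.nrm_nonneg f) (SNModule.opNrm_nonneg _), fun c =>
          (nrm_apply_le f _).trans ((mul_le_mul_of_nonneg_left (nrm_apply_le C.σ c)
            (C.dual.nrm_nonneg f)).trans_eq (by ring))⟩
     map_add' := fun _ _ => rfl
     map_smul' := fun _ _ => rfl },
    SNModule.opNrm C.σ, SNModule.opNrm_nonneg _, fun f =>
      SNModule.opNrm_le (mul_nonneg (SNModule.opNrm_nonneg _) (C.dual.nrm_nonneg f)) fun c =>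
        (nrm_apply_le f _).trans ((mul_le_mul_of_nonneg_left (nrm_apply_le C.σ c)
          (C.dual.nrm_nonneg f)).trans_eq (by ring))⟩

/-! ### Points with values in an algebra -/

variable (S T : CAlg R)

/-- `C^∨ ⊗_R S`. -/
abbrev pts : LipModule R := C.dual.tensor S.asModule

/-- The product of `C^∨ ⊗_R S`: `(f ⊗ s)(g ⊗ t) = (f * g) ⊗ st`. -/
def ptsMul (a b : C.pts S) : C.pts S :=
  (tensorBilin C.conv C.conv_lip S.mulBilin S.mulBilin_lip le_rfl a).1 b

/-- The unit `η ⊗ 1` of `C^∨ ⊗_R S`. -/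
def ptsOne : C.pts S := tmul (M := C.dual) (N := S.asModule) C.η (1 : S.carrier)

/-- The involution `σ^∨ ⊗ 1` of `C^∨ ⊗_R S`. -/
def ptsσ : LipMap (C.pts S) (C.pts S) := map C.dualσ (idMap S.asModule) le_rfl

/-- Evaluation of functionals at `c`. -/
def evalAt (c : C.M) : C.dual.carrier →ₗ[R.carrier] R.carrier where
  toFun f := f.1 c
  map_add' _ _ := rfl
  map_smul' _ _ := rfl

/-- The bilinear map `(f, s) ↦ f(c) s`. -/
def evBilin (c : C.M) :
    C.dual.carrier →ₗ[R.carrier] S.asModule.carrier →ₗ[R.carrier] S.asModule.carrier :=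
  (LinearMap.lsmul R.carrier S.asModule.carrier).comp (C.evalAt c)

theorem nrm_evBilin_le (c : C.M) (f : C.dual) (s : S.asModule) :
    S.nrm (C.evBilin S c f s) ≤ S.asModule.D * C.M.nrm c * C.dual.nrm f * S.asModule.nrm s := by
  have h1 : R.nrm (f.1 c) ≤ C.dual.nrm f * C.M.nrm c := nrm_apply_le f c
  have h2 := S.asModule.D_pos
  refine (S.asModule.nrm_smul_le (f.1 c) s).trans
    (mul_le_mul_of_nonneg_right ?_ (S.asModule.nrm_nonneg s))
  exact (mul_le_mul_of_nonneg_left h1 h2.le).trans_eq (by ring)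

/-- Evaluation `a ↦ a(c)` on `C^∨ ⊗_R S`, with `(f ⊗ s)(c) = f(c) s`. -/
def ev (c : C.M) : LipMap (C.pts S) S.asModule :=
  lift (C.evBilin S c) ⟨S.asModule.D * C.M.nrm c, mul_nonneg S.asModule.D_pos.le (C.M.nrm_nonneg c),
    C.nrm_evBilin_le S c⟩ (le_min S.C_le le_rfl)

variable {C S T}

/-- The value `a(c) ∈ S` of `a ∈ C^∨ ⊗_R S` at `c ∈ C`. -/
def value (a : C.pts S) (c : C.M) : S := C.ev S c a

theorem ev_tmul (c : C.M) (f : C.dual) (s : S.asModule) :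
    C.ev S c (tmul f s) = S.mulBilin (S.ρ (f.1 c)) s := lift_tmul _ _ _ _ _

theorem nrm_value_le (a : C.pts S) (c : C.M) :
    S.nrm (value a c) ≤ S.C * S.asModule.D * (C.pts S).nrm a * C.M.nrm c := by
  have := nrm_lift_le (C.evBilin S c) ⟨_, mul_nonneg S.asModule.D_pos.le (C.M.nrm_nonneg c),
    C.nrm_evBilin_le S c⟩ (le_min S.C_le le_rfl)
    (mul_nonneg S.asModule.D_pos.le (C.M.nrm_nonneg c)) (C.nrm_evBilin_le S c) a
  refine this.trans_eq ?_
  change S.C * (S.asModule.D * C.M.nrm c) * (C.pts S).nrm a = _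
  ring

/-- `c ↦ a(c)` as a linear map. -/
def valueLin (a : C.pts S) : C.M.carrier →ₗ[R.carrier] S.asModule.carrier where
  toFun := value a
  map_add' c d := by
    have : C.ev S (c + d) = C.ev S c + C.ev S d := tensor_ext fun f s => by
      change _ = C.ev S c (tmul f s) + C.ev S d (tmul f s)
      simp only [ev_tmul]
      exact (congrArg (fun t => S.mulBilin t s) ((congrArg S.ρ (map_add f.1 c d)).trans
        (map_add S.ρ (f.1 c) (f.1 d)))).trans (add_mul (R := S.carrier) _ _ _)
    exact congrArg (fun φ : LipMap (C.pts S) S.asModule => φ a) this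
  map_smul' r c := by
    have : C.ev S (r • c) = r • C.ev S c := tensor_ext fun f s => by
      change _ = r • C.ev S c (tmul f s)
      simp only [ev_tmul]
      exact (congrArg (fun t => S.mulBilin t s) ((congrArg S.ρ (map_smul f.1 r c)).trans
        (map_mul S.ρ r (f.1 c)))).trans (mul_assoc (G := S.carrier) _ _ _)
    exact congrArg (fun φ : LipMap (C.pts S) S.asModule => φ a) this

/-- The map `α_{C,S}`: it sends `a` to the `S`-linear extension `c ⊗ s ↦ a(c) s` of `c ↦ a(c)`. -/
def alpha (a : C.pts S) : LipMap (C.M.tensor S.asModule) S.asModule :=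
  lift (S.mulBilin.comp (valueLin a))
    ⟨S.D * (S.C * S.asModule.D * (C.pts S).nrm a), mul_nonneg S.D_pos.le (mul_nonneg
      (mul_nonneg S.C_pos.le S.asModule.D_pos.le) ((C.pts S).nrm_nonneg a)), fun c s =>
        (S.nrm_mul_le (value a c) s).trans (mul_le_mul_of_nonneg_right
          ((mul_le_mul_of_nonneg_left (nrm_value_le a c) S.D_pos.le).trans_eq (by ring))
            (S.nrm_nonneg s))⟩
    (le_min (S.C_le.trans C.C_eq.ge) le_rfl)

variable (C S)

/-- The action of `s ∈ S` on `C ⊗_R S`. -/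
def scalarAct (s : S) : LipMap (C.M.tensor S.asModule) (C.M.tensor S.asModule) :=
  map (idMap C.M) ⟨S.mulBilin s, S.D * S.nrm s, mul_nonneg S.D_pos.le (S.nrm_nonneg s),
    fun t => S.nrm_mul_le s t⟩ le_rfl

/-- The `S`-linear maps among the Lipschitz maps `C ⊗_R S → S`, i.e. `Hom_S(C ⊗_R S, S)`. -/
def homS : Set (LipMap (C.M.tensor S.asModule) S.asModule) :=
  {φ | ∀ (s : S) x, φ (C.scalarAct S s x) = S.mulBilin s (φ x)}

/-- `α_{C,S} : C^∨ ⊗_R S → Hom_S(C ⊗_R S, S)` is an isomorphism: bijective, and Lipschitz in both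
directions. -/
def AlphaIso : Prop :=
  Set.BijOn (alpha (C := C) (S := S)) Set.univ (C.homS S) ∧
  (∃ K, ∀ a : C.pts S, SNModule.opNrm (alpha a) ≤ K * (C.pts S).nrm a) ∧
  (∃ K, ∀ a : C.pts S, (C.pts S).nrm a ≤ K * SNModule.opNrm (alpha a))

/-- The set of short isometries of `(C, σ)` with values in `S`. -/
def sisoSet : Set (C.pts S) :=
  {a | (∃ D > 0, ∀ l : List C.M, S.nrm (l.map (value a)).prod ≤ D * (l.map C.M.nrm).prod) ∧
    C.ptsMul S a (C.ptsσ S a) = C.ptsOne S ∧ C.ptsMul S (C.ptsσ S a) a = C.ptsOne S}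

variable {S}

/-- The map `C^∨ ⊗_R S → C^∨ ⊗_R T` induced by a morphism `S → T`. -/
def ptsMap (φ : CAlg.Hom S T) : LipMap (C.pts S) (C.pts T) :=
  map (idMap C.dual) φ.asLip (min_le_min le_rfl φ.C_le)

theorem ptsMap_tmul (φ : CAlg.Hom S T) (f : C.dual) (s : S.asModule) :
    C.ptsMap φ (tmul f s) = tmul (M := C.dual) (N := T.asModule) f (φ.toRingHom s) :=
  map_tmul _ _ _ _ _

theorem pts_ext {P : LipModule R} {f g : LipMap (C.pts S) P}
    (h : ∀ u s, f (tmul u s) = g (tmul u s)) (a : C.pts S) : f a = g a :=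
  congrArg (fun φ : LipMap (C.pts S) P => φ a) (tensor_ext h)

/-- Composition of Lipschitz maps. -/
def compLip {M N P : LipModule R} (g : LipMap N P) (f : LipMap M N) : LipMap M P :=
  ⟨g.1 ∘ₗ f.1, SNModule.opNrm g * SNModule.opNrm f,
    mul_nonneg (SNModule.opNrm_nonneg g) (SNModule.opNrm_nonneg f), fun x =>
      (nrm_apply_le g (f x)).trans ((mul_le_mul_of_nonneg_left (nrm_apply_le f x)
        (SNModule.opNrm_nonneg g)).trans_eq (by ring))⟩

theorem value_ptsMap (φ : CAlg.Hom S T) (a : C.pts S) (c : C.M) :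
    value (C.ptsMap φ a) c = φ.toRingHom (value a c) :=
  C.pts_ext (f := compLip (C.ev T c) (C.ptsMap φ)) (g := compLip φ.asLip (C.ev S c))
    (fun u s => by
      change C.ev T c (C.ptsMap φ (tmul u s)) = φ.toRingHom (C.ev S c (tmul u s))
      rw [ptsMap_tmul]
      refine (ev_tmul (S := T) c u (φ.toRingHom s)).trans ?_
      rw [ev_tmul]
      refine Eq.trans ?_ (map_mul φ.toRingHom (S.ρ (u.1 c)) s).symm
      exact congrArg (fun t : T.carrier => t * φ.toRingHom s) (φ.comp_ρ (u.1 c)).symm) a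

theorem ptsσ_ptsMap (φ : CAlg.Hom S T) (a : C.pts S) :
    C.ptsσ T (C.ptsMap φ a) = C.ptsMap φ (C.ptsσ S a) :=
  C.pts_ext (f := compLip (C.ptsσ T) (C.ptsMap φ)) (g := compLip (C.ptsMap φ) (C.ptsσ S))
    (fun u s => by
      change C.ptsσ T (C.ptsMap φ (tmul u s)) = C.ptsMap φ (C.ptsσ S (tmul u s))
      rw [ptsMap_tmul]
      refine (map_tmul _ _ _ _ _).trans ?_
      refine Eq.trans ?_ (congrArg (C.ptsMap φ) (map_tmul _ _ _ _ _)).symm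
      exact (C.ptsMap_tmul φ _ _).symm) a

theorem ptsMap_one (φ : CAlg.Hom S T) : C.ptsMap φ (C.ptsOne S) = C.ptsOne T := by
  refine (C.ptsMap_tmul φ C.η (1 : S.carrier)).trans ?_
  rw [map_one]; rfl

/-- Left multiplication on `C^∨ ⊗_R S`. -/
def ptsMulLeft (S : CAlg R) (a : C.pts S) : LipMap (C.pts S) (C.pts S) :=
  tensorBilin C.conv C.conv_lip S.mulBilin S.mulBilin_lip le_rfl a

/-- Right multiplication on `C^∨ ⊗_R S`. -/
def ptsMulRight (S : CAlg R) (b : C.pts S) : LipMap (C.pts S) (C.pts S) :=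
  ⟨{ toFun := fun a => C.ptsMul S a b
     map_add' := fun a a' => by
      simp only [ptsMul, map_add]; rfl
     map_smul' := fun r a => by
      simp only [ptsMul, map_smul]; rfl },
    by
      let m := tensorBilin C.conv C.conv_lip S.mulBilin S.mulBilin_lip le_rfl
      refine ⟨SNModule.opNrm m * (C.pts S).nrm b, mul_nonneg (SNModule.opNrm_nonneg _)
        ((C.pts S).nrm_nonneg _), fun a => ?_⟩
      have h1 : (C.pts S).nrm ((m a).1 b) ≤ _ := SNModule.le_opNrm (m a) b
      have h2 : SNModule.opNrm (m a) ≤ _ := SNModule.le_opNrm m a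
      exact h1.trans ((mul_le_mul_of_nonneg_right h2 ((C.pts S).nrm_nonneg _)).trans_eq (by ring))⟩

theorem ptsMul_tmul (f g : C.dual) (s t : S.asModule) :
    C.ptsMul S (tmul f s) (tmul g t) = tmul (convFun f g) (S.mulBilin s t) :=
  tensorBilin_tmul _ _ _ _ _ _ _ _ _

theorem ptsMap_mul (φ : CAlg.Hom S T) (a b : C.pts S) :
    C.ptsMap φ (C.ptsMul S a b) = C.ptsMul T (C.ptsMap φ a) (C.ptsMap φ b) := by
  refine C.pts_ext (f := compLip (C.ptsMap φ) (C.ptsMulLeft S a))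
    (g := compLip (C.ptsMulLeft T (C.ptsMap φ a)) (C.ptsMap φ)) (fun g t => ?_) b
  refine C.pts_ext (f := compLip (C.ptsMap φ) (C.ptsMulRight S (tmul g t)))
    (g := compLip (C.ptsMulRight T (C.ptsMap φ (tmul g t))) (C.ptsMap φ)) (fun f s => ?_) a
  change C.ptsMap φ (C.ptsMul S (tmul f s) (tmul g t)) =
    C.ptsMul T (C.ptsMap φ (tmul f s)) (C.ptsMap φ (tmul g t))
  rw [ptsMul_tmul, ptsMap_tmul, ptsMap_tmul, ptsMap_tmul]
  refine Eq.trans ?_ (C.ptsMul_tmul (S := T) f g (φ.toRingHom s) (φ.toRingHom t)).symm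
  exact congrArg (tmul (M := C.dual) (N := T.asModule) (convFun f g)) (RingHom.map_mul φ.toRingHom s t)

theorem ptsMap_mem (φ : CAlg.Hom S T) {a : C.pts S} (ha : a ∈ C.sisoSet S) :
    C.ptsMap φ a ∈ C.sisoSet T := by
  obtain ⟨⟨D, hD, h⟩, h1, h2⟩ := ha
  obtain ⟨K, hK, hφ⟩ := φ.lip
  refine ⟨⟨(K + 1) * D, by positivity, fun l => ?_⟩, ?_, ?_⟩
  · have e : (l.map (value (C.ptsMap φ a))).prod = φ.toRingHom (l.map (value a)).prod := by
      rw [map_list_prod, List.map_map]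
      exact congrArg List.prod (List.map_congr_left fun c _ => C.value_ptsMap φ a c)
    rw [e]
    refine (hφ _).trans ?_
    have h3 := h l
    have h4 := S.nrm_nonneg (l.map (value a)).prod
    nlinarith
  · rw [ptsσ_ptsMap, ← ptsMap_mul, h1, ptsMap_one]
  · rw [ptsσ_ptsMap, ← ptsMap_mul, h2, ptsMap_one]

open CategoryTheory in
/-- The functor `SIso(C, σ)` of short isometries. -/
def SIso : CAlg R ⥤ Type u where
  obj S := C.sisoSet S
  map φ := TypeCat.ofHom fun a => ⟨C.ptsMap φ a.1, C.ptsMap_mem φ a.2⟩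
  map_id S := by
    ext a
    exact C.pts_ext (f := C.ptsMap (𝟙 S)) (g := idMap _) (fun u s => C.ptsMap_tmul (𝟙 S) u s) a.1
  map_comp {S T U} φ ψ := by
    ext a
    refine C.pts_ext (f := C.ptsMap (φ ≫ ψ)) (g := compLip (C.ptsMap ψ) (C.ptsMap φ))
      (fun u s => ?_) a.1
    refine (C.ptsMap_tmul (φ ≫ ψ) u s).trans ?_
    change _ = C.ptsMap ψ (C.ptsMap φ (tmul u s))
    rw [ptsMap_tmul]
    exact (C.ptsMap_tmul ψ _ _).symm

end InvComonoid

/-! ### The symmetric algebra and the representing algebra -/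

namespace InvComonoid

variable {R : LipHalo.{u}} (C : InvComonoid R)

/-- The algebraic symmetric algebra. -/
abbrev SymAlg : Type u := SymmetricAlgebra R.carrier C.M.carrier

/-- Scalars `r` and products `c₀ c₁ ⋯ cₙ` of elements of `C`. -/
abbrev SymLeaf : Type u := R.carrier ⊕ C.M.carrier × List C.M.carrier

def symVal : C.SymLeaf → C.SymAlg
  | .inl r => algebraMap R.carrier C.SymAlg r
  | .inr (c, l) => SymmetricAlgebra.ι R.carrier C.M.carrier c *
      (l.map (SymmetricAlgebra.ι R.carrier C.M.carrier)).prod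

/-- The weights `|r|` and `|c₀| |c₁| ⋯ |cₙ|`. -/
def symWeight : C.SymLeaf → ℝ
  | .inl r => R.nrm r
  | .inr (c, l) => C.M.nrm c * (l.map C.M.nrm).prod

theorem symWeight_nonneg (l : C.SymLeaf) : 0 ≤ C.symWeight l := by
  rcases l with r | ⟨c, l⟩
  · exact R.nrm_nonneg r
  · refine mul_nonneg (C.M.nrm_nonneg c) (List.prod_nonneg fun x hx => ?_)
    obtain ⟨d, -, rfl⟩ := List.mem_map.1 hx
    exact C.M.nrm_nonneg d

/-- Products of leaves are leaves. -/
theorem exists_leaf_mul (l l' : C.SymLeaf) : ∃ l'', C.symVal l'' = C.symVal l * C.symVal l' ∧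
    C.symWeight l'' ≤ max 1 R.D * C.symWeight l * C.symWeight l' := by
  have hD := R.D_pos
  have key : ∀ (r : R.carrier) (c : C.M) (l : List C.M),
      C.symWeight (.inr (r • c, l)) ≤ max 1 R.D * R.nrm r * C.symWeight (.inr (c, l)) := by
    intro r c l
    have h1 := C.M.nrm_smul_le r c
    rw [C.D_eq] at h1
    have h2 : 0 ≤ (l.map C.M.nrm).prod := List.prod_nonneg fun x hx => by
      obtain ⟨d, -, rfl⟩ := List.mem_map.1 hx
      exact C.M.nrm_nonneg d
    have h3 : R.D * R.nrm r * C.M.nrm c ≤ max 1 R.D * R.nrm r * C.M.nrm c :=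
      mul_le_mul_of_nonneg_right (mul_le_mul_of_nonneg_right (le_max_right _ _) (R.nrm_nonneg r))
        (C.M.nrm_nonneg c)
    exact (mul_le_mul_of_nonneg_right (h1.trans h3) h2).trans_eq
      (by simp only [symWeight]; ring)
  rcases l with r | ⟨c, l⟩ <;> rcases l' with s | ⟨d, l'⟩
  · refine ⟨.inl (r * s), by simp [symVal], (R.nrm_mul_le r s).trans ?_⟩
    exact mul_le_mul_of_nonneg_right (mul_le_mul_of_nonneg_right (le_max_right _ _)
      (R.nrm_nonneg r)) (R.nrm_nonneg s)
  · exact ⟨.inr (r • d, l'), by simp [symVal, Algebra.smul_def, mul_assoc], key r d l'⟩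
  · exact ⟨.inr (s • c, l), by
      simp only [symVal, Algebra.smul_def, map_smul]; rw [mul_assoc, mul_comm (algebraMap _ _ s)],
      (key s c l).trans_eq (by simp only [symWeight]; ring)⟩
  · refine ⟨.inr (c, l ++ d :: l'), by simp [symVal, mul_assoc], ?_⟩
    have h := mul_nonneg (C.symWeight_nonneg (.inr (c, l))) (C.symWeight_nonneg (.inr (d, l')))
    have e : C.symWeight (.inr (c, l ++ d :: l')) =
      C.symWeight (.inr (c, l)) * C.symWeight (.inr (d, l')) := by
      simp only [symWeight, List.map_append, List.map_cons, List.prod_append, List.prod_cons]; ring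
    rw [e, mul_assoc]
    exact le_mul_of_one_le_left h (le_max_left _ _)

theorem exists_symTree (x : C.SymAlg) : ∃ t : BinTree C.SymLeaf, t.eval C.symVal = x := by
  have hz : ∃ l, C.symVal l = 0 := ⟨.inl 0, by simp [symVal]⟩
  have hsub : ∀ x y : C.SymAlg, (∃ t : BinTree C.SymLeaf, t.eval C.symVal = x) →
      (∃ t : BinTree C.SymLeaf, t.eval C.symVal = y) →
      ∃ t : BinTree C.SymLeaf, t.eval C.symVal = x - y := by
    rintro _ _ ⟨s, rfl⟩ ⟨t, rfl⟩
    exact ⟨.node s t, rfl⟩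
  induction x using SymmetricAlgebra.induction with
  | algebraMap r => exact ⟨.leaf (.inl r), rfl⟩
  | ι c => exact ⟨.leaf (.inr (c, [])), by simp [BinTree.eval, symVal]⟩
  | add x y hx hy => exact BinTree.exists_eval_add hz hx hy
  | mul x y hx hy =>
    obtain ⟨s, rfl⟩ := hx
    obtain ⟨t, rfl⟩ := hy
    induction s with
    | leaf l =>
      induction t with
      | leaf l' =>
        obtain ⟨l'', h, -⟩ := C.exists_leaf_mul l l'
        exact ⟨.leaf l'', h⟩
      | node s t hs ht =>
        simp only [BinTree.eval, mul_sub] at hs ht ⊢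
        exact hsub _ _ hs ht
    | node s s' hs hs' =>
      simp only [BinTree.eval, sub_mul]
      exact hsub _ _ hs hs'

/-- The semi-norm on the symmetric algebra: the largest one with constant `C_R` such that
`|r| ≤ |r|_R` and `|c₀ ⋯ cₙ| ≤ |c₀|_C ⋯ |cₙ|_C`. -/
def symNrm : C.SymAlg → ℝ := BinTree.treeNrm R.C C.symVal C.symWeight

theorem symNrm_nonneg (x : C.SymAlg) : 0 ≤ C.symNrm x :=
  BinTree.treeNrm_nonneg R.C_pos.le C.symWeight_nonneg x

theorem symNrm_sub_le (x y : C.SymAlg) : C.symNrm (x - y) ≤ R.C * max (C.symNrm x) (C.symNrm y) :=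
  BinTree.treeNrm_sub_le R.C_pos C.symWeight_nonneg C.exists_symTree x y

theorem symNrm_leaf_le (l : C.SymLeaf) : C.symNrm (C.symVal l) ≤ C.symWeight l :=
  BinTree.treeNrm_le (v := C.symVal) R.C_pos.le C.symWeight_nonneg (.leaf l)

theorem symNrm_mul_le (x y : C.SymAlg) :
    C.symNrm (x * y) ≤ max 1 R.D * C.symNrm x * C.symNrm y := by
  have hD : 0 < max 1 R.D := lt_max_of_lt_left one_pos
  have h1 : ∀ l y, C.symNrm (C.symVal l * y) ≤ max 1 R.D * C.symWeight l * C.symNrm y := by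
    intro l y
    have := C.symWeight_nonneg l
    refine BinTree.le_treeNrm R.C_pos.le C.exists_symTree (AddMonoidHom.mulLeft (C.symVal l))
      C.symNrm C.symNrm_nonneg le_rfl C.symNrm_sub_le (by positivity) (fun l' => ?_) y
    obtain ⟨l'', h, h'⟩ := C.exists_leaf_mul l l'
    exact ((congrArg C.symNrm h).ge.trans (C.symNrm_leaf_le l'')).trans h'
  have := C.symNrm_nonneg y
  refine (BinTree.le_treeNrm R.C_pos.le C.exists_symTree (AddMonoidHom.mulRight y)
    C.symNrm C.symNrm_nonneg le_rfl C.symNrm_sub_le (w := C.symWeight) (B := max 1 R.D * C.symNrm y) (by positivity)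
    (fun l => (h1 l y).trans_eq (by ring)) x).trans_eq ?_
  unfold symNrm; ring

/-- The symmetric algebra as a semi-normed module. -/
def symPre : SNModule R where
  carrier := C.SymAlg
  nrm := C.symNrm
  C := R.C
  D := max 1 R.D
  C_pos := R.C_pos
  D_pos := lt_max_of_lt_left one_pos
  nrm_nonneg := C.symNrm_nonneg
  nrm_zero := by
    refine le_antisymm ?_ (C.symNrm_nonneg 0)
    have := C.symNrm_leaf_le (.inl 0)
    rwa [symVal, map_zero, symWeight, (R.nrm_eq_zero 0).2 rfl] at this
  nrm_sub_le := C.symNrm_sub_le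
  nrm_smul_le := fun r x => by
    rw [Algebra.smul_def]
    refine (C.symNrm_mul_le _ _).trans (mul_le_mul_of_nonneg_right (mul_le_mul_of_nonneg_left
      (C.symNrm_leaf_le (.inl r)) (le_max_of_le_left zero_le_one)) (C.symNrm_nonneg x))

theorem symNrm_mul_small {K ε : ℝ} (hK : 0 ≤ K) (hε : 0 < ε) :
    ∃ δ > 0, ∀ x y : C.SymAlg, C.symNrm x ≤ K → C.symNrm y < δ → C.symNrm (x * y) < ε := by
  have hD : 0 < max 1 R.D := lt_max_of_lt_left one_pos
  refine ⟨ε / (max 1 R.D * K + 1), by positivity, fun x y hx hy => ?_⟩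
  rw [lt_div_iff₀ (by positivity)] at hy
  have h1 := C.symNrm_mul_le x y
  have h2 : max 1 R.D * C.symNrm x * C.symNrm y ≤ max 1 R.D * K * C.symNrm y :=
    mul_le_mul_of_nonneg_right (mul_le_mul_of_nonneg_left hx hD.le) (C.symNrm_nonneg y)
  have h3 := C.symNrm_nonneg y
  nlinarith

theorem symCauchy_mul {a b : ℕ → C.SymAlg} (ha : a ∈ C.symPre.cauchy) (hb : b ∈ C.symPre.cauchy) :
    a * b ∈ C.symPre.cauchy := by
  intro ε hε
  obtain ⟨r, hr, N₁, h₁⟩ := C.symPre.cauchy_bdd ⟨a, ha⟩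
  obtain ⟨s, hs, N₂, h₂⟩ := C.symPre.cauchy_bdd ⟨b, hb⟩
  have hC := R.C_pos
  have hε' : 0 < ε / R.C := by positivity
  obtain ⟨δ, hδ, h₃⟩ := C.symNrm_mul_small hr hε'
  obtain ⟨δ', hδ', h₄⟩ := C.symNrm_mul_small hs hε'
  obtain ⟨N₃, h₅⟩ := hb δ hδ
  obtain ⟨N₄, h₆⟩ := ha δ' hδ'
  refine ⟨max (max N₁ N₂) (max N₃ N₄), fun m hm n hn => ?_⟩
  simp only [ge_iff_le, max_le_iff] at hm hn
  have e1 := h₃ (a m) (b m - b n) (h₁ m hm.1.1) (h₅ m hm.2.1 n hn.2.1)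
  have e2 := h₄ (b n) (a n - a m) (h₂ n hn.1.2) (h₆ n hn.2.2 m hm.2.2)
  have e3 := C.symPre.nrm_sub_lt e1 e2
  have e4 : (a * b) m - (a * b) n = a m * (b m - b n) - b n * (a n - a m) := by
    simp only [Pi.mul_apply]; ring
  exact (congrArg C.symNrm e4).trans_lt e3

/-- The algebra of Cauchy sequences in the symmetric algebra. -/
def symCauchy : Subalgebra R.carrier (ℕ → C.SymAlg) :=
  Submodule.toSubalgebra C.symPre.cauchy (SNModule.constSeq (X := C.symPre) (1 : C.SymAlg)).2
    (fun _ _ ha hb => C.symCauchy_mul ha hb)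

/-- The ideal of null sequences. -/
def symNull : Ideal C.symCauchy where
  carrier := {a | ConvergesFor C.symNrm a.1 0}
  zero_mem' := C.symPre.null.zero_mem'
  add_mem' := C.symPre.null.add_mem'
  smul_mem' := by
    intro a b hb ε hε
    obtain ⟨r, hr, N₁, h₁⟩ := C.symPre.cauchy_bdd a
    obtain ⟨δ, hδ, h₃⟩ := C.symNrm_mul_small hr hε
    obtain ⟨N₂, h₂⟩ := hb δ hδ
    refine ⟨max N₁ N₂, fun n hn => ?_⟩
    have h4 := h₂ n (le_of_max_le_right hn)
    rw [sub_zero] at h4 ⊢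
    exact h₃ (a.1 n) (b.1 n) (h₁ n (le_of_max_le_left hn)) h4

/-- `Sym_R(C)`: the completion of the symmetric algebra. -/
def Sym : Type u := C.symCauchy ⧸ C.symNull

instance : CommRing C.Sym := inferInstanceAs (CommRing (C.symCauchy ⧸ C.symNull))
instance : Algebra R.carrier C.Sym := inferInstanceAs (Algebra R.carrier (C.symCauchy ⧸ C.symNull))

/-- The norm of `Sym_R(C)`. -/
def SymNrm (x : C.Sym) : ℝ := C.symPre.complNrm x

/-- The canonical map from the symmetric algebra to its completion. -/
def toSym : C.SymAlg →ₐ[R.carrier] C.Sym :=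
  (Ideal.Quotient.mkₐ R.carrier C.symNull).comp
    (AlgHom.codRestrict (Pi.constAlgHom R.carrier ℕ C.SymAlg) C.symCauchy
      fun x => (SNModule.constSeq (X := C.symPre) x).2)

/-- The canonical map `C → Sym_R(C)`. -/
def symι (c : C.M) : C.Sym := C.toSym (SymmetricAlgebra.ι R.carrier C.M.carrier c)

theorem nrm_ι_mul_ι_le (c d : C.M) : C.symNrm (SymmetricAlgebra.ι R.carrier C.M.carrier c *
    SymmetricAlgebra.ι R.carrier C.M.carrier d) ≤ 1 * C.M.nrm c * C.M.nrm d := by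
  have := C.symNrm_leaf_le (.inr (c, [d]))
  simpa [symVal, symWeight] using this

/-- The multiplication `∇ : C ⊗_R C → Sym_R(C)`, `c ⊗ d ↦ cd`. -/
def nabla : LipMap (C.M.tensor C.M) C.symPre.completion :=
  lift (((LinearMap.mul R.carrier C.SymAlg).compl₁₂ (SymmetricAlgebra.ι R.carrier C.M.carrier)
      (SymmetricAlgebra.ι R.carrier C.M.carrier)).compr₂ (SNModule.toCompl (X := C.symPre)))
    ⟨1, zero_le_one, fun c d => (SNModule.complNrm_toCompl_le (X := C.symPre) _).trans
      (C.nrm_ι_mul_ι_le c d)⟩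
    ((min_self C.M.C).trans C.C_eq).ge

/-- The element `∇((1 ⊗ σ)(Δ c)) - η(c)` of `Sym_R(C)`. -/
def relation (c : C.M) : C.Sym :=
  (show C.Sym from C.nabla (map (idMap C.M) C.σ le_rfl (C.Δ c))) -
    algebraMap R.carrier C.Sym (C.η c)

theorem SymNrm_sub_le (x y : C.Sym) : C.SymNrm (x - y) ≤ R.C * max (C.SymNrm x) (C.SymNrm y) :=
  SNModule.complNrm_sub_le (X := C.symPre) x y

theorem SymNrm_mul_le (x y : C.Sym) : C.SymNrm (x * y) ≤ max 1 R.D * C.SymNrm x * C.SymNrm y := by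
  have hD : 0 < max 1 R.D := lt_max_of_lt_left one_pos
  have key : ∀ r > C.SymNrm x, ∀ s > C.SymNrm y, C.SymNrm (x * y) ≤ max 1 R.D * r * s := by
    intro r hr s hs
    obtain ⟨a, ha, N, hN⟩ := SNModule.exists_rep (X := C.symPre) x hr
    obtain ⟨b, hb, M, hM⟩ := SNModule.exists_rep (X := C.symPre) y hs
    have hr0 : 0 ≤ r := (SNModule.complNrm_nonneg (X := C.symPre) x).trans hr.le
    have hs0 : 0 ≤ s := (SNModule.complNrm_nonneg (X := C.symPre) y).trans hs.le
    have e : x * y = C.symPre.null.mkQ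
        ⟨HMul.hMul (α := ℕ → C.SymAlg) (β := ℕ → C.SymAlg) a.1 b.1, C.symCauchy_mul a.2 b.2⟩ := by
      rw [← ha, ← hb]; rfl
    rw [e]
    refine SNModule.complNrm_le (X := C.symPre) (N := max N M) _ (by positivity) fun n hn => ?_
    refine (C.symNrm_mul_le (a.1 n) (b.1 n)).trans ?_
    exact mul_le_mul (mul_le_mul_of_nonneg_left (hN n (le_of_max_le_left hn)) hD.le)
      (hM n (le_of_max_le_right hn)) (C.symNrm_nonneg _) (by positivity)
  have hlim : Filter.Tendsto (fun ε : ℝ => max 1 R.D * (C.SymNrm x + ε) * (C.SymNrm y + ε))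
      (nhdsWithin 0 (Set.Ioi 0)) (nhds (max 1 R.D * (C.SymNrm x + 0) * (C.SymNrm y + 0))) :=
    (Continuous.tendsto (by fun_prop) 0).mono_left nhdsWithin_le_nhds
  rw [add_zero, add_zero] at hlim
  refine ge_of_tendsto hlim ?_
  filter_upwards [self_mem_nhdsWithin] with ε hε
  exact key _ (lt_add_of_pos_right _ hε) _ (lt_add_of_pos_right _ hε)

/-- The closure of an ideal of `Sym_R(C)`. -/
def closure (J : Ideal C.Sym) : Ideal C.Sym where
  carrier := {x | ∀ ε > 0, ∃ j ∈ J, C.SymNrm (x - j) < ε}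
  zero_mem' := fun ε hε => ⟨0, J.zero_mem, by
    have : C.SymNrm 0 = 0 := C.symPre.completion.nrm_zero
    rwa [sub_zero, this]⟩
  add_mem' := by
    intro x y hx hy ε hε
    have hC := R.C_pos
    obtain ⟨j, hj, h⟩ := hx (ε / R.C) (by positivity)
    obtain ⟨k, hk, h'⟩ := hy (ε / R.C / R.C) (by positivity)
    refine ⟨j + k, J.add_mem hj hk, ?_⟩
    have h1 : C.SymNrm (-(y - k)) < ε / R.C := by
      rw [lt_div_iff₀ hC] at h'
      have : C.SymNrm (-(y - k)) ≤ R.C * C.SymNrm (y - k) :=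
        C.symPre.completion.nrm_neg_le (y - k)
      linarith
    have h2 := C.symPre.completion.nrm_sub_lt h h1
    have e : x + y - (j + k) = x - j - -(y - k) := by ring
    rw [e]; exact h2
  smul_mem' := by
    intro z x hx ε hε
    have hD : 0 < max 1 R.D := lt_max_of_lt_left one_pos
    have hz : 0 ≤ C.SymNrm z := SNModule.complNrm_nonneg (X := C.symPre) z
    obtain ⟨j, hj, h⟩ := hx (ε / (max 1 R.D * C.SymNrm z + 1)) (by positivity)
    refine ⟨z * j, J.mul_mem_left z hj, ?_⟩
    rw [lt_div_iff₀ (by positivity)] at h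
    have h1 := C.SymNrm_mul_le z (x - j)
    have h2 : 0 ≤ C.SymNrm (x - j) := SNModule.complNrm_nonneg (X := C.symPre) _
    rw [smul_eq_mul, ← mul_sub]
    nlinarith

/-- The closure of the ideal generated by the elements `∇((1 ⊗ σ)(Δ c)) - η(c)`. -/
def relIdeal : Ideal C.Sym := C.closure (Ideal.span (Set.range C.relation))

/-- The algebra `Sym_R(C)` modulo the closure of the ideal generated by the relations. -/
abbrev SIsoAlg : Type u := C.Sym ⧸ C.relIdeal

/-- The quotient norm on `SIsoAlg`. -/
def quotNrm (x : C.SIsoAlg) : ℝ :=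
  sInf {r | ∃ y : C.Sym, Ideal.Quotient.mk C.relIdeal y = x ∧ C.SymNrm y = r}

end InvComonoid

end

noncomputable section

open Halo LipModule

/-! ### Comparison of norms, quotients and series -/

namespace Halo

/-! Evaluation turns the problem into one about Lipschitz maps `C → S`. The map `α_{C,S}` sends `a`
to the `S`-linear extension of `c ↦ a(c)`, so its bijectivity identifies `C^∨ ⊗_R S` with the
Lipschitz linear maps `g : C → S` (`valueLip_injective`, `valueLip_surjective`). Under this
identification the product becomes the convolution `g * h = (g ⊗ h) ∘ Δ` followed by multiplication
(`valueLip_ptsMul`), the unit becomes `ρ ∘ η`, and the involution becomes `g ↦ g ∘ σ`. A short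
isometry is therefore a map `g` with uniformly bounded products of values and with `g * (g ∘ σ) = 1
= (g ∘ σ) * g`.

Boundedness of products is exactly what makes the multiplicative extension of `g` Lipschitz for the
largest semi-norm on the symmetric algebra (`symAlgLift_bound`), so that it extends to the
completion `Sym_R(C)`. The equation `g * (g ∘ σ) = 1` says that this extension kills the relations.
Its kernel is closed, so it factors through the quotient (`symLift_eq_zero`, `sisoLift`).
Conversely, restricting a morphism to `C` gives a map with bounded products and `g * (g ∘ σ) = 1`.

The delicate point is the other equation `(g ∘ σ) * g = 1`, which is not among the relations:
because `σ` reverses `Δ` and `S` is commutative, composing the first equation with `σ` only returns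
the first equation. It follows from a finiteness property of `C`. The hypothesis for the square-zero
extension `S = R ⊕ C` yields a point `a` whose values are those of the inclusion `C → R ⊕ C`.
Approximating `a` by a finite sum of pure tensors and projecting to `C` gives a finite-rank
endomorphism of `C` close to the identity, hence invertible by a Neumann series. So `C` has a finite
dual basis (`exists_dual_basis`). Convolution operators then become matrices over the commutative
ring `S`, for which one-sided inverses are two-sided (`convS_eq_one_comm`).

As for norms, the quotient norm is complete, but `|1|` may differ from `1` and its multiplicative
constant is `max 1 D_R`. The operator norm of multiplication is equivalent to it, is
submultiplicative and has `|1| = 1` on a nonzero ring, so the constants `C_R` and `D_R` are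
admissible (`CAlg.ofNrm`). -/

theorem CauchyFor.of_le {X : Type*} [Sub X] {p q : X → ℝ} {L : ℝ} (hL : 0 ≤ L)
    (hp : ∀ x, 0 ≤ p x) (h : ∀ x, q x ≤ L * p x) {a : ℕ → X} (ha : CauchyFor p a) :
    CauchyFor q a := by
  intro ε hε
  obtain ⟨N, hN⟩ := ha (ε / (L + 1)) (by positivity)
  refine ⟨N, fun m hm n hn => ?_⟩
  have h1 := hN m hm n hn
  rw [lt_div_iff₀ (by positivity)] at h1
  have := h (a m - a n)
  have := hp (a m - a n)
  nlinarith

theorem ConvergesFor.of_le {X : Type*} [Sub X] {p q : X → ℝ} {L : ℝ} (hL : 0 ≤ L)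
    (hp : ∀ x, 0 ≤ p x) (h : ∀ x, q x ≤ L * p x) {a : ℕ → X} {x : X} (ha : ConvergesFor p a x) :
    ConvergesFor q a x := by
  intro ε hε
  obtain ⟨N, hN⟩ := ha (ε / (L + 1)) (by positivity)
  refine ⟨N, fun n hn => ?_⟩
  have h1 := hN n hn
  rw [lt_div_iff₀ (by positivity)] at h1
  have := h (a n - x)
  have := hp (a n - x)
  nlinarith

end Halo

namespace LipModule

variable {R : LipHalo.{u}}

/-- Splitting off the first term costs a factor `C` on it and `C * C` on the remaining sum. Since `C
* C * θ ≤ 1`, the decay by `θ` pays for this, and the bound does not depend on the number `p` of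
terms. -/
theorem nrm_sum_le (N : LipModule R) {d : ℕ → N.carrier} {L θ : ℝ} (hL : 0 ≤ L) (hθ : 0 ≤ θ)
    (hC : N.C * N.C * θ ≤ 1) (hd : ∀ k, N.nrm (d k) ≤ L * θ ^ k) (p n : ℕ) :
    N.nrm (∑ k ∈ Finset.range p, d (n + k)) ≤ N.C * (L * θ ^ n) := by
  have hC0 := N.C_pos
  induction p generalizing n with
  | zero => simpa [N.nrm_zero] using by positivity
  | succ p ih =>
    rw [Finset.sum_range_succ', add_comm]
    refine (N.nrm_add_le _ _).trans (mul_le_mul_of_nonneg_left (max_le (hd n) ?_) hC0.le)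
    have h1 := ih (n + 1)
    simp only [add_assoc, add_comm 1] at h1
    refine (mul_le_mul_of_nonneg_left h1 hC0.le).trans ?_
    have : N.C * (N.C * (L * θ ^ (n + 1))) = (N.C * N.C * θ) * (L * θ ^ n) := by ring
    rw [this]
    exact mul_le_of_le_one_left (by positivity) hC

/-- A series dominated by a geometric series of small ratio converges. -/
theorem exists_sum (N : LipModule R) {d : ℕ → N.carrier} {L θ : ℝ} (hL : 0 ≤ L) (hθ : 0 ≤ θ)
    (hθ1 : θ < 1) (hC : N.C * N.C * θ ≤ 1) (hd : ∀ k, N.nrm (d k) ≤ L * θ ^ k) :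
    ∃ s, ConvergesFor N.nrm (fun p => ∑ k ∈ Finset.range p, d k) s := by
  have hC0 := N.C_pos
  refine N.complete _ fun ε hε => ?_
  have key : ∀ m n, m ≤ n → N.nrm (∑ k ∈ Finset.range n, d k - ∑ k ∈ Finset.range m, d k) ≤
      N.C * (L * θ ^ m) := by
    intro m n hmn
    obtain ⟨p, rfl⟩ := Nat.exists_eq_add_of_le hmn
    rw [Finset.sum_range_add_sub_sum_range]
    exact N.nrm_sum_le hL hθ hC hd p m
  -- The factor `C * L + 1` absorbs the tail bound `C * (L * θ ^ m)`. The factor `C + 1` leaves room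
  -- for the sign change `|-x| ≤ C |x|`, needed when the two indices come in the other order.
  obtain ⟨K, hK⟩ := exists_pow_lt_of_lt_one
    (by positivity : 0 < ε / (N.C * L + 1) / (N.C + 1)) hθ1
  have small : ∀ m ≥ K, N.C * (L * θ ^ m) < ε / (N.C + 1) := by
    intro m hm
    have h1 : θ ^ m ≤ θ ^ K := pow_le_pow_of_le_one hθ hθ1.le hm
    have h2 : 0 ≤ θ ^ m := by positivity
    have h3 : θ ^ m < ε / (N.C + 1) / (N.C * L + 1) := by
      rw [div_right_comm]; exact h1.trans_lt hK
    rw [lt_div_iff₀ (by positivity)] at h3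
    have : 0 ≤ N.C * L := by positivity
    nlinarith
  have small' : ∀ m ≥ K, ∀ n ≥ m,
      N.nrm (∑ k ∈ Finset.range n, d k - ∑ k ∈ Finset.range m, d k) < ε / (N.C + 1) :=
    fun m hm n hn => (key m n hn).trans_lt (small m hm)
  have h0 : 0 < N.C + 1 := by positivity
  refine ⟨K, fun m hm n hn => ?_⟩
  rcases le_total n m with h | h
  · exact (small' n hn m h).trans_le (div_le_self hε.le (by linarith))
  · have h1 := small' m hm n h
    rw [lt_div_iff₀ h0] at h1
    have h2 := N.nrm_neg_le (∑ k ∈ Finset.range n, d k - ∑ k ∈ Finset.range m, d k)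
    rw [neg_sub] at h2
    have h3 := N.nrm_nonneg (∑ k ∈ Finset.range n, d k - ∑ k ∈ Finset.range m, d k)
    nlinarith

theorem exists_small_ratio (N : LipModule R) : ∃ θ : ℝ, 0 < θ ∧ θ < 1 ∧ N.C * N.C * θ ≤ 1 := by
  have hC := N.C_pos
  have h : (0 : ℝ) < N.C * N.C + 2 := by positivity
  refine ⟨1 / (N.C * N.C + 2), by positivity, ?_, ?_⟩
  · rw [div_lt_one h]; nlinarith
  · rw [mul_one_div, div_le_one h]; linarith

/-- A quotient of a complete module is complete. -/
theorem complete_of_quotient (N : LipModule R) {Y : Type*} [AddCommGroup Y] (π : N.carrier →+ Y)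
    {q : Y → ℝ} {C : ℝ} (hC : 0 < C) (hsub : ∀ x y, q (x - y) ≤ C * max (q x) (q y))
    (hπ : ∀ x, q (π x) ≤ N.nrm x) (hlift : ∀ y r, q y < r → ∃ x, π x = y ∧ N.nrm x < r)
    (a : ℕ → Y) (ha : CauchyFor q a) : ∃ x, ConvergesFor q a x := by
  obtain ⟨θ, hθ, hθ1, hθC⟩ := N.exists_small_ratio
  -- `K k` is a threshold past which the sequence varies by less than `θ ^ k`. The partial sums `I
  -- k` dominate `K k` and increase with `k`, so consecutive terms of `a ∘ I` differ by less than `θ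
  -- ^ k`.
  choose K hK using fun k : ℕ => ha (θ ^ k) (by positivity)
  let I : ℕ → ℕ := fun k => ∑ i ∈ Finset.range (k + 1), K i
  have hI : ∀ k, K k ≤ I k := fun k =>
    Finset.single_le_sum (f := K) (fun _ _ => Nat.zero_le _) (Finset.self_mem_range_succ k)
  have hI' : ∀ k, I k ≤ I (k + 1) := fun k => by
    simp only [I]; rw [Finset.sum_range_succ _ (k + 1)]; exact Nat.le_add_right _ _
  -- The differences of consecutive terms of the subsequence lift to elements of norm below `θ ^ k`.
  -- Their series converges upstairs, and the image of its sum telescopes.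
  choose d hd hd' using fun k => hlift _ _
    (hK k (I (k + 1)) ((hI k).trans (hI' k)) (I k) (hI k))
  obtain ⟨s, hs⟩ := N.exists_sum zero_le_one hθ.le hθ1 hθC (d := d)
    (fun k => by rw [one_mul]; exact (hd' k).le)
  have hsum : ∀ p, π (∑ k ∈ Finset.range p, d k) = a (I p) - a (I 0) := by
    intro p
    rw [map_sum]
    simp only [hd]
    exact Finset.sum_range_sub (fun k => a (I k)) p
  refine ⟨a (I 0) + π s, fun ε hε => ?_⟩
  obtain ⟨N₁, h₁⟩ := hs (ε / C / (N.C + 1)) (by have := N.C_pos; positivity)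
  obtain ⟨N₂, h₂⟩ := exists_pow_lt_of_lt_one (by positivity : 0 < ε / C) hθ1
  refine ⟨K (max N₁ N₂), fun n hn => ?_⟩
  set p := max N₁ N₂
  have e1 : q (a n - a (I p)) < ε / C := (hK p n hn (I p) (hI p)).trans_le
    ((pow_le_pow_of_le_one hθ.le hθ1.le (le_max_right _ _)).trans h₂.le)
  have e2 : q (π (s - ∑ k ∈ Finset.range p, d k)) < ε / C := by
    refine (hπ _).trans_lt ?_
    have h3 := h₁ p (le_max_left _ _)
    have h4 := N.nrm_neg_le (∑ k ∈ Finset.range p, d k - s)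
    rw [neg_sub] at h4
    have h5 := N.nrm_nonneg (∑ k ∈ Finset.range p, d k - s)
    have := N.C_pos
    rw [lt_div_iff₀ (by positivity)] at h3
    simp only at h3
    nlinarith
  have e3 := (hsub _ _).trans_lt (mul_lt_mul_of_pos_left (max_lt e1 e2) hC)
  rw [mul_div_cancel₀ _ hC.ne', map_sub, hsum] at e3
  have e4 : a n - (a (I 0) + π s) = a n - a (I p) - (π s - (a (I p) - a (I 0))) := by abel
  rw [e4]
  exact e3

end LipModule

/-! ### Complete norms on algebras -/

namespace Halo

variable {A : Type u} [CommRing A]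

/-- A complete norm on a ring, with constants `C` and `E`, without a condition on `|1|`. -/
structure IsAlgNrm (q : A → ℝ) (C E : ℝ) : Prop where
  nonneg : ∀ x, 0 ≤ q x
  eq_zero : ∀ x, q x = 0 ↔ x = 0
  sub_le : ∀ x y, q (x - y) ≤ C * max (q x) (q y)
  E_nonneg : 0 ≤ E
  mul_le : ∀ x y, q (x * y) ≤ E * q x * q y
  complete : ∀ a : ℕ → A, CauchyFor q a → ∃ x, ConvergesFor q a x

/-! ### The operator norm of multiplication -/

/-- The operator norm of the multiplication by `x`. -/
def mulNrm (q : A → ℝ) (x : A) : ℝ := sInf {K | 0 ≤ K ∧ ∀ y, q (x * y) ≤ K * q y}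

theorem mulNrm_nonneg (q : A → ℝ) (x : A) : 0 ≤ mulNrm q x := Real.sInf_nonneg fun _ h => h.1

theorem mulNrm_le {q : A → ℝ} {x : A} {K : ℝ} (hK : 0 ≤ K) (h : ∀ y, q (x * y) ≤ K * q y) :
    mulNrm q x ≤ K := csInf_le ⟨0, fun _ h => h.1⟩ ⟨hK, h⟩

namespace IsAlgNrm

variable {q : A → ℝ} {C E : ℝ}

theorem nrm_mul_le_mulNrm (h : IsAlgNrm q C E) (x y : A) : q (x * y) ≤ mulNrm q x * q y := by
  have hx : ∀ y, q (x * y) ≤ E * q x * q y := h.mul_le x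
  rcases (h.nonneg y).eq_or_lt with h0 | h0
  · simpa [← h0] using hx y
  · rw [← div_le_iff₀ h0]
    exact le_csInf ⟨E * q x, mul_nonneg h.E_nonneg (h.nonneg x), hx⟩
      fun L hL => (div_le_iff₀ h0).2 (hL.2 y)

theorem mulNrm_le_nrm (h : IsAlgNrm q C E) (x : A) : mulNrm q x ≤ E * q x :=
  mulNrm_le (mul_nonneg h.E_nonneg (h.nonneg x)) (h.mul_le x)

/-- Multiplication by `x` is tested on `1`. Together with `mulNrm_le_nrm` this makes the two norms
equivalent, with constants `q 1` and `E`. -/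
theorem nrm_le_mulNrm (h : IsAlgNrm q C E) (x : A) : q x ≤ q 1 * mulNrm q x := by
  simpa [mul_comm] using h.nrm_mul_le_mulNrm x 1

end IsAlgNrm

end Halo

theorem LipHalo.one_le_D (R : LipHalo.{u}) [Nontrivial R.carrier] : 1 ≤ R.D := by
  have := R.nrm_mul_le 1 1
  rwa [mul_one, R.nrm_one inferInstance, mul_one, mul_one] at this

/-- The `R`-algebra given by a complete norm on a ring.  The norm is replaced by the equivalent
operator norm, which satisfies `|1| = 1` and `|x y| ≤ |x| |y|`. -/
def CAlg.ofNrm {R : LipHalo.{u}} {A : Type u} [CommRing A] (ρ : R.carrier →+* A) {q : A → ℝ}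
    {E : ℝ} (h : IsAlgNrm q R.C E) (hρ : ∃ K, ∀ r, q (ρ r) ≤ K * R.nrm r) : CAlg R where
  carrier := A
  nrm := mulNrm q
  C := R.C
  D := R.D
  C_pos := R.C_pos
  D_pos := R.D_pos
  nrm_nonneg := mulNrm_nonneg q
  nrm_one := fun _ => by
    have h1 : 0 < q 1 := (h.nonneg 1).lt_of_ne fun h0 => one_ne_zero ((h.eq_zero 1).1 h0.symm)
    -- For the lower bound, `q 1 ≤ q 1 * mulNrm q 1` may be divided by `q 1 > 0`.
    refine le_antisymm (mulNrm_le zero_le_one fun y => by simp) ?_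
    have := h.nrm_le_mulNrm 1
    rwa [le_mul_iff_one_le_right h1] at this
  nrm_eq_zero := fun x => by
    constructor
    · intro h0
      have := h.nrm_le_mulNrm x
      rw [h0, mul_zero] at this
      exact (h.eq_zero x).1 (le_antisymm this (h.nonneg x))
    · rintro rfl
      refine le_antisymm ((h.mulNrm_le_nrm 0).trans_eq ?_) (mulNrm_nonneg q 0)
      rw [(h.eq_zero 0).2 rfl, mul_zero]
  nrm_sub_le := fun x y => by
    have hC := R.C_pos
    have h0 := le_max_of_le_left (c := mulNrm q y) (mulNrm_nonneg q x)
    refine mulNrm_le (by positivity) fun z => ?_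
    rw [sub_mul, mul_assoc, max_mul_of_nonneg _ _ (h.nonneg z)]
    exact (h.sub_le _ _).trans (mul_le_mul_of_nonneg_left
      (max_le_max (h.nrm_mul_le_mulNrm x z) (h.nrm_mul_le_mulNrm y z)) hC.le)
  nrm_mul_le := fun x y => by
    have hD := R.D_pos
    have hx := mulNrm_nonneg q x
    have hy := mulNrm_nonneg q y
    refine mulNrm_le (by positivity) fun z => ?_
    -- The operator norm is submultiplicative without any constant, and `1 ≤ D_R` then allows the
    -- constant `D_R`. That inequality needs `R ≠ 0`, which follows from `A ≠ 0`; the zero algebra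
    -- is treated apart.
    rcases subsingleton_or_nontrivial A with hA | hA
    · rw [Subsingleton.elim (x * y * z) 0, (h.eq_zero 0).2 rfl]
      exact mul_nonneg (by positivity) (h.nonneg z)
    · have := ρ.domain_nontrivial
      have hz := h.nonneg z
      rw [mul_assoc x]
      refine (h.nrm_mul_le_mulNrm x _).trans ((mul_le_mul_of_nonneg_left
        (h.nrm_mul_le_mulNrm y z) hx).trans ?_)
      rw [mul_assoc R.D, mul_assoc R.D, ← mul_assoc]
      exact le_mul_of_one_le_left (by positivity) R.one_le_D
  complete := fun a ha => by
    obtain ⟨x, hx⟩ := h.complete a (ha.of_le (h.nonneg 1) (mulNrm_nonneg q) h.nrm_le_mulNrm)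
    exact ⟨x, hx.of_le h.E_nonneg h.nonneg h.mulNrm_le_nrm⟩
  ρ := ρ
  lip := by
    obtain ⟨K, hK⟩ := hρ
    exact ⟨E * K, fun r => (h.mulNrm_le_nrm _).trans
      ((mul_le_mul_of_nonneg_left (hK r) h.E_nonneg).trans_eq (by ring))⟩
  C_le := le_rfl
  D_le := le_rfl

/-! ### Convolution of Lipschitz maps with values in an algebra -/

namespace CAlg

open InvComonoid

variable {R : LipHalo.{u}} {S : CAlg R} {M N P : LipModule R}

theorem mulPair_bound (g : LipMap M S.asModule) (h : LipMap N S.asModule) (m : M) (n : N) :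
    S.asModule.nrm (S.mulBilin.compl₁₂ g.1 h.1 m n) ≤
      S.D * SNModule.opNrm g * SNModule.opNrm h * M.nrm m * N.nrm n := by
  have hD := S.D_pos
  have hg := SNModule.opNrm_nonneg g
  have hm := M.nrm_nonneg m
  refine (S.nrm_mul_le (g m) (h n)).trans ((mul_le_mul (mul_le_mul_of_nonneg_left
    (nrm_apply_le g m) hD.le) (nrm_apply_le h n) (S.nrm_nonneg _) (by positivity)).trans_eq ?_)
  ring

theorem mulPair_const_nonneg (g : LipMap M S.asModule) (h : LipMap N S.asModule) :
    0 ≤ S.D * SNModule.opNrm g * SNModule.opNrm h :=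
  mul_nonneg (mul_nonneg S.D_pos.le (SNModule.opNrm_nonneg g)) (SNModule.opNrm_nonneg h)

/-- The map `m ⊗ n ↦ g(m) h(n)`. -/
def mulPair (g : LipMap M S.asModule) (h : LipMap N S.asModule) (hC : S.C ≤ min M.C N.C) :
    LipMap (M.tensor N) S.asModule :=
  lift (S.mulBilin.compl₁₂ g.1 h.1) ⟨_, mulPair_const_nonneg g h, mulPair_bound g h⟩ hC

theorem mulPair_tmul (g : LipMap M S.asModule) (h : LipMap N S.asModule)
    (hC : S.C ≤ min M.C N.C) (m : M) (n : N) :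
    mulPair g h hC (tmul m n) = S.mulBilin (g m) (h n) := lift_tmul _ _ _ _ _

theorem nrm_mulPair_le (g : LipMap M S.asModule) (h : LipMap N S.asModule)
    (hC : S.C ≤ min M.C N.C) (x : M.tensor N) : S.nrm (mulPair g h hC x) ≤
      S.C * (S.D * SNModule.opNrm g * SNModule.opNrm h) * (M.tensor N).nrm x := by
  unfold mulPair
  exact nrm_lift_le (P := S.asModule) _ _ _ (mulPair_const_nonneg g h) (mulPair_bound g h) x

theorem mulPair_eq {g : LipMap M S.asModule} {h : LipMap N S.asModule} {hC : S.C ≤ min M.C N.C}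
    {φ : LipMap (M.tensor N) S.asModule}
    (H : ∀ m n, S.mulBilin (g m) (h n) = φ (tmul m n)) : mulPair g h hC = φ :=
  tensor_ext fun m n => (mulPair_tmul g h hC m n).trans (H m n)

/-- `mulPair`, evaluated at `x`, as a bilinear map. -/
def mulPairBilin (hC : S.C ≤ min M.C N.C) (x : M.tensor N) :
    LipMap M S.asModule →ₗ[R.carrier] LipMap N S.asModule →ₗ[R.carrier] S.asModule.carrier :=
  LinearMap.mk₂ R.carrier (fun g h => mulPair g h hC x)
    (fun g g' h => congrArg (fun φ : LipMap (M.tensor N) S.asModule => φ x)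
      (mulPair_eq (φ := mulPair g h hC + mulPair g' h hC) fun m n => by
        change _ = mulPair g h hC (tmul m n) + mulPair g' h hC (tmul m n)
        rw [mulPair_tmul, mulPair_tmul]
        exact S.mulBilin.map_add₂ (g m) (g' m) (h n)))
    (fun r g h => congrArg (fun φ : LipMap (M.tensor N) S.asModule => φ x)
      (mulPair_eq (φ := r • mulPair g h hC) fun m n => by
        change _ = r • mulPair g h hC (tmul m n)
        rw [mulPair_tmul]
        exact S.mulBilin.map_smul₂ r (g m) (h n)))
    (fun g h h' => congrArg (fun φ : LipMap (M.tensor N) S.asModule => φ x)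
      (mulPair_eq (φ := mulPair g h hC + mulPair g h' hC) fun m n => by
        change _ = mulPair g h hC (tmul m n) + mulPair g h' hC (tmul m n)
        rw [mulPair_tmul, mulPair_tmul]
        exact (S.mulBilin (g m)).map_add (h n) (h' n)))
    (fun r g h => congrArg (fun φ : LipMap (M.tensor N) S.asModule => φ x)
      (mulPair_eq (φ := r • mulPair g h hC) fun m n => by
        change _ = r • mulPair g h hC (tmul m n)
        rw [mulPair_tmul]
        exact (S.mulBilin (g m)).map_smul r (h n)))

variable (S)

/-- The structure map `R → S` as a Lipschitz linear map. -/
def ρLip : LipMap R.asModule S.asModule :=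
  ⟨{ toFun := S.ρ
     map_add' := map_add S.ρ
     map_smul' := map_mul S.ρ }, by
    obtain ⟨K, hK⟩ := S.lip
    exact ⟨max K 0, le_max_right _ _, fun r => (hK r).trans
      (mul_le_mul_of_nonneg_right (le_max_left _ _) (R.nrm_nonneg r))⟩⟩

/-- The multiplication by `s ∈ S` as a Lipschitz linear map. -/
def mulLip (s : S) : LipMap S.asModule S.asModule :=
  ⟨S.mulBilin s, S.D * S.nrm s, mul_nonneg S.D_pos.le (S.nrm_nonneg s), fun t => S.nrm_mul_le s t⟩

variable {S}

end CAlg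

/-! ### The convolution monoid of Lipschitz maps from C to S -/

namespace InvComonoid

open CAlg

variable {R : LipHalo.{u}} {C : InvComonoid R} {S : CAlg R}

/-- A bilinear map on `C × C` with values in `S` passes to the completed tensor product only under
this comparison of constants. -/
theorem _root_.CAlg.C_le_min (C : InvComonoid R) (S : CAlg R) : S.C ≤ min C.M.C C.M.C :=
  S.C_le.trans (C.C_eq.ge.trans (min_self _).ge)

/-- The convolution `(g * h)(c) = (g ⊗ h)(Δ c)`. -/
def convS (g h : LipMap C.M S.asModule) : LipMap C.M S.asModule :=
  compLip (mulPair g h (C_le_min C S)) C.Δ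

theorem convS_apply (g h : LipMap C.M S.asModule) (c : C.M) :
    convS g h c = mulPair g h (C_le_min C S) (C.Δ c) := rfl

variable (C S) in
/-- The unit for the convolution. -/
def convOne : LipMap C.M S.asModule := compLip S.ρLip C.η

theorem counitLeft_tmul {M : LipModule R} (η : LipMap M R.asModule) (m n : M) :
    counitLeft η (tmul m n) = (show R.carrier from η m) • n := lift_tmul _ _ _ _ _

theorem swap_tmul {M N : LipModule R} (m : M) (n : N) : swap M N (tmul m n) = tmul n m :=
  lift_tmul _ _ _ _ _

theorem one_convS (h : LipMap C.M S.asModule) : convS (convOne C S) h = h := by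
  refine Subtype.ext (LinearMap.ext fun c => ?_)
  have : mulPair (convOne C S) h (C_le_min C S) = compLip h (counitLeft C.η) :=
    mulPair_eq fun m n => by
      change _ = h.1 (counitLeft C.η (tmul m n))
      rw [counitLeft_tmul, map_smul]; rfl
  change mulPair (convOne C S) h (C_le_min C S) (C.Δ c) = _
  rw [this]
  exact congrArg h.1 (C.counit_left c)

theorem convS_one (h : LipMap C.M S.asModule) : convS h (convOne C S) = h := by
  refine Subtype.ext (LinearMap.ext fun c => ?_)
  have : mulPair h (convOne C S) (C_le_min C S) = compLip h (counitRight C.η) :=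
    mulPair_eq fun m n => by
      change _ = h.1 (counitLeft C.η (swap C.M C.M (tmul m n)))
      rw [swap_tmul, counitLeft_tmul, map_smul]
      exact mul_comm (G := S.carrier) _ _
  change mulPair h (convOne C S) (C_le_min C S) (C.Δ c) = _
  rw [this]
  exact congrArg h.1 (C.counit_right c)

theorem assoc_tmul {M N P : LipModule R} (x : M.tensor N) (p : P) :
    assoc M N P (tmul x p) = tmulRight M N P p x := lift_tmul _ _ _ _ _

/-- Both sides are the same trilinear map `tri : x ⊗ (y ⊗ z) ↦ f(x) g(y) h(z)`, applied to the two
iterated comultiplications, which coassociativity identifies. -/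
theorem convS_assoc (f g h : LipMap C.M S.asModule) :
    convS (convS f g) h = convS f (convS g h) := by
  have hC := C_le_min C S
  have hC' : S.C ≤ min C.M.C (C.M.tensor C.M).C :=
    le_min (hC.trans (min_le_left _ _)) hC
  let tri : LipMap (C.M.tensor (C.M.tensor C.M)) S.asModule := mulPair f (mulPair g h hC) hC'
  -- The element `x = Δ m` need not be a pure tensor. So the identity is proved for all `x`, with
  -- `p` fixed, as an equality of Lipschitz maps.
  have h1 : ∀ p x, S.mulBilin (mulPair f g hC x) (h p) = tri (tmulRight C.M C.M C.M p x) := by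
    intro p x
    have : compLip (S.mulLip (h p)) (mulPair f g hC) =
        compLip tri (tmulRight C.M C.M C.M p) := tensor_ext fun m n => by
      change S.mulBilin (h p) (mulPair f g hC (tmul m n)) = tri (tmulRight C.M C.M C.M p (tmul m n))
      rw [tmulRight_tmul, mulPair_tmul]
      simp only [tri]
      rw [mulPair_tmul, mulPair_tmul]
      exact (mul_comm (G := S.carrier) _ _).trans (mul_assoc (G := S.carrier) _ _ _)
    exact (mul_comm (G := S.carrier) _ _).trans
      (congrArg (fun φ : LipMap (C.M.tensor C.M) S.asModule => φ x) this)
  have h2 : mulPair (convS f g) h hC = compLip tri (compLip (assoc C.M C.M C.M)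
      (map C.Δ (idMap C.M) (min_le_min (min_self C.M.C).le le_rfl))) := mulPair_eq fun m n => by
    change _ = tri (assoc C.M C.M C.M
      (map C.Δ (idMap C.M) (min_le_min (min_self C.M.C).le le_rfl) (tmul m n)))
    rw [map_tmul, assoc_tmul]
    exact h1 n (C.Δ m)
  have h3 : mulPair f (convS g h) hC = compLip tri
      (map (idMap C.M) C.Δ (min_le_min le_rfl (min_self C.M.C).le)) := mulPair_eq fun m n => by
    change _ = tri (map (idMap C.M) C.Δ (min_le_min le_rfl (min_self C.M.C).le) (tmul m n))
    rw [map_tmul]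
    exact (mulPair_tmul f (mulPair g h hC) hC' m (C.Δ n)).symm
  refine Subtype.ext (LinearMap.ext fun c => ?_)
  change mulPair (convS f g) h hC (C.Δ c) = mulPair f (convS g h) hC (C.Δ c)
  rw [h2, h3]
  exact congrArg tri.1 (C.coassoc c)

/-! ### Points as Lipschitz maps -/

/-- `c ↦ a(c)` as a Lipschitz map. -/
def valueLip (a : C.pts S) : LipMap C.M S.asModule :=
  ⟨valueLin a, S.C * S.asModule.D * (C.pts S).nrm a, mul_nonneg (mul_nonneg S.C_pos.le
    S.asModule.D_pos.le) ((C.pts S).nrm_nonneg a), nrm_value_le a⟩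

theorem opNrm_valueLip_le (a : C.pts S) :
    SNModule.opNrm (valueLip a) ≤ S.C * S.asModule.D * (C.pts S).nrm a :=
  SNModule.opNrm_le (mul_nonneg (mul_nonneg S.C_pos.le
    S.asModule.D_pos.le) ((C.pts S).nrm_nonneg a)) (nrm_value_le a)

variable (C S) in
/-- `a ↦ (c ↦ a(c))` as a linear map. -/
def valueHom : (C.pts S).carrier →ₗ[R.carrier] LipMap C.M S.asModule where
  toFun := valueLip
  map_add' a b := Subtype.ext (LinearMap.ext fun c => map_add (C.ev S c).1 a b)
  map_smul' r a := Subtype.ext (LinearMap.ext fun c => map_smul (C.ev S c).1 r a)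

theorem value_tmul (f : C.dual) (s : S.carrier) (c : C.M) :
    value (S := S) (tmul (M := C.dual) (N := S.asModule) f s) c =
      (S.ρ (f.1 c) * s : S.carrier) := ev_tmul c f s

theorem mulPair_valueLip_tmul (f g : C.dual) (s t : S.asModule) (x : C.M.tensor C.M) :
    mulPair (valueLip (tmul f s)) (valueLip (tmul g t)) (C_le_min C S) x =
      S.mulBilin (S.mulBilin s t) (S.ρLip (pair f g x)) := by
  have : mulPair (valueLip (tmul f s)) (valueLip (tmul g t)) (C_le_min C S) =
      compLip (S.mulLip (S.mulBilin s t)) (compLip S.ρLip (pair f g)) := mulPair_eq fun m n => by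
    change value (S := S) (tmul f s) m * value (S := S) (tmul g t) n =
      S.mulBilin (S.mulBilin s t) (S.ρLip (pair f g (tmul m n)))
    rw [pair_tmul]
    refine (congrArg₂ (fun x y : S.carrier => x * y) (value_tmul f s m) (value_tmul g t n)).trans ?_
    exact (mul_mul_mul_comm (G := S.carrier) _ _ _ _).trans ((mul_comm (G := S.carrier) _ _).trans
      (congrArg (S.mulBilin (S.mulBilin s t))
        (map_mul S.ρ (f.1 m) (g.1 n)).symm))
  rw [this]; rfl

/-- `b ↦ (a ⊗ b)(x)` and `a ↦ (a ⊗ b)(x)` are Lipschitz. -/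
theorem mulPair_valueLip_bound (x : C.M.tensor C.M) (a b : C.pts S) :
    S.nrm (mulPair (valueLip a) (valueLip b) (C_le_min C S) x) ≤
      S.C * (S.D * (S.C * S.asModule.D) * (S.C * S.asModule.D)) * (C.M.tensor C.M).nrm x *
        (C.pts S).nrm a * (C.pts S).nrm b := by
  have hC := S.C_pos
  have hD := S.D_pos
  have hD' := S.asModule.D_pos
  have hx := (C.M.tensor C.M).nrm_nonneg x
  have ha := (C.pts S).nrm_nonneg a
  refine (nrm_mulPair_le _ _ _ x).trans ((mul_le_mul_of_nonneg_right (mul_le_mul_of_nonneg_left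
    (mul_le_mul (mul_le_mul_of_nonneg_left (opNrm_valueLip_le a) hD.le) (opNrm_valueLip_le b)
      (SNModule.opNrm_nonneg _) (by positivity)) hC.le) hx).trans_eq ?_)
  ring

/-- Both sides, evaluated at a fixed `c`, are Lipschitz linear in `a` and in `b` separately. It is
therefore enough to compare them on pure tensors, where they equal `(f ⊗ g)(Δ c)` times `st`. -/
theorem valueLip_ptsMul (a b : C.pts S) :
    valueLip (C.ptsMul S a b) = convS (valueLip a) (valueLip b) := by
  refine Subtype.ext (LinearMap.ext fun c => ?_)
  have hC := S.C_pos
  have hD := S.D_pos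
  have hD' := S.asModule.D_pos
  have hx := (C.M.tensor C.M).nrm_nonneg (C.Δ c)
  have ha := (C.pts S).nrm_nonneg
  -- `L` and `L'` are the two partial maps of `(a, b) ↦ (a ⊗ b)(Δ c)`. Their Lipschitz bounds
  -- justify the density argument, first in `b` and then in `a`.
  let L : C.pts S → LipMap (C.pts S) S.asModule := fun a =>
    ⟨(mulPairBilin (C_le_min C S) (C.Δ c) (valueLip a)).comp (valueHom C S), _,
      by have := ha a; positivity, mulPair_valueLip_bound (C.Δ c) a⟩
  let L' : C.pts S → LipMap (C.pts S) S.asModule := fun b =>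
    ⟨((mulPairBilin (C_le_min C S) (C.Δ c)).flip (valueLip b)).comp (valueHom C S),
      S.C * (S.D * (S.C * S.asModule.D) * (S.C * S.asModule.D)) *
        (C.M.tensor C.M).nrm (C.Δ c) * (C.pts S).nrm b,
      by have := ha b; positivity, fun a => (mulPair_valueLip_bound (C.Δ c) a b).trans_eq
        (by ring)⟩
  refine C.pts_ext (f := compLip (C.ev S c) (C.ptsMulLeft S a)) (g := L a) (fun g t => ?_) b
  refine C.pts_ext (f := compLip (C.ev S c) (C.ptsMulRight S (tmul g t)))
    (g := L' (tmul g t)) (fun f s => ?_) a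
  change value (C.ptsMul S (tmul f s) (tmul g t)) c =
    mulPair (valueLip (tmul f s)) (valueLip (tmul g t)) (C_le_min C S) (C.Δ c)
  rw [ptsMul_tmul, mulPair_valueLip_tmul]
  exact (value_tmul (convFun f g) _ c).trans (mul_comm _ _)

theorem valueLip_ptsσ (a : C.pts S) : valueLip (C.ptsσ S a) = compLip (valueLip a) C.σ := by
  refine Subtype.ext (LinearMap.ext fun c => ?_)
  refine C.pts_ext (f := compLip (C.ev S c) (C.ptsσ S)) (g := C.ev S (C.σ c)) (fun f s => ?_) a
  change C.ev S c (C.ptsσ S (tmul f s)) = _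
  have : C.ptsσ S (tmul f s) = tmul (C.dualσ f) s := map_tmul _ _ _ _ _
  rw [this, ev_tmul, ev_tmul]; rfl

theorem valueLip_ptsOne : valueLip (C.ptsOne S) = convOne C S := by
  refine Subtype.ext (LinearMap.ext fun c => ?_)
  exact (value_tmul (S := S) C.η 1 c).trans (mul_one _)

/-! ### The map α and the values of points -/

/-- The extension `c ⊗ s ↦ g(c) s` of `g`. -/
def extendS (g : LipMap C.M S.asModule) : LipMap (C.M.tensor S.asModule) S.asModule :=
  mulPair g (idMap S.asModule) (le_min (S.C_le.trans C.C_eq.ge) le_rfl)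

theorem extendS_mem (g : LipMap C.M S.asModule) : extendS g ∈ C.homS S := by
  intro s x
  have : compLip (extendS g) (C.scalarAct S s) = compLip (S.mulLip s) (extendS g) :=
    tensor_ext fun c t => by
      change extendS g (C.scalarAct S s (tmul c t)) = S.mulBilin s (extendS g (tmul c t))
      have e : C.scalarAct S s (tmul c t) = tmul (N := S.asModule) c (S.mulBilin s t) :=
        map_tmul _ _ _ _ _
      rw [e]
      simp only [extendS]
      rw [mulPair_tmul, mulPair_tmul]
      exact mul_left_comm (G := S.carrier) _ _ _
  exact congrArg (fun φ : LipMap (C.M.tensor S.asModule) S.asModule => φ x) this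

theorem alpha_tmul (a : C.pts S) (c : C.M) (s : S.asModule) :
    alpha a (tmul c s) = S.mulBilin (value a c) s := lift_tmul _ _ _ _ _

theorem alpha_eq_extendS (a : C.pts S) : alpha a = extendS (valueLip a) :=
  tensor_ext fun c s => (alpha_tmul a c s).trans
    (mulPair_tmul (valueLip a) (idMap S.asModule) _ c s).symm

/-- `α` factors through `valueLip`, so injectivity of `α` passes to `valueLip`. -/
theorem valueLip_injective (h : C.AlphaIso S) :
    Function.Injective (valueLip : C.pts S → LipMap C.M S.asModule) := fun a b hab =>
  h.1.injOn (Set.mem_univ a) (Set.mem_univ b) (by rw [alpha_eq_extendS, alpha_eq_extendS, hab])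

/-- The `S`-linear extension of `g` is in the image of `α`. Evaluating at `c ⊗ 1` recovers `g` as
the values of the preimage. -/
theorem valueLip_surjective (h : C.AlphaIso S) :
    Function.Surjective (valueLip : C.pts S → LipMap C.M S.asModule) := by
  intro g
  obtain ⟨a, -, ha⟩ := h.1.surjOn (extendS_mem g)
  refine ⟨a, Subtype.ext (LinearMap.ext fun c => ?_)⟩
  have h1 := congrArg (fun φ : LipMap (C.M.tensor S.asModule) S.asModule =>
    φ (tmul (N := S.asModule) c (1 : S.carrier))) ha
  have h2 : extendS g (tmul (N := S.asModule) c (1 : S.carrier)) =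
    S.mulBilin (g c) (1 : S.carrier) := mulPair_tmul _ _ _ c _
  have h3 : alpha a (tmul (N := S.asModule) c (1 : S.carrier)) =
    S.mulBilin (value a c) (1 : S.carrier) := alpha_tmul a c _
  exact (mul_one (M := S.carrier) (value a c)).symm.trans
    (h3.symm.trans (h1.trans (h2.trans (mul_one (M := S.carrier) (g c)))))

end InvComonoid

/-! ### Square-zero extensions -/

namespace LipModule

variable {R : LipHalo.{u}} (M : LipModule R)

/-- `M` as a right module. -/
abbrev opModule : Module (R.carrier)ᵐᵒᵖ M.carrier :=
  Module.compHom M.carrier ((RingHom.id R.carrier).fromOpposite mul_comm)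

attribute [local instance] opModule

/-- The left and right actions have to agree for the square-zero extension to be a commutative ring.
-/
theorem isCentralScalar : IsCentralScalar R.carrier M.carrier := ⟨fun _ _ => rfl⟩

attribute [local instance] isCentralScalar

/-- The maximum norm on the square-zero extension `R ⊕ M`. -/
def sqZeroNrm (x : TrivSqZeroExt R.carrier M.carrier) : ℝ := max (R.nrm x.fst) (M.nrm x.snd)

theorem isAlgNrm_sqZeroNrm (hM : M.C = R.C) :
    IsAlgNrm M.sqZeroNrm R.C (R.D + R.C * (1 + R.C) * M.D) where
  nonneg x := le_max_of_le_left (R.nrm_nonneg _)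
  eq_zero x := by
    constructor
    · intro h
      have h1 : R.nrm x.fst ≤ 0 := (le_max_left _ _).trans_eq h
      have h2 : M.nrm x.snd ≤ 0 := (le_max_right _ _).trans_eq h
      exact TrivSqZeroExt.ext ((R.nrm_eq_zero _).1 (le_antisymm h1 (R.nrm_nonneg _)))
        (M.eq_zero_of_nrm _ (le_antisymm h2 (M.nrm_nonneg _)))
    · rintro rfl
      simp [sqZeroNrm, M.nrm_zero, (R.nrm_eq_zero 0).2 rfl]
  sub_le x y := by
    have hC := R.C_pos
    refine max_le ((R.nrm_sub_le _ _).trans (mul_le_mul_of_nonneg_left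
      (max_le_max (le_max_left _ _) (le_max_left _ _)) hC.le)) ?_
    have := M.nrm_sub_le x.snd y.snd
    rw [hM] at this
    exact this.trans (mul_le_mul_of_nonneg_left
      (max_le_max (le_max_right _ _) (le_max_right _ _)) hC.le)
  E_nonneg := by
    have := R.C_pos
    have := R.D_pos
    have := M.D_pos
    positivity
  mul_le x y := by
    have hC := R.C_pos
    have hD := R.D_pos
    have hD' := M.D_pos
    have hx : 0 ≤ M.sqZeroNrm x := le_max_of_le_left (R.nrm_nonneg _)
    have hy : 0 ≤ M.sqZeroNrm y := le_max_of_le_left (R.nrm_nonneg _)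
    have hx1 : R.nrm x.fst ≤ M.sqZeroNrm x := le_max_left _ _
    have hx2 : M.nrm x.snd ≤ M.sqZeroNrm x := le_max_right _ _
    have hy1 : R.nrm y.fst ≤ M.sqZeroNrm y := le_max_left _ _
    have hy2 : M.nrm y.snd ≤ M.sqZeroNrm y := le_max_right _ _
    have hxy : 0 ≤ M.sqZeroNrm x * M.sqZeroNrm y := mul_nonneg hx hy
    have h1 : R.nrm (x * y).fst ≤ R.D * (M.sqZeroNrm x * M.sqZeroNrm y) := by
      rw [TrivSqZeroExt.fst_mul]
      refine (R.nrm_mul_le _ _).trans ?_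
      rw [mul_assoc]
      exact mul_le_mul_of_nonneg_left (mul_le_mul hx1 hy1 (R.nrm_nonneg _) hx) hD.le
    have h2 : M.nrm (x.fst • y.snd) ≤ M.D * (M.sqZeroNrm x * M.sqZeroNrm y) := by
      refine (M.nrm_smul_le _ _).trans ?_
      rw [mul_assoc]
      exact mul_le_mul_of_nonneg_left (mul_le_mul hx1 hy2 (M.nrm_nonneg _) hx) hD'.le
    have h3 : M.nrm (y.fst • x.snd) ≤ M.D * (M.sqZeroNrm x * M.sqZeroNrm y) := by
      refine (M.nrm_smul_le _ _).trans ?_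
      rw [mul_assoc, mul_comm (M.sqZeroNrm x)]
      exact mul_le_mul_of_nonneg_left (mul_le_mul hy1 hx2 (M.nrm_nonneg _) hy) hD'.le
    -- The two summands of the second component are bounded by `B = M.D * |x| * |y|`, and `|m + n| ≤
    -- C max(|m|, C |n|)` then gives at most `C * (1 + C) * B`.
    have h4 : M.nrm (x * y).snd ≤ R.C * (1 + R.C) * M.D * (M.sqZeroNrm x * M.sqZeroNrm y) := by
      rw [TrivSqZeroExt.snd_mul, op_smul_eq_smul]
      refine (M.nrm_add_le _ _).trans ?_
      rw [hM, mul_assoc, mul_assoc]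
      have h0 : 0 ≤ M.D * (M.sqZeroNrm x * M.sqZeroNrm y) := by positivity
      refine mul_le_mul_of_nonneg_left (max_le ?_ ?_) hC.le
      · nlinarith
      · nlinarith
    have h5 : 0 ≤ R.C * (1 + R.C) * M.D * (M.sqZeroNrm x * M.sqZeroNrm y) := by positivity
    have h6 : 0 ≤ R.D * (M.sqZeroNrm x * M.sqZeroNrm y) := by positivity
    rw [mul_assoc, add_mul]
    exact max_le (h1.trans (by linarith)) (h4.trans (by linarith))
  complete a ha := by
    obtain ⟨r, hr⟩ := R.complete (fun n => (a n).fst) fun ε hε => by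
      obtain ⟨N, hN⟩ := ha ε hε
      exact ⟨N, fun m hm n hn => (le_max_left _ _).trans_lt (hN m hm n hn)⟩
    obtain ⟨m, hm⟩ := M.complete (fun n => (a n).snd) fun ε hε => by
      obtain ⟨N, hN⟩ := ha ε hε
      exact ⟨N, fun m hm n hn => (le_max_right _ _).trans_lt (hN m hm n hn)⟩
    refine ⟨(r, m), fun ε hε => ?_⟩
    obtain ⟨N₁, h₁⟩ := hr ε hε
    obtain ⟨N₂, h₂⟩ := hm ε hε
    exact ⟨max N₁ N₂, fun n hn => max_lt (h₁ n (le_of_max_le_left hn))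
      (h₂ n (le_of_max_le_right hn))⟩

theorem sqZeroNrm_inr (m : M) : M.sqZeroNrm (TrivSqZeroExt.inr m) = M.nrm m := by
  simp [sqZeroNrm, (R.nrm_eq_zero 0).2 rfl, M.nrm_nonneg]

/-- The square-zero extension `R ⊕ M`. -/
def sqZero (hM : M.C = R.C) : CAlg R :=
  CAlg.ofNrm (TrivSqZeroExt.inlHom R.carrier M.carrier) (M.isAlgNrm_sqZeroNrm hM)
    ⟨1, fun r => by simp [sqZeroNrm, M.nrm_zero, R.nrm_nonneg]⟩

/-- The inclusion `M → R ⊕ M`. -/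
def sqZeroInr (hM : M.C = R.C) : LipMap M (M.sqZero hM).asModule :=
  ⟨{ toFun := fun m => (TrivSqZeroExt.inr m : TrivSqZeroExt R.carrier M.carrier)
     map_add' := fun m n => TrivSqZeroExt.inr_add R.carrier m n
     map_smul' := fun r m => (TrivSqZeroExt.inl_mul_inr r m).symm },
    -- The norm of `sqZero` is the operator norm, so the multiplicative constant of the maximum norm
    -- enters here. The projection below uses the reverse comparison, with the constant `M.sqZeroNrm
    -- 1`.
    _, (M.isAlgNrm_sqZeroNrm hM).E_nonneg, fun m =>
      ((M.isAlgNrm_sqZeroNrm hM).mulNrm_le_nrm _).trans_eq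
        (congrArg _ (M.sqZeroNrm_inr m))⟩

/-- The projection `R ⊕ M → M`. -/
def sqZeroSnd (hM : M.C = R.C) : LipMap (M.sqZero hM).asModule M :=
  ⟨{ toFun := fun x => TrivSqZeroExt.snd (R := R.carrier) (M := M.carrier) x
     map_add' := fun _ _ => rfl
     map_smul' := fun r x => (TrivSqZeroExt.snd_mul (R := R.carrier) (M := M.carrier)
      (TrivSqZeroExt.inl r) x).trans (by simp) },
    M.sqZeroNrm 1, (M.isAlgNrm_sqZeroNrm hM).nonneg 1, fun x =>
      (le_max_right _ _).trans ((M.isAlgNrm_sqZeroNrm hM).nrm_le_mulNrm x)⟩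

/-! ### Perturbation of the identity -/

/-- A linear map close to the identity is bijective. -/
theorem bijective_of_close {M : LipModule R} {θ : ℝ} (hθ : 0 ≤ θ) (hθ1 : θ < 1)
    (hC : M.C * M.C * θ ≤ 1) (F : M.carrier →ₗ[R.carrier] M.carrier)
    (hF : ∀ m, M.nrm (m - F m) ≤ θ * M.nrm m) : Function.Bijective F := by
  constructor
  · refine (injective_iff_map_eq_zero F).2 fun m hm => M.eq_zero_of_nrm m ?_
    have h1 := hF m
    have h2 := M.nrm_nonneg m
    rw [hm, sub_zero] at h1
    nlinarith
  · intro m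
    -- Neumann series: the preimage of `m` is the sum of `T ^ k m` with `T = 1 - F`, which converges
    -- because `|T ^ k m| ≤ θ ^ k |m|`.
    let T : M.carrier →ₗ[R.carrier] M.carrier := LinearMap.id - F
    have hT : ∀ k, M.nrm ((T ^ k) m) ≤ M.nrm m * θ ^ k := by
      intro k
      induction k with
      | zero => simp
      | succ k ih =>
        rw [pow_succ', Module.End.mul_apply, pow_succ]
        refine (hF ((T ^ k) m)).trans ((mul_le_mul_of_nonneg_left ih hθ).trans_eq ?_)
        ring
    obtain ⟨s, hs⟩ := M.exists_sum (M.nrm_nonneg m) hθ hθ1 hC hT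
    have hsum : ∀ p, F (∑ k ∈ Finset.range p, (T ^ k) m) = m - (T ^ p) m := by
      intro p
      induction p with
      | zero => simp
      | succ p ih =>
        rw [Finset.sum_range_succ, map_add, ih, pow_succ', Module.End.mul_apply]
        simp only [T, LinearMap.sub_apply, LinearMap.id_apply]
        abel
    -- The images under `F` of the partial sums tend to `F s` by continuity, and to `m` because they
    -- equal `m - T ^ p m`.
    refine ⟨s, M.tendsto_unique (a := fun p => F (∑ k ∈ Finset.range p, (T ^ k) m)) ?_ ?_⟩
    -- Closeness to the identity already makes `F` Lipschitz: `F y = y - (y - F y)`.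
    · have hFy : ∀ y, M.nrm (F y) ≤ M.C * M.nrm y := by
        intro y
        have h1 := M.nrm_sub_le y (y - F y)
        rw [sub_sub_cancel] at h1
        have h2 := M.nrm_nonneg y
        refine h1.trans (mul_le_mul_of_nonneg_left (max_le le_rfl ((hF y).trans ?_)) M.C_pos.le)
        nlinarith
      intro ε hε
      obtain ⟨N, hN⟩ := hs (ε / M.C) (div_pos hε M.C_pos)
      refine ⟨N, fun n hn => ?_⟩
      have h1 := hN n hn
      rw [lt_div_iff₀ M.C_pos, mul_comm] at h1
      dsimp only at h1 ⊢
      rw [← map_sub]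
      exact (hFy _).trans_lt h1
    · intro ε hε
      have hm := M.nrm_nonneg m
      have hC0 := M.C_pos
      obtain ⟨N, hN⟩ := exists_pow_lt_of_lt_one
        (by positivity : 0 < ε / (M.C * M.nrm m + 1)) hθ1
      refine ⟨N, fun n hn => ?_⟩
      dsimp only
      rw [hsum, sub_sub_cancel_left]
      have h1 := (pow_le_pow_of_le_one hθ hθ1.le hn).trans_lt hN
      rw [lt_div_iff₀ (by positivity)] at h1
      have h2 := (M.nrm_neg_le ((T ^ n) m)).trans (mul_le_mul_of_nonneg_left (hT n) hC0.le)
      have h3 : 0 ≤ θ ^ n := by positivity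
      nlinarith

end LipModule

/-! ### A finite dual basis of C -/

namespace InvComonoid

open CAlg

variable {R : LipHalo.{u}} {C : InvComonoid R}

variable (C) in
/-- The map from the algebraic tensor product to `C^∨ ⊗_R S`. -/
def toPts (S : CAlg R) :
    TensorProduct R.carrier C.dual.carrier S.asModule.carrier →ₗ[R.carrier] (C.pts S).carrier :=
  SNModule.toCompl (X := C.dual.preTensor S.asModule)

/-- An element of the algebraic tensor product takes the values of a finite sum of pure tensors. -/
theorem exists_value_eq_sum (S : CAlg R)
    (x : TensorProduct R.carrier C.dual.carrier S.asModule.carrier) :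
    ∃ t : Finset (C.dual.carrier × S.carrier), ∀ c,
      value (C.toPts S x) c =
        ∑ i ∈ t, (S.ρ (i.1.1 c) * i.2 : S.carrier) := by
  obtain ⟨t, ht⟩ := TensorProduct.exists_finset x
  refine ⟨t, fun c => ?_⟩
  subst ht
  rw [map_sum]
  refine (map_sum (C.ev S c).1 _ _).trans (Finset.sum_congr rfl fun i _ => ?_)
  exact value_tmul (S := S) i.1 i.2 c

/-- If `α_{C,S}` is surjective for the square-zero extension `S = R ⊕ C`, then `C` has a finite
dual basis. -/
theorem exists_dual_basis (h : C.AlphaIso (C.M.sqZero C.C_eq)) :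
    ∃ (ι : Type u) (_ : Fintype ι) (f : ι → C.dual.carrier) (m : ι → C.M.carrier),
      ∀ c, c = ∑ i, (show R.carrier from (f i).1 c) • m i := by
  obtain ⟨θ, hθ, hθ1, hC⟩ := C.M.exists_small_ratio
  set S := C.M.sqZero C.C_eq with hS
  set π : LipMap S.asModule C.M := C.M.sqZeroSnd C.C_eq with hπ
  -- This `a` represents the inclusion `C → R ⊕ C`, so `π (a(c)) = c` for the projection `π`.
  obtain ⟨a, ha⟩ := valueLip_surjective h (C.M.sqZeroInr C.C_eq)
  have hL : 0 ≤ SNModule.opNrm π * (S.C * S.asModule.D) :=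
    mul_nonneg (SNModule.opNrm_nonneg _) (mul_nonneg S.C_pos.le S.asModule.D_pos.le)
  set L := SNModule.opNrm π * (S.C * S.asModule.D) with hLdef
  -- Algebraic tensors are dense. `L` is the constant in `|π (a(c))| ≤ L |a| |c|`, so an error of at
  -- most `θ / (L + 1)` keeps the resulting endomorphism within `θ` of the identity. The further
  -- division by the constant `C` of the module pays for the change of sign from `b - a` to `a - b`.
  obtain ⟨x, hx⟩ : ∃ x, (C.pts S).nrm (C.toPts S x - a) <
        θ / (L + 1) / (C.pts S).C := by
    obtain ⟨b, rfl⟩ := (C.dual.preTensor S.asModule).null.mkQ_surjective a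
    obtain ⟨N, hN⟩ := SNModule.toCompl_tendsto b (θ / (L + 1) / (C.pts S).C)
      (div_pos (by positivity) (C.pts S).C_pos)
    exact ⟨_, hN N le_rfl⟩
  set b : C.pts S := C.toPts S x with hb
  have hab : (C.pts S).nrm (a - b) ≤ θ / (L + 1) := by
    rw [lt_div_iff₀ (C.pts S).C_pos] at hx
    have := (C.pts S).nrm_neg_le (b - a)
    rw [neg_sub] at this
    linarith
  obtain ⟨t, ht⟩ := exists_value_eq_sum S x
  -- `F c = ∑ fᵢ(c) π(sᵢ)` has finite rank and differs from `c = π (a(c))` by `π ((a - b)(c))`.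
  let F : C.M.carrier →ₗ[R.carrier] C.M.carrier := π.1 ∘ₗ (valueLip b).1
  have hF : ∀ c, C.M.nrm (c - F c) ≤ θ * C.M.nrm c := by
    intro c
    have e : c - F c = π (value (a - b) c) := by
      have h1 : valueLip (a - b) = valueLip a - valueLip b := map_sub (valueHom C S) a b
      have h2 : value (a - b) c = (valueLip (a - b)).1 c := rfl
      rw [h2, h1, ha]
      exact (map_sub π.1 (C.M.sqZeroInr C.C_eq c) (value b c)).symm
    rw [e]
    have h3 := C.M.nrm_nonneg c
    have h4 : L * (C.pts S).nrm (a - b) ≤ θ := by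
      refine (mul_le_mul_of_nonneg_left hab hL).trans ?_
      rw [← mul_div_assoc, div_le_iff₀ (by positivity)]
      nlinarith
    refine (nrm_apply_le π _).trans ((mul_le_mul_of_nonneg_left (nrm_value_le (a - b) c)
      (SNModule.opNrm_nonneg π)).trans ((Eq.le ?_).trans (mul_le_mul_of_nonneg_right h4 h3)))
    rw [hLdef]; ring
  have hbij := bijective_of_close hθ.le hθ1 hC F hF
  let e := LinearEquiv.ofBijective F hbij
  -- Applying `F⁻¹` to `F c = ∑ fᵢ(c) π(sᵢ)` gives the dual basis, with `mᵢ = F⁻¹ (π(sᵢ))`.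
  refine ⟨t, inferInstance, fun i => i.1.1, fun i => e.symm (π i.1.2), fun c => ?_⟩
  have h1 : F c = ∑ i : t, (show R.carrier from i.1.1.1 c) • π i.1.2 := by
    change π (value b c) = _
    rw [hb, ht c, ← Finset.sum_coe_sort t]
    refine (map_sum π.1 _ _).trans (Finset.sum_congr rfl fun i _ => ?_)
    exact π.1.map_smul (show R.carrier from i.1.1.1 c) i.1.2
  apply hbij.1
  rw [h1, map_sum]
  refine Finset.sum_congr rfl fun i _ => ?_
  rw [map_smul]
  exact congrArg _ (e.apply_symm_apply _).symm

/-! ### One-sided inverses for the convolution -/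

variable {S : CAlg R} {ι : Type u} [Fintype ι]

theorem sum_apply {M N : LipModule R} (φ : ι → LipMap M N) (m : M) :
    (∑ i, φ i).1 m = ∑ i, (φ i).1 m := by
  rw [Submodule.coe_sum, LinearMap.sum_apply]

/-- Convolution with `u` on the left is linear over `S` in the right factor. This turns an expansion
of `h` into an expansion of `u * h`. -/
theorem convS_sum (u h : LipMap C.M S.asModule) (φ : ι → LipMap C.M S.asModule) (t : ι → S.carrier)
    (hh : ∀ d, h d = ∑ i, S.mulBilin (t i) (φ i d)) (c : C.M) :
    convS u h c = ∑ i, S.mulBilin (t i) (convS u (φ i) c) := by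
  have : mulPair u h (C_le_min C S) =
      ∑ i, compLip (S.mulLip (t i)) (mulPair u (φ i) (C_le_min C S)) := mulPair_eq fun m n => by
    rw [sum_apply, hh, map_sum]
    refine Finset.sum_congr rfl fun i _ => ?_
    change _ = S.mulBilin (t i) (mulPair u (φ i) (C_le_min C S) (tmul m n))
    rw [mulPair_tmul]
    exact mul_left_comm (G := S.carrier) _ _ _
  rw [convS_apply, this, sum_apply]
  rfl

/-- In the presence of a finite dual basis, one-sided inverses are two-sided. -/
theorem convS_eq_one_comm {f : ι → C.dual.carrier} {m : ι → C.M.carrier}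
    (hfm : ∀ c, c = ∑ i, (show R.carrier from (f i).1 c) • m i)
    {u v : LipMap C.M S.asModule} (huv : convS u v = convOne C S) :
    convS v u = convOne C S := by
  classical
  let φ : ι → LipMap C.M S.asModule := fun i => compLip S.ρLip (f i)
  -- Expanding `c` in the dual basis shows that the finitely many `φᵢ = ρ ∘ fᵢ` generate all
  -- Lipschitz maps `C → S` over `S`.
  have hφ : ∀ (h : LipMap C.M S.asModule) (c : C.M), h c = ∑ i, S.mulBilin (h (m i)) (φ i c) := by
    intro h c
    conv_lhs => rw [hfm c]
    refine (map_sum h.1 _ _).trans (Finset.sum_congr rfl fun i _ => ?_)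
    exact (h.1.map_smul (show R.carrier from (f i).1 c) (m i)).trans (mul_comm (G := S.carrier) _ _)
  -- The matrix of `h ↦ u * h` in terms of the generators `φⱼ`, with coordinates read off at the
  -- `mᵢ`. It is multiplicative in `u` by associativity and the expansion `hφ`.
  let A : LipMap C.M S.asModule → Matrix ι ι S.carrier :=
    fun u => Matrix.of fun i j => (convS u (φ j) (m i) : S.carrier)
  have hA : ∀ u v, A u * A v = A (convS u v) := by
    intro u v
    ext i k
    rw [Matrix.mul_apply]
    change _ = convS (convS u v) (φ k) (m i)
    rw [convS_assoc, convS_sum u (convS v (φ k)) φ (fun j => convS v (φ k) (m j))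
      (fun d => hφ _ d)]
    exact Finset.sum_congr rfl fun j _ => mul_comm (G := S.carrier) _ _
  -- The `φⱼ` generate but need not be free, so the unit gives only an idempotent `P`. Adding the
  -- complement `1 - P` turns inverses relative to `P` into honest inverse matrices, and these
  -- commute because `S` is commutative.
  set P := A (convOne C S) with hP
  have h1 : A u * A v = P := by rw [hA, huv]
  have h2 : ∀ w, A w * P = A w := fun w => by rw [hP, hA, convS_one]
  have h3 : ∀ w, P * A w = A w := fun w => by rw [hP, hA, one_convS]
  have h4 : (A u + (1 - P)) * (A v + (1 - P)) = 1 := by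
    have hPP : P * P = P := h2 _
    simp only [add_mul, mul_add, mul_sub, sub_mul, mul_one, one_mul, h1, h2, h3, hPP]
    abel
  have h5 : A v * A u = P := by
    have h6 := mul_eq_one_comm.1 h4
    have hPP : P * P = P := h2 _
    simp only [add_mul, mul_add, mul_sub, sub_mul, mul_one, one_mul, h2, h3, hPP] at h6
    have h7 : A v * A u - P = 0 := by
      have := sub_eq_zero.2 h6
      rw [← this]; abel
    exact sub_eq_zero.1 h7
  rw [hA] at h5
  -- `A (v * u) = P` says that `(v * u) * φₖ` and `φₖ` agree at every `mᵢ`, hence everywhere by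
  -- `hφ`. Expanding the unit in the `φₖ` then gives `v * u = (v * u) * 1 = 1`.
  have h8 : ∀ k, convS (convS v u) (φ k) = φ k := by
    intro k
    refine Subtype.ext (LinearMap.ext fun c => ?_)
    refine (hφ _ c).trans (Eq.trans ?_ (hφ (φ k) c).symm)
    refine Finset.sum_congr rfl fun i _ => congrArg (fun s => S.mulBilin s (φ i c)) ?_
    have h9 := congrFun (congrFun h5 i) k
    have h10 : P i k = (φ k) (m i) := by
      change convS (convOne C S) (φ k) (m i) = _
      rw [one_convS]
    exact h9.trans h10
  rw [← convS_one (convS v u)]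
  refine Subtype.ext (LinearMap.ext fun c => ?_)
  refine (convS_sum (convS v u) (convOne C S) φ _ (fun d => hφ _ d) c).trans ?_
  simp only [h8]
  exact (hφ _ c).symm

end InvComonoid

/-! ### The representing algebra -/

namespace InvComonoid

open CAlg

variable {R : LipHalo.{u}} (C : InvComonoid R)

/-! ### The quotient norm -/

theorem SymNrm_nonneg (x : C.Sym) : 0 ≤ C.SymNrm x :=
  SNModule.complNrm_nonneg (X := C.symPre) x

theorem SymNrm_toSym_le (x : C.SymAlg) : C.SymNrm (C.toSym x) ≤ C.symNrm x :=
  SNModule.complNrm_toCompl_le (X := C.symPre) x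

theorem quotNrm_nonneg (x : C.SIsoAlg) : 0 ≤ C.quotNrm x :=
  Real.sInf_nonneg (by rintro _ ⟨y, -, rfl⟩; exact C.SymNrm_nonneg y)

theorem quotNrm_mk_le (y : C.Sym) : C.quotNrm (Ideal.Quotient.mk C.relIdeal y) ≤ C.SymNrm y :=
  csInf_le ⟨0, by rintro _ ⟨y, -, rfl⟩; exact C.SymNrm_nonneg y⟩ ⟨y, rfl, rfl⟩

theorem exists_lift_of_quotNrm_lt (x : C.SIsoAlg) {r : ℝ} (h : C.quotNrm x < r) :
    ∃ y : C.Sym, Ideal.Quotient.mk C.relIdeal y = x ∧ C.SymNrm y < r := by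
  obtain ⟨y, hy⟩ := Ideal.Quotient.mk_surjective x
  obtain ⟨_, ⟨z, hz, rfl⟩, hr⟩ := exists_lt_of_csInf_lt
    ⟨C.SymNrm y, (⟨y, hy, rfl⟩ : _ ∈ {r | ∃ y : C.Sym, Ideal.Quotient.mk C.relIdeal y = x ∧
      C.SymNrm y = r})⟩ h
  exact ⟨z, hz, hr⟩

/-- To bound by `K` times the quotient norm, it suffices to bound on lifts. -/
theorem le_mul_quotNrm {x : C.SIsoAlg} {K b : ℝ} (hK : 0 ≤ K)
    (h : ∀ y : C.Sym, Ideal.Quotient.mk C.relIdeal y = x → b ≤ K * C.SymNrm y) :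
    b ≤ K * C.quotNrm x := by
  refine le_of_forall_pos_le_add fun ε hε => ?_
  obtain ⟨y, hy, hlt⟩ := C.exists_lift_of_quotNrm_lt x
    (lt_add_of_pos_right _ (by positivity : 0 < ε / (K + 1)))
  refine (h y hy).trans ((mul_le_mul_of_nonneg_left hlt.le hK).trans ?_)
  rw [mul_add]
  refine add_le_add le_rfl ?_
  rw [← mul_div_assoc, div_le_iff₀ (by positivity)]
  nlinarith

theorem quotNrm_sub_le (x y : C.SIsoAlg) :
    C.quotNrm (x - y) ≤ R.C * max (C.quotNrm x) (C.quotNrm y) := by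
  have hC := R.C_pos
  refine le_of_forall_pos_le_add fun ε hε => ?_
  have hε' : 0 < ε / R.C := by positivity
  obtain ⟨a, rfl, ha⟩ := C.exists_lift_of_quotNrm_lt x (lt_add_of_pos_right _ hε')
  obtain ⟨b, rfl, hb⟩ := C.exists_lift_of_quotNrm_lt y (lt_add_of_pos_right _ hε')
  rw [← map_sub]
  refine (C.quotNrm_mk_le _).trans ((C.SymNrm_sub_le a b).trans ?_)
  have h1 := max_le_max ha.le hb.le
  rw [max_add_add_right] at h1
  refine (mul_le_mul_of_nonneg_left h1 hC.le).trans ?_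
  rw [mul_add, mul_div_cancel₀ _ hC.ne']

theorem quotNrm_mul_le (x y : C.SIsoAlg) :
    C.quotNrm (x * y) ≤ max 1 R.D * C.quotNrm x * C.quotNrm y := by
  have hD : 0 < max 1 R.D := lt_max_of_lt_left one_pos
  refine C.le_mul_quotNrm (mul_nonneg hD.le (C.quotNrm_nonneg x)) fun b hb => ?_
  rw [mul_right_comm]
  refine C.le_mul_quotNrm (mul_nonneg hD.le (C.SymNrm_nonneg b)) fun a ha => ?_
  rw [mul_right_comm, ← ha, ← hb, ← map_mul]
  exact (C.quotNrm_mk_le _).trans (C.SymNrm_mul_le a b)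

/-- Separatedness is where the closure of the ideal is needed: a class of norm `0` has arbitrarily
small representatives, so any representative is a limit of elements of the ideal. -/
theorem quotNrm_eq_zero (x : C.SIsoAlg) : C.quotNrm x = 0 ↔ x = 0 := by
  constructor
  · intro h
    obtain ⟨y, rfl⟩ := Ideal.Quotient.mk_surjective x
    rw [Ideal.Quotient.eq_zero_iff_mem]
    intro ε hε
    have hC := R.C_pos
    obtain ⟨z, hz, hz'⟩ := C.exists_lift_of_quotNrm_lt _ (h.trans_lt (by positivity : 0 < ε / R.C))
    have h1 : z - y ∈ C.relIdeal := (Ideal.Quotient.eq).1 hz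
    obtain ⟨j, hj, hj'⟩ := h1 (ε / R.C) (by positivity)
    refine ⟨-j, neg_mem hj, ?_⟩
    have h2 := C.symPre.completion.nrm_sub_lt (x := z) hz' hj'
    have e : y - -j = z - (z - y - j) := by ring
    rw [e]; exact h2
  · rintro rfl
    have h1 := C.quotNrm_mk_le 0
    have h2 : C.SymNrm 0 = 0 := C.symPre.completion.nrm_zero
    rw [map_zero, h2] at h1
    exact le_antisymm h1 (C.quotNrm_nonneg 0)

theorem quotNrm_complete (a : ℕ → C.SIsoAlg) (ha : CauchyFor C.quotNrm a) :
    ∃ x, ConvergesFor C.quotNrm a x :=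
  C.symPre.completion.complete_of_quotient
    (show C.symPre.completion.carrier →+ C.SIsoAlg from
      (Ideal.Quotient.mk C.relIdeal).toAddMonoidHom)
    R.C_pos C.quotNrm_sub_le C.quotNrm_mk_le (fun x _ h => C.exists_lift_of_quotNrm_lt x h) a ha

theorem isAlgNrm_quotNrm : IsAlgNrm C.quotNrm R.C (max 1 R.D) where
  nonneg := C.quotNrm_nonneg
  eq_zero := C.quotNrm_eq_zero
  sub_le := C.quotNrm_sub_le
  E_nonneg := le_max_of_le_left zero_le_one
  mul_le := C.quotNrm_mul_le
  complete := C.quotNrm_complete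

/-- The algebra `SIsoAlg` with the operator norm of the quotient norm. -/
def sisoCAlg : CAlg R :=
  CAlg.ofNrm (algebraMap R.carrier C.SIsoAlg) C.isAlgNrm_quotNrm ⟨1, fun r => by
    rw [one_mul]
    have e : algebraMap R.carrier C.SIsoAlg r = Ideal.Quotient.mk C.relIdeal
      (C.toSym (algebraMap R.carrier C.SymAlg r)) := by rw [AlgHom.commutes]; rfl
    rw [e]
    exact (C.quotNrm_mk_le _).trans ((C.SymNrm_toSym_le _).trans (C.symNrm_leaf_le (.inl r)))⟩

/-! ### Maps out of the symmetric algebra -/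

/-- The canonical map `C → Sym_R(C)` as a Lipschitz map. -/
def symιLip : LipMap C.M C.symPre.completion :=
  ⟨(SNModule.toCompl (X := C.symPre)).comp (SymmetricAlgebra.ι R.carrier C.M.carrier),
    1, zero_le_one, fun c => by
      have h := (C.SymNrm_toSym_le _).trans (C.symNrm_leaf_le (.inr (c, [])))
      simp only [symVal, symWeight, List.map_nil, List.prod_nil, mul_one] at h
      rw [one_mul]; exact h⟩

/-- The multiplication by an element of `Sym_R(C)`. -/
def symMul (z : C.Sym) : LipMap C.symPre.completion C.symPre.completion :=
  ⟨{ toFun := fun x => (z * (show C.Sym from x) : C.Sym)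
     map_add' := fun x y => mul_add (R := C.Sym) z x y
     map_smul' := fun r x => mul_smul_comm r z (show C.Sym from x) },
    max 1 R.D * C.SymNrm z,
    mul_nonneg (le_max_of_le_left zero_le_one) (C.SymNrm_nonneg z), C.SymNrm_mul_le z⟩

variable {C} {S : CAlg R}

/-- A Lipschitz map from `Sym_R(C)` is determined by its values on the symmetric algebra. -/
theorem sym_ext {N : LipModule R} {Φ Ψ : LipMap C.symPre.completion N}
    (h : ∀ x : C.SymAlg, Φ (C.toSym x) = Ψ (C.toSym x)) : Φ = Ψ :=
  SNModule.completion_ext (X := C.symPre) h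

theorem nabla_tmul (c d : C.M) : C.nabla (tmul c d) = (C.symι c * C.symι d : C.Sym) := by
  refine (lift_tmul _ _ _ _ _).trans ?_
  exact map_mul C.toSym _ _

/-- A map that is multiplicative on products of two elements of `C` carries
`∇ (1 ⊗ σ)` to the pairing. -/
theorem mulPair_eq_nabla (g : LipMap C.M S.asModule) (Φ : LipMap C.symPre.completion S.asModule)
    (h : ∀ c d, Φ (C.symι c * C.symι d : C.Sym) = S.mulBilin (g c) (g d)) (x : C.M.tensor C.M) :
    mulPair g (compLip g C.σ) (C_le_min C S) x =
      Φ (C.nabla (map (idMap C.M) C.σ le_rfl x)) := by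
  have : mulPair g (compLip g C.σ) (C_le_min C S) =
      compLip Φ (compLip C.nabla (map (idMap C.M) C.σ le_rfl)) := mulPair_eq fun c d => by
    change _ = Φ (C.nabla (map (idMap C.M) C.σ le_rfl (tmul c d)))
    rw [map_tmul, nabla_tmul]
    exact (h c (C.σ d)).symm
  rw [this]; rfl

/-- The multiplicative extension of `g` to the algebraic symmetric algebra. -/
def symAlgLift (g : LipMap C.M S.asModule) : C.SymAlg →+* S.carrier :=
  letI : Algebra R.carrier S.carrier := S.ρ.toAlgebra
  (SymmetricAlgebra.lift (R := R.carrier) (A := S.carrier)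
    ({ toFun := fun c => g.1 c
       map_add' := fun c d => map_add g.1 c d
       map_smul' := fun r c => map_smul g.1 r c } : C.M.carrier →ₗ[R.carrier] S.carrier)).toRingHom

theorem symAlgLift_ι (g : LipMap C.M S.asModule) (c : C.M) :
    symAlgLift g (SymmetricAlgebra.ι R.carrier C.M.carrier c) = (g c : S.carrier) :=
  letI : Algebra R.carrier S.carrier := S.ρ.toAlgebra
  SymmetricAlgebra.lift_ι_apply _ _

theorem symAlgLift_algebraMap (g : LipMap C.M S.asModule) (r : R.carrier) :
    symAlgLift g (algebraMap R.carrier C.SymAlg r) = S.ρ r :=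
  letI : Algebra R.carrier S.carrier := S.ρ.toAlgebra
  AlgHom.commutes _ r

theorem symAlgLift_smul (g : LipMap C.M S.asModule) (r : R.carrier) (x : C.SymAlg) :
    symAlgLift g (r • x) = S.ρ r * symAlgLift g x := by
  rw [Algebra.smul_def, map_mul, symAlgLift_algebraMap]

/-- The products of values of `g` are bounded. -/
def MulBounded (g : LipMap C.M S.asModule) : Prop :=
  ∃ D > 0, ∀ l : List C.M, S.nrm (List.map (β := S.carrier) (fun c => g.1 c) l).prod ≤
    D * (l.map C.M.nrm).prod

/-- The semi-norm is the largest one below the weights of the leaves and `C_S ≤ C_R`, so only leaves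
have to be tested. Scalars are controlled by the structure map of `S`, nonempty monomials by the
bound on products of values of `g`. -/
theorem symAlgLift_bound {g : LipMap C.M S.asModule} (hg : MulBounded g) :
    ∃ K, 0 ≤ K ∧ ∀ x : C.SymAlg, S.nrm (symAlgLift g x) ≤ K * C.symNrm x := by
  obtain ⟨D, hD, h⟩ := hg
  obtain ⟨L, hL⟩ := S.lip
  refine ⟨max D L, le_max_of_le_left hD.le, fun x => BinTree.le_treeNrm R.C_pos.le C.exists_symTree
    (symAlgLift g).toAddMonoidHom S.nrm S.nrm_nonneg S.C_le S.nrm_sub_le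
      (le_max_of_le_left hD.le) (fun l => ?_) x⟩
  have hw := C.symWeight_nonneg l
  rcases l with r | ⟨c, l⟩
  · change S.nrm (symAlgLift g (algebraMap R.carrier C.SymAlg r)) ≤ _
    rw [symAlgLift_algebraMap]
    exact (hL r).trans (mul_le_mul_of_nonneg_right (le_max_right _ _) hw)
  · have e : symAlgLift g (C.symVal (.inr (c, l))) =
        (List.map (β := S.carrier) (fun c => g.1 c) (c :: l)).prod := by
      simp only [symVal, map_mul, map_list_prod, List.map_map, symAlgLift_ι]
      refine congrArg _ (congrArg List.prod (List.map_congr_left fun d _ => ?_))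
      exact symAlgLift_ι g d
    refine (congrArg S.nrm e).trans_le ((h (c :: l)).trans ?_)
    rw [List.map_cons, List.prod_cons]
    exact mul_le_mul_of_nonneg_right (le_max_left _ _) hw

/-- The extension of `g` to `Sym_R(C)` as a Lipschitz linear map. -/
def symLiftLip (g : LipMap C.M S.asModule) (hg : MulBounded g) :
    LipMap C.symPre.completion S.asModule :=
  SNModule.extend (X := C.symPre) (N := S.asModule)
    ⟨{ toFun := symAlgLift g
       map_add' := map_add (symAlgLift g)
       map_smul' := fun r x => symAlgLift_smul g r x }, symAlgLift_bound hg⟩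

theorem symLiftLip_toSym (g : LipMap C.M S.asModule) (hg : MulBounded g) (x : C.SymAlg) :
    symLiftLip g hg (C.toSym x) = symAlgLift g x :=
  SNModule.extend_toCompl (X := C.symPre) (N := S.asModule) _ x

/-- Multiplicativity holds on the dense image of the symmetric algebra. It extends by continuity in
one factor (`h1`) and then in the other. -/
theorem symLiftLip_mul (g : LipMap C.M S.asModule) (hg : MulBounded g) (z x : C.Sym) :
    symLiftLip g hg (z * x : C.Sym) = S.mulBilin (symLiftLip g hg z) (symLiftLip g hg x) := by
  have h1 : ∀ (z : C.SymAlg) (x : C.Sym), symLiftLip g hg (C.toSym z * x : C.Sym) =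
      S.mulBilin (symLiftLip g hg (C.toSym z)) (symLiftLip g hg x) := by
    intro z x
    have : compLip (symLiftLip g hg) (C.symMul (C.toSym z)) =
        compLip (S.mulLip (symLiftLip g hg (C.toSym z))) (symLiftLip g hg) := sym_ext fun y => by
      change symLiftLip g hg (C.toSym z * C.toSym y : C.Sym) =
        S.mulBilin (symLiftLip g hg (C.toSym z)) (symLiftLip g hg (C.toSym y))
      rw [← map_mul, symLiftLip_toSym, symLiftLip_toSym, symLiftLip_toSym]
      exact map_mul (symAlgLift g) z y
    exact congrArg (fun φ : LipMap C.symPre.completion S.asModule => φ x) this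
  have : compLip (symLiftLip g hg) (C.symMul z) =
      compLip (S.mulLip (symLiftLip g hg z)) (symLiftLip g hg) := sym_ext fun y => by
    change symLiftLip g hg (z * C.toSym y : C.Sym) =
      S.mulBilin (symLiftLip g hg z) (symLiftLip g hg (C.toSym y))
    rw [mul_comm z, h1]
    exact mul_comm (G := S.carrier) _ _
  exact congrArg (fun φ : LipMap C.symPre.completion S.asModule => φ x) this

/-- The extension of `g` to `Sym_R(C)` as a ring homomorphism. -/
def symLift (g : LipMap C.M S.asModule) (hg : MulBounded g) : C.Sym →+* S.carrier where
  toFun := fun x => symLiftLip g hg x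
  map_one' := by
    have := symLiftLip_toSym g hg 1
    rw [map_one] at this
    exact this.trans (map_one (symAlgLift g))
  map_zero' := map_zero (symLiftLip g hg).1
  map_add' := map_add (symLiftLip g hg).1
  map_mul' := symLiftLip_mul g hg

theorem symLift_toSym (g : LipMap C.M S.asModule) (hg : MulBounded g) (x : C.SymAlg) :
    symLift g hg (C.toSym x) = symAlgLift g x := symLiftLip_toSym g hg x

theorem symLift_ι (g : LipMap C.M S.asModule) (hg : MulBounded g) (c : C.M) :
    symLift g hg (C.symι c) = (g c : S.carrier) :=
  (symLift_toSym g hg _).trans (symAlgLift_ι g c)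

theorem symLift_algebraMap (g : LipMap C.M S.asModule) (hg : MulBounded g) (r : R.carrier) :
    symLift g hg (algebraMap R.carrier C.Sym r) = S.ρ r := by
  rw [← AlgHom.commutes C.toSym, symLift_toSym, symAlgLift_algebraMap]

theorem nrm_symLift_le (g : LipMap C.M S.asModule) (hg : MulBounded g) (x : C.Sym) :
    S.nrm (symLift g hg x) ≤ SNModule.opNrm (symLiftLip g hg) * C.SymNrm x :=
  nrm_apply_le (symLiftLip g hg) x

/-- On a relation the extension takes the value `(g * (g ∘ σ))(c) - ρ(η(c)) = 0`, so it vanishes on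
the ideal they generate; being Lipschitz, it vanishes on the closure. -/
theorem symLift_eq_zero {g : LipMap C.M S.asModule} (hg : MulBounded g)
    (h : convS g (compLip g C.σ) = convOne C S) {x : C.Sym} (hx : x ∈ C.relIdeal) :
    symLift g hg x = 0 := by
  have hrel : Ideal.span (Set.range C.relation) ≤ RingHom.ker (symLift g hg) := by
    rw [Ideal.span_le]
    rintro _ ⟨c, rfl⟩
    change symLift g hg (C.relation c) = 0
    have h1 : convS g (compLip g C.σ) c = symLiftLip g hg _ :=
      mulPair_eq_nabla g (symLiftLip g hg) (fun c d => (symLiftLip_mul g hg _ _).trans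
        (congrArg₂ (fun s t => S.mulBilin s t) (symLift_ι g hg c) (symLift_ι g hg d))) (C.Δ c)
    rw [h] at h1
    exact (map_sub (symLift g hg) _ _).trans
      (sub_eq_zero.2 (h1.symm.trans (symLift_algebraMap g hg _).symm))
  refine (S.nrm_eq_zero _).1 (le_antisymm (le_of_forall_pos_le_add fun ε hε => ?_)
    (S.nrm_nonneg _))
  have hK := SNModule.opNrm_nonneg (symLiftLip g hg)
  obtain ⟨j, hj, hjε⟩ := hx (ε / (SNModule.opNrm (symLiftLip g hg) + 1)) (by positivity)
  have h1 : symLift g hg x = symLift g hg (x - j) := by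
    have : symLift g hg j = 0 := hrel hj
    rw [map_sub, this, sub_zero]
  rw [h1, zero_add]
  refine (nrm_symLift_le g hg _).trans ?_
  rw [lt_div_iff₀ (by positivity)] at hjε
  have := C.SymNrm_nonneg (x - j)
  nlinarith

/-- The morphism from the representing algebra given by `g`. -/
def sisoLift (g : LipMap C.M S.asModule) (hg : MulBounded g)
    (h : convS g (compLip g C.σ) = convOne C S) : CAlg.Hom C.sisoCAlg S where
  toRingHom := Ideal.Quotient.lift C.relIdeal (symLift g hg) fun _ hx => symLift_eq_zero hg h hx
  comp_ρ r := symLift_algebraMap g hg r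
  lip := by
    have hK := SNModule.opNrm_nonneg (symLiftLip g hg)
    -- The map is bounded for the quotient norm by testing on lifts; the factor `quotNrm 1` passes
    -- to the operator norm.
    refine ⟨SNModule.opNrm (symLiftLip g hg) * C.quotNrm 1,
      mul_nonneg hK (C.quotNrm_nonneg 1), fun x => ?_⟩
    rw [mul_assoc]
    refine le_trans ?_ (mul_le_mul_of_nonneg_left (C.isAlgNrm_quotNrm.nrm_le_mulNrm x) hK)
    refine C.le_mul_quotNrm hK fun y hy => ?_
    rw [← hy]
    exact nrm_symLift_le g hg y
  -- The representing algebra has exactly the constants of `R`, so every `S` satisfies the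
  -- comparison required of a morphism.
  C_le := S.C_le
  D_le := S.D_le

theorem sisoLift_mk (g : LipMap C.M S.asModule) (hg : MulBounded g)
    (h : convS g (compLip g C.σ) = convOne C S) (c : C.M) :
    (sisoLift g hg h).toRingHom (Ideal.Quotient.mk C.relIdeal (C.symι c)) = (g c : S.carrier) :=
  symLift_ι g hg c

/-! ### Morphisms from the representing algebra -/

/-- The composition of a morphism with `Sym_R(C) → SIsoAlg`. -/
def homSym (φ : CAlg.Hom C.sisoCAlg S) : C.Sym →+* S.carrier :=
  φ.toRingHom.comp (Ideal.Quotient.mk C.relIdeal)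

theorem homSym_algebraMap (φ : CAlg.Hom C.sisoCAlg S) (r : R.carrier) :
    homSym φ (algebraMap R.carrier C.Sym r) = S.ρ r := φ.comp_ρ r

theorem homSym_lip (φ : CAlg.Hom C.sisoCAlg S) :
    ∃ K, 0 ≤ K ∧ ∀ x, S.nrm (homSym φ x) ≤ K * C.SymNrm x := by
  obtain ⟨K, hK, h⟩ := φ.lip
  have hD : 0 ≤ max 1 R.D := le_max_of_le_left zero_le_one
  refine ⟨K * max 1 R.D, mul_nonneg hK hD, fun x => (h _).trans ?_⟩
  rw [mul_assoc]
  exact mul_le_mul_of_nonneg_left ((C.isAlgNrm_quotNrm.mulNrm_le_nrm _).trans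
    (mul_le_mul_of_nonneg_left (C.quotNrm_mk_le x) hD)) hK

/-- `homSym` as a Lipschitz linear map. -/
def homSymLip (φ : CAlg.Hom C.sisoCAlg S) : LipMap C.symPre.completion S.asModule :=
  ⟨{ toFun := fun x => homSym φ x
     map_add' := map_add (homSym φ)
     map_smul' := fun r x => by
      have : homSym φ (r • (show C.Sym from x)) = S.ρ r * homSym φ x := by
        rw [Algebra.smul_def, map_mul, homSym_algebraMap]
      exact this }, homSym_lip φ⟩

/-- The restriction of a morphism to `C`. -/
def homRes (φ : CAlg.Hom C.sisoCAlg S) : LipMap C.M S.asModule := compLip (homSymLip φ) C.symιLip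

theorem homRes_mulBounded (φ : CAlg.Hom C.sisoCAlg S) : MulBounded (homRes φ) := by
  obtain ⟨K, hK, h⟩ := homSym_lip φ
  have h1 : 0 ≤ S.nrm 1 := S.nrm_nonneg 1
  -- The leaves of the semi-norm cover nonempty products only; the empty one is bounded by `S.nrm
  -- 1`. The final `1` makes the constant positive, even for `S = 0`.
  refine ⟨K + S.nrm 1 + 1, by positivity, fun l => ?_⟩
  rcases l with _ | ⟨c, l⟩
  · rw [List.map_nil (f := C.M.nrm), List.prod_nil, mul_one]
    change S.nrm 1 ≤ _
    linarith
  · have hw := C.symWeight_nonneg (.inr (c, l))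
    have e : (List.map (β := S.carrier) (fun c => (homRes φ).1 c) (c :: l)).prod =
        homSym φ (C.toSym (C.symVal (.inr (c, l)))) := by
      simp only [symVal, map_mul, map_list_prod, List.map_map]
      rfl
    refine (congrArg S.nrm e).trans_le ((h _).trans ((mul_le_mul_of_nonneg_left
      ((C.SymNrm_toSym_le _).trans (C.symNrm_leaf_le _)) hK).trans ?_))
    rw [List.map_cons, List.prod_cons]
    exact mul_le_mul_of_nonneg_right (by linarith) hw

/-- A morphism kills each relation, and by `mulPair_eq_nabla` this is the equation at `c`. -/
theorem convS_homRes (φ : CAlg.Hom C.sisoCAlg S) :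
    convS (homRes φ) (compLip (homRes φ) C.σ) = convOne C S := by
  refine Subtype.ext (LinearMap.ext fun c => ?_)
  refine (mulPair_eq_nabla (homRes φ) (homSymLip φ)
    (fun c d => map_mul (homSym φ) (C.symι c) (C.symι d)) (C.Δ c)).trans ?_
  have h1 : homSym φ (C.relation c) = 0 := by
    have : Ideal.Quotient.mk C.relIdeal (C.relation c) = 0 := by
      rw [Ideal.Quotient.eq_zero_iff_mem]
      intro ε hε
      refine ⟨C.relation c, Ideal.subset_span ⟨c, rfl⟩, ?_⟩
      have h0 : C.SymNrm 0 = 0 := C.symPre.completion.nrm_zero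
      rwa [sub_self, h0]
    exact (congrArg φ.toRingHom this).trans (map_zero φ.toRingHom)
  exact (sub_eq_zero.1 ((map_sub (homSym φ) _ _).symm.trans h1)).trans (homSym_algebraMap φ _)

/-- `C` generates the symmetric algebra over `R`, whose image is dense in `Sym_R(C)`, which in turn
surjects onto the representing algebra. -/
theorem homRes_injective : Function.Injective
    (homRes : CAlg.Hom C.sisoCAlg S → LipMap C.M S.asModule) := by
  intro φ ψ h
  have h1 : homSymLip φ = homSymLip ψ := sym_ext fun x => by
    change homSym φ (C.toSym x) = homSym ψ (C.toSym x)
    induction x using SymmetricAlgebra.induction with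
    | algebraMap r => rw [AlgHom.commutes, homSym_algebraMap, homSym_algebraMap]
    | ι c => exact congrArg (fun g : LipMap C.M S.asModule => g c) h
    | add x y hx hy => rw [map_add, map_add, map_add, hx, hy]
    | mul x y hx hy => rw [map_mul, map_mul, map_mul, hx, hy]
  refine CAlg.Hom.ext (RingHom.ext fun x => ?_)
  obtain ⟨y, rfl⟩ := Ideal.Quotient.mk_surjective (I := C.relIdeal) x
  exact congrArg (fun g : LipMap C.symPre.completion S.asModule => g y) h1

theorem homRes_sisoLift (g : LipMap C.M S.asModule) (hg : MulBounded g)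
    (h : convS g (compLip g C.σ) = convOne C S) : homRes (sisoLift g hg h) = g :=
  Subtype.ext (LinearMap.ext fun c => sisoLift_mk g hg h c)

/-! ### Representability -/

/-- Injectivity of evaluation translates the two equations in `C^∨ ⊗_R S` into convolution
equations, and the norm condition is already about values. -/
theorem mem_sisoSet_iff (h : C.AlphaIso S) {a : C.pts S} : a ∈ C.sisoSet S ↔
    MulBounded (valueLip a) ∧ convS (valueLip a) (compLip (valueLip a) C.σ) = convOne C S ∧
      convS (compLip (valueLip a) C.σ) (valueLip a) = convOne C S := by
  rw [← valueLip_ptsσ, ← valueLip_ptsMul, ← valueLip_ptsMul, ← valueLip_ptsOne,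
    (valueLip_injective h).eq_iff, (valueLip_injective h).eq_iff]
  rfl

/-- The point `a ∈ C^∨ ⊗_R S` with the values of `g`. -/
def ptOf (h : C.AlphaIso S) (g : LipMap C.M S.asModule) : C.pts S :=
  (valueLip_surjective h g).choose

theorem valueLip_ptOf (h : C.AlphaIso S) (g : LipMap C.M S.asModule) : valueLip (ptOf h g) = g :=
  (valueLip_surjective h g).choose_spec

/-- The relations give only one of the two isometry equations. The other comes from the finite dual
basis, which uses the hypothesis on `α` for the square-zero extension in addition to `S`. -/
theorem ptOf_homRes_mem (hα : ∀ S : CAlg R, C.AlphaIso S) (φ : CAlg.Hom C.sisoCAlg S) :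
    ptOf (hα S) (homRes φ) ∈ C.sisoSet S := by
  obtain ⟨ι, _, f, m, hfm⟩ := exists_dual_basis (hα (C.M.sqZero C.C_eq))
  rw [mem_sisoSet_iff (hα S), valueLip_ptOf]
  exact ⟨homRes_mulBounded φ, convS_homRes φ, convS_eq_one_comm hfm (convS_homRes φ)⟩

/-- Morphisms from the representing algebra are short isometries. -/
def sisoEquiv (hα : ∀ S : CAlg R, C.AlphaIso S) (S : CAlg R) :
    CAlg.Hom C.sisoCAlg S ≃ C.sisoSet S where
  toFun φ := ⟨ptOf (hα S) (homRes φ), ptOf_homRes_mem hα φ⟩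
  invFun a := sisoLift (valueLip a.1) ((mem_sisoSet_iff (hα S)).1 a.2).1
    ((mem_sisoSet_iff (hα S)).1 a.2).2.1
  left_inv φ := homRes_injective ((homRes_sisoLift _ ((mem_sisoSet_iff (hα S)).1
    (ptOf_homRes_mem hα φ)).1 _).trans (valueLip_ptOf (hα S) (homRes φ)))
  right_inv a := Subtype.ext (valueLip_injective (hα S) ((valueLip_ptOf (hα S) _).trans
    (homRes_sisoLift (valueLip a.1) ((mem_sisoSet_iff (hα S)).1 a.2).1 _)))

theorem value_sisoEquiv (hα : ∀ S : CAlg R, C.AlphaIso S) (φ : CAlg.Hom C.sisoCAlg S) (c : C.M) :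
    value (sisoEquiv hα S φ).1 c =
      φ.toRingHom (Ideal.Quotient.mk C.relIdeal (C.symι c)) :=
  congrArg (fun g : LipMap C.M S.asModule => g c) (valueLip_ptOf (hα S) (homRes φ))

/-- `SIso(C, σ)` is represented by `SIsoAlg`. -/
def sisoRep (hα : ∀ S : CAlg R, C.AlphaIso S) : C.SIso.CorepresentableBy C.sisoCAlg where
  homEquiv {S} := sisoEquiv hα S
  homEquiv_comp {S T} ψ φ := by
    -- Points are determined by their values, so naturality reduces to `a(c) = φ([c])` on both
    -- sides.
    refine Subtype.ext (valueLip_injective (hα T) (Subtype.ext (LinearMap.ext fun c => ?_)))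
    refine (value_sisoEquiv hα _ c).trans (Eq.trans ?_
      (C.value_ptsMap ψ (sisoEquiv hα S φ).1 c).symm)
    rw [value_sisoEquiv]; rfl

end InvComonoid

end

theorem mainTheorem2 (R : LipHalo.{u}) (C : InvComonoid R)
    (hα : ∀ S : CAlg R, C.AlphaIso S) :
    ∃ (A : CAlg R) (e : A.carrier ≃+* C.SIsoAlg),
      (∀ r, e (A.ρ r) = algebraMap R.carrier C.SIsoAlg r) ∧
      A.C = R.C ∧ A.D = R.D ∧
      (∃ K, ∀ x, A.nrm x ≤ K * C.quotNrm (e x)) ∧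
      (∃ K, ∀ x, C.quotNrm (e x) ≤ K * A.nrm x) ∧
      ∃ h : C.SIso.CorepresentableBy A, ∀ (S : CAlg R) (φ : A ⟶ S) (c : C.M.carrier),
        InvComonoid.value (h.homEquiv φ).1 c =
          φ.toRingHom (e.symm (Ideal.Quotient.mk C.relIdeal (C.symι c))) := by
  -- The underlying ring is the quotient itself and only its norm has changed. The constants of the
  -- equivalence are `max 1 R.D` and `C.quotNrm 1`.
  refine ⟨C.sisoCAlg, RingEquiv.refl C.SIsoAlg, fun _ => rfl, rfl, rfl,
    ⟨_, C.isAlgNrm_quotNrm.mulNrm_le_nrm⟩, ⟨_, C.isAlgNrm_quotNrm.nrm_le_mulNrm⟩,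
    InvComonoid.sisoRep hα, fun S φ c => ?_⟩
  exact InvComonoid.value_sisoEquiv hα φ c
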